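/- Let $n\ge 1$ and let $M\in\mathbb{R}^{n\times n}$ be a matrix of rank $r$ with compact singular value decomposition $M=U\Sigma V^\top$, where $U,V\in\mathbb{R}^{n\times r}$ have orthonormal columns and $\Sigma$ is an $r\times r$ diagonal matrix with positive diagonal entries. Let $\bar U,\bar V\in\mathbb{R}^{n\times\bar r}$ have orthonormal columns, with $\mathrm{col}(U)\subseteq\mathrm{col}(\bar U)$ and $\mathrm{col}(V)\subseteq\mathrm{col}(\bar V)$, where $\mathrm{col}$ denotes the column space. Suppose that $U,V$ are incoherent with parameter $\mu_0$ and $\bar U,\bar V$ are incoherent with parameter $\bar\mu_0$, i.e. for all $1\le i\le n$, with $e_i$ the $i$-th standard basis vector, $$\max\{\|U^\top e_i\|_2,\|V^\top e_i\|_2\}\le\sqrt{\frac{\mu_0 r}{n}},\qquad \max\{\|\bar U^\top e_i\|_2,\|\bar V^\top e_i\|_2\}\le\sqrt{\frac{\bar\mu_0\bar r}{n}}.$$ Let $\Omega\subseteq\{1,\dots,n\}^2$ be a random set that contains each index pair $(i,j)$ with probability $p\in[0,1]$, independently of all others, and let $\mathcal{P}_\Omega Z$ be the matrix that agrees with $Z$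 on $\Omega$ and is zero elsewhere. Let $\|\cdot\|_*$ denote the nuclear norm (the sum of the singular values). There exist universal constants $c_0,c_1,c_2>0$ (independent of all of the above data) such that, whenever $$p\ge c_0\,\frac{\mu_0\bar\mu_0 r\bar r\,\log(32\bar\mu_0\bar r)\,\log n}{n^2},$$ then with probability at least $1-c_1n^{-c_2}$ the matrix $X^*:=\bar U^\top M\bar V$ is the unique optimal solution of the program $$\min_{X\in\mathbb{R}^{\bar r\times\bar r}}\|X\|_*\quad\text{subject to}\quad \mathcal{P}_\Omega(\bar U X\bar V^\top)=\mathcal{P}_\Omega M.$$ -/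

import Mathlib

open scoped Matrix

noncomputable section

namespace StructuredCompletion

/-- `M = U Σ Vᵀ` is a rank-`r` (compact) singular value decomposition: the `r` columns of `U` and
of `V` are orthonormal and `Σ = diag σ` has strictly positive diagonal entries.  In particular
`M` has rank `r`. -/
structure IsCompactSVD {m n r : ℕ} (M : Matrix (Fin m) (Fin n) ℝ)
    (U : Matrix (Fin m) (Fin r) ℝ) (σ : Fin r → ℝ) (V : Matrix (Fin n) (Fin r) ℝ) : Prop where
  left_orthonormal : Uᵀ * U = 1
  right_orthonormal : Vᵀ * V = 1
  singular_pos : ∀ k, 0 < σ k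
  eq_mul : M = U * Matrix.diagonal σ * Vᵀ

/-- The standard incoherence condition with parameter `μ` for a pair of matrices with `r` columns:
`‖Uᵀ eᵢ‖₂ ≤ √(μ r / m)` for every row index `i` of `U` and `‖Vᵀ eⱼ‖₂ ≤ √(μ r / n)` for every
row index `j` of `V`. -/
def StandardIncoherence {m n r : ℕ} (U : Matrix (Fin m) (Fin r) ℝ)
    (V : Matrix (Fin n) (Fin r) ℝ) (μ : ℝ) : Prop :=
  (∀ i : Fin m, ‖WithLp.toLp 2 (Uᵀ *ᵥ Pi.single i 1)‖ ≤ √(μ * r / m)) ∧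
  (∀ j : Fin n, ‖WithLp.toLp 2 (Vᵀ *ᵥ Pi.single j 1)‖ ≤ √(μ * r / n))

/-- The column space of a matrix. -/
def col {m n : ℕ} (A : Matrix (Fin m) (Fin n) ℝ) : Submodule ℝ (Fin m → ℝ) :=
  Submodule.span ℝ (Set.range Aᵀ)

/-- The nuclear norm: the sum of the singular values. -/
def nuclearNorm {m n : ℕ} (A : Matrix (Fin m) (Fin n) ℝ) : ℝ :=
  (Matrix.toEuclideanLin A).singularValues.sum fun _ s => s

open Classical in
/-- `P_Ω Z` keeps the entries of `Z` indexed by `Ω` and sets all others to zero. -/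
def proj {m n : ℕ} (Ω : Set (Fin m × Fin n)) (Z : Matrix (Fin m) (Fin n) ℝ) :
    Matrix (Fin m) (Fin n) ℝ :=
  Matrix.of fun i j => if (i, j) ∈ Ω then Z i j else 0

/-- `X` is feasible for the program `min ‖X‖_*` subject to `P_Ω (Ū X V̄ᵀ) = P_Ω M`. -/
def IsFeasible {n s : ℕ} (Ubar Vbar : Matrix (Fin n) (Fin s) ℝ) (M : Matrix (Fin n) (Fin n) ℝ)
    (Ω : Set (Fin n × Fin n)) (X : Matrix (Fin s) (Fin s) ℝ) : Prop :=
  proj Ω (Ubar * X * Vbarᵀ) = proj Ω M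

/-- `X` is an optimal solution of the program `min ‖X‖_*` subject to
`P_Ω (Ū X V̄ᵀ) = P_Ω M`. -/
def IsOptimal {n s : ℕ} (Ubar Vbar : Matrix (Fin n) (Fin s) ℝ) (M : Matrix (Fin n) (Fin n) ℝ)
    (Ω : Set (Fin n × Fin n)) (X : Matrix (Fin s) (Fin s) ℝ) : Prop :=
  IsFeasible Ubar Vbar M Ω X ∧
    ∀ Y, IsFeasible Ubar Vbar M Ω Y → nuclearNorm X ≤ nuclearNorm Y

/-- `X` is the unique optimal solution of that program. -/
def IsUniqueOptimal {n s : ℕ} (Ubar Vbar : Matrix (Fin n) (Fin s) ℝ)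
    (M : Matrix (Fin n) (Fin n) ℝ) (Ω : Set (Fin n × Fin n)) (X : Matrix (Fin s) (Fin s) ℝ) :
    Prop :=
  IsOptimal Ubar Vbar M Ω X ∧ ∀ Y, IsOptimal Ubar Vbar M Ω Y → Y = X

/-- The law of the random set of observed indices in the Bernoulli model: each of the `n²` index
pairs belongs to it with probability `p`, independently of all others. -/
abbrev observationLaw (n : ℕ) (p : unitInterval) : MeasureTheory.Measure (Set (Fin n × Fin n)) :=
  ProbabilityTheory.setBernoulli Set.univ p

end StructuredCompletion

end

/-! Let `u_a`, `v_b` be the rows of `Ubar`, `Vbar`. The program is matrix completion for `s × s`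
matrices from the measurements `u_aᵀ X v_b`, and `X*` has singular frames `Ubarᵀ U`, `Vbarᵀ V`. The
atoms `u_a v_bᵀ` form a Parseval frame. Rows have squared norm at most `B ~ μbar₀ rbar / n`; their
projections to the singular spaces have squared norm at most `A ~ μ₀ r / n`.

Let `T` be the orthogonal projection to the tangent space at `X*`. By nuclear norm duality
(`nuclearNorm_lt_of_certificate`) every unobserved `H ≠ 0` increases the norm as soon as `‖T H‖² ≤ κ
‖H - T H‖²` in Frobenius norm and some combination `Y` of observed atoms has `T Y` close to `U Vᵀ`
and `‖Y - T Y‖ ≤ 1/2`.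

The certificate comes from golfing: a fresh batch of samples replaces the residual `W` by `T (W - R
W)`, with `R` the empirical sampling operator. Entries, rows and columns of `W` are tracked
together, since they are the uniform and variance bounds that matrix Bernstein needs; all of them
halve with high probability. Projected atoms have squared norm of order `A B` rather than `B²`, so a
batch needs rate of order `A B log n`. The residual only has to beat `κ`, of order `n B`, so about
`log (32 n B)` batches suffice.

Matrix Bernstein is proved by the Laplace transform and Golden–Thompson. Independent batches are
modelled by lazy draws, which return a given point with the probability that a Bernoulli set is
exactly that singleton. For increasing events such draws are dominated by a Bernoulli set of the
summed rate (`lazyExp_bernExp_le`), and recovery is increasing in the observed set. -/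

section

open scoped Matrix.Norms.L2Operator
open NormedSpace (exp)
open Filter Topology

/-! ### The Golden–Thompson inequality -/

section GoldenThompson

variable {d : Type*} [Fintype d]

theorem Matrix.trace_mul_conjTranspose_self_nonneg (X : Matrix d d ℝ) :
    0 ≤ (X * Xᴴ).trace :=
  (Matrix.posSemidef_self_mul_conjTranspose X).trace_nonneg

variable [DecidableEq d]

theorem Matrix.trace_mul_pow_comm (X Y : Matrix d d ℝ) (m : ℕ) :
    ((X * Y) ^ m).trace = ((Y * X) ^ m).trace := by
  cases m with
  | zero => simp
  | succ m =>
    have h : ∀ k : ℕ, (X * Y) ^ k * X = X * (Y * X) ^ k := by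
      intro k
      induction k with
      | zero => simp
      | succ k ih => rw [pow_succ', mul_assoc, ih, pow_succ']; simp only [mul_assoc]
    rw [pow_succ, ← mul_assoc, h, mul_assoc, Matrix.trace_mul_comm, pow_succ]
    simp only [mul_assoc]

theorem Matrix.trace_mul_le_of_isHermitian {P Q : Matrix d d ℝ} (hP : P.IsHermitian)
    (hQ : Q.IsHermitian) : 2 * (P * Q).trace ≤ (P ^ 2).trace + (Q ^ 2).trace := by
  have h := Matrix.trace_mul_conjTranspose_self_nonneg (P - Q)
  rw [(hP.sub hQ).eq] at h
  have e : (P - Q) * (P - Q) = P ^ 2 + Q ^ 2 - (P * Q + Q * P) := by noncomm_ring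
  rw [e, Matrix.trace_sub, Matrix.trace_add, Matrix.trace_add, Matrix.trace_mul_comm Q P] at h
  linarith

/-- The trace inequalities for dyadic powers behind the Golden--Thompson inequality. -/
theorem Matrix.trace_dyadic_pow_le (k : ℕ) :
    (∀ A B : Matrix d d ℝ, A.IsHermitian → B.IsHermitian →
      ((A * B) ^ 2 ^ k).trace ≤ (A ^ 2 ^ k * B ^ 2 ^ k).trace) ∧
    ∀ X : Matrix d d ℝ, (X ^ 2 ^ (k + 1)).trace ≤ ((X * Xᴴ) ^ 2 ^ k).trace := by
  induction k with
  | zero =>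
    refine ⟨fun A B _ _ => by simp, fun X => ?_⟩
    have h := Matrix.trace_mul_conjTranspose_self_nonneg (X - Xᴴ)
    have e : (X - Xᴴ) * (X - Xᴴ)ᴴ = X * Xᴴ + Xᴴ * X - X * X - (X * X)ᴴ := by
      rw [Matrix.conjTranspose_sub, Matrix.conjTranspose_conjTranspose, Matrix.conjTranspose_mul]
      noncomm_ring
    rw [e, Matrix.trace_sub, Matrix.trace_sub, Matrix.trace_add, Matrix.trace_mul_comm Xᴴ X,
      Matrix.trace_conjTranspose] at h
    simp only [star_trivial] at h
    simp only [zero_add, pow_one, pow_zero, sq]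
    linarith
  | succ k ih =>
    obtain ⟨hG, hH⟩ := ih
    -- The two families feed each other. The second at `k + 1` is the second at `k` for `X²`, cycled
    -- to `(X Xᴴ)(Xᴴ X)`, then the first at `k` and `2 tr PQ ≤ tr P² + tr Q²` with equal traces on
    -- the right. The first at `k + 1` is the second at `k` for `A B`, then the first at `k` for
    -- `A²` and `B²`.
    have hH' : ∀ X : Matrix d d ℝ,
        (X ^ 2 ^ (k + 1 + 1)).trace ≤ ((X * Xᴴ) ^ 2 ^ (k + 1)).trace := by
      intro X
      have h1 := hH (X * X)
      have e1 : (X * X) ^ 2 ^ (k + 1) = X ^ 2 ^ (k + 1 + 1) := by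
        rw [← sq, ← pow_mul, pow_succ 2 (k + 1), mul_comm]
      have e2 : X * X * (X * X)ᴴ = X * (X * Xᴴ * Xᴴ) := by
        rw [Matrix.conjTranspose_mul]; simp only [mul_assoc]
      rw [e1, e2, Matrix.trace_mul_pow_comm] at h1
      have e3 : X * Xᴴ * Xᴴ * X = (X * Xᴴ) * (Xᴴ * X) := by simp only [mul_assoc]
      rw [e3] at h1
      have s1 : (X * Xᴴ).IsHermitian := Matrix.isHermitian_mul_conjTranspose_self X
      have s2 : (Xᴴ * X).IsHermitian := Matrix.isHermitian_conjTranspose_mul_self X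
      have h2 := hG _ _ s1 s2
      have h3 := Matrix.trace_mul_le_of_isHermitian (s1.pow (2 ^ k)) (s2.pow (2 ^ k))
      rw [← pow_mul, ← pow_mul, ← pow_succ, Matrix.trace_mul_pow_comm Xᴴ X] at h3
      linarith
    refine ⟨fun A B hA hB => ?_, hH'⟩
    have h1 := hH (A * B)
    have e1 : A * B * (A * B)ᴴ = A * (B * B * A) := by
      rw [Matrix.conjTranspose_mul, hA.eq, hB.eq]; simp only [mul_assoc]
    rw [e1, Matrix.trace_mul_pow_comm A (B * B * A)] at h1
    have e2 : B * B * A * A = (B ^ 2) * (A ^ 2) := by simp only [mul_assoc, sq]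
    rw [e2, Matrix.trace_mul_pow_comm (B ^ 2)] at h1
    have h2 := hG _ _ (hA.pow 2) (hB.pow 2)
    rw [← pow_mul, ← pow_mul, ← pow_succ'] at h2
    exact h1.trans h2

theorem norm_pow_sub_pow_le {R : Type*} [NormedRing R] [NormOneClass R] {x y : R} {C : ℝ}
    (hx : ‖x‖ ≤ C) (hy : ‖y‖ ≤ C) (n : ℕ) :
    ‖x ^ (n + 1) - y ^ (n + 1)‖ ≤ (n + 1) * C ^ n * ‖x - y‖ := by
  have hC : 0 ≤ C := (norm_nonneg x).trans hx
  induction n with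
  | zero => simp
  | succ n ih =>
    have e : x ^ (n + 1 + 1) - y ^ (n + 1 + 1)
        = x ^ (n + 1) * (x - y) + (x ^ (n + 1) - y ^ (n + 1)) * y := by
      rw [pow_succ x (n + 1), pow_succ y (n + 1)]; noncomm_ring
    rw [e]
    have h1 : ‖x ^ (n + 1)‖ ≤ C ^ (n + 1) :=
      (norm_pow_le _ _).trans (pow_le_pow_left₀ (norm_nonneg _) hx _)
    calc _ ≤ ‖x ^ (n + 1)‖ * ‖x - y‖ + ‖x ^ (n + 1) - y ^ (n + 1)‖ * ‖y‖ :=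
          (norm_add_le _ _).trans (add_le_add (norm_mul_le _ _) (norm_mul_le _ _))
      _ ≤ C ^ (n + 1) * ‖x - y‖ + ((n + 1) * C ^ n * ‖x - y‖) * C := by gcongr
      _ = _ := by push_cast; ring

theorem norm_exp_le_exp_norm {R : Type*} [NormedRing R] [NormOneClass R] [NormedAlgebra ℝ R]
    [CompleteSpace R] (x : R) : ‖exp x‖ ≤ Real.exp ‖x‖ := by
  rw [NormedSpace.exp_eq_tsum ℝ, Real.exp_eq_exp_ℝ, NormedSpace.exp_eq_tsum ℝ]
  refine tsum_of_norm_bounded (NormedSpace.expSeries_summable' (𝕂 := ℝ) ‖x‖).hasSum fun n => ?_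
  rw [norm_smul, smul_eq_mul]
  rw [Real.norm_of_nonneg (by positivity)]
  gcongr
  exact norm_pow_le _ _

/-- The Lie product formula along dyadic integers. -/
theorem tendsto_exp_mul_exp_pow {R : Type*} [NormedRing R] [NormOneClass R] [NormedAlgebra ℝ R]
    [CompleteSpace R] (A B : R) :
    Tendsto (fun k : ℕ => (exp (((2 ^ k : ℕ) : ℝ)⁻¹ • A) * exp (((2 ^ k : ℕ) : ℝ)⁻¹ • B)) ^ 2 ^ k)
      atTop (𝓝 (exp (A + B))) := by
  let : NormedAlgebra ℚ R := NormedAlgebra.restrictScalars ℚ ℝ R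
  set g : ℝ → R := fun t => exp (t • A) * exp (t • B) - exp (t • (A + B)) with hg
  -- Thus `g t = o(t)` and `2 ^ k ‖g (2 ^ (-k))‖ → 0`; passing to the `2 ^ k`-th power multiplies
  -- this by at most `C`, uniformly in `k`.
  have hd : HasDerivAt g 0 0 := by
    have h1 := hasDerivAt_exp_smul_const A (0 : ℝ)
    have h2 := hasDerivAt_exp_smul_const B (0 : ℝ)
    have h3 := hasDerivAt_exp_smul_const (A + B) (0 : ℝ)
    have h := (h1.mul h2).sub h3
    exact h.congr_deriv (by simp [zero_smul, NormedSpace.exp_zero])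
  have hg0 : g 0 = 0 := by simp [hg]
  have hs : Tendsto (fun k : ℕ => ((2 ^ k : ℕ) : ℝ)⁻¹) atTop (𝓝[≠] 0) := by
    refine tendsto_nhdsWithin_iff.2 ⟨?_, Eventually.of_forall fun k => by simp⟩
    exact tendsto_inv_atTop_zero.comp
      (tendsto_natCast_atTop_atTop.comp (tendsto_pow_atTop_atTop_of_one_lt one_lt_two))
  have hslope := (hasDerivAt_iff_tendsto_slope.1 hd).comp hs
  have hlim : Tendsto (fun k : ℕ => (2 ^ k : ℕ) * ‖g (((2 ^ k : ℕ) : ℝ)⁻¹)‖) atTop (𝓝 0) := by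
    have := hslope.norm
    rw [norm_zero] at this
    refine this.congr fun k => ?_
    simp [slope, hg0, norm_smul]
  rw [tendsto_iff_norm_sub_tendsto_zero]
  set C := Real.exp (‖A‖ + ‖B‖) with hC
  refine squeeze_zero (fun _ => norm_nonneg _) (fun k => ?_) (by rw [← mul_zero C]; exact hlim.const_mul C)
  obtain ⟨n, hn⟩ : ∃ n, 2 ^ k = n + 1 := ⟨2 ^ k - 1, (Nat.sub_add_cancel Nat.one_le_two_pow).symm⟩
  set s : ℝ := ((2 ^ k : ℕ) : ℝ)⁻¹ with hs'
  have hs0 : 0 ≤ s := by positivity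
  have hns : ((n + 1 : ℕ) : ℝ) * s = 1 := by
    rw [hs', hn]; exact mul_inv_cancel₀ (by positivity)
  have e : exp (A + B) = exp (s • (A + B)) ^ (n + 1) := by
    rw [← NormedSpace.exp_nsmul, ← Nat.cast_smul_eq_nsmul ℝ, smul_smul, hns, one_smul]
  have hX : ‖exp (s • A) * exp (s • B)‖ ≤ Real.exp (s * (‖A‖ + ‖B‖)) := by
    rw [mul_add, Real.exp_add]
    refine (norm_mul_le _ _).trans ?_
    gcongr
    · exact (norm_exp_le_exp_norm _).trans (by rw [norm_smul, Real.norm_of_nonneg hs0])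
    · exact (norm_exp_le_exp_norm _).trans (by rw [norm_smul, Real.norm_of_nonneg hs0])
  have hY : ‖exp (s • (A + B))‖ ≤ Real.exp (s * (‖A‖ + ‖B‖)) := by
    refine (norm_exp_le_exp_norm _).trans ?_
    rw [norm_smul, Real.norm_of_nonneg hs0]
    gcongr
    exact norm_add_le _ _
  have hpow : Real.exp (s * (‖A‖ + ‖B‖)) ^ n ≤ C := by
    rw [← Real.exp_nat_mul, hC]
    apply Real.exp_le_exp.2
    push_cast at hns
    have : (n : ℝ) * s ≤ 1 := by linarith
    nlinarith [norm_nonneg A, norm_nonneg B]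
  rw [e, hn]
  calc _ ≤ (n + 1) * Real.exp (s * (‖A‖ + ‖B‖)) ^ n * ‖g s‖ := norm_pow_sub_pow_le hX hY n
    _ ≤ (n + 1) * C * ‖g s‖ := by gcongr
    _ = C * (((n + 1 : ℕ) : ℝ) * ‖g s‖) := by push_cast; ring
    _ ≤ _ := by rw [← hn]

instance Matrix.l2_normOneClass [Nonempty d] : NormOneClass (Matrix d d ℝ) :=
  ⟨by rw [← Matrix.diagonal_one, Matrix.l2_opNorm_diagonal]; simp⟩

/-- The **Golden--Thompson inequality** for real symmetric matrices. -/
theorem Matrix.trace_exp_add_le {A B : Matrix d d ℝ} (hA : A.IsHermitian) (hB : B.IsHermitian) :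
    (exp (A + B)).trace ≤ (exp A * exp B).trace := by
  cases isEmpty_or_nonempty d
  · simp [Matrix.trace]
  let : NormedAlgebra ℚ (Matrix d d ℝ) := NormedAlgebra.restrictScalars ℚ ℝ _
  have ht : Continuous (Matrix.trace : Matrix d d ℝ → ℝ) := continuous_id.matrix_trace
  refine le_of_tendsto ((ht.tendsto _).comp (tendsto_exp_mul_exp_pow A B))
    (Eventually.of_forall fun k => ?_)
  have h := (Matrix.trace_dyadic_pow_le (d := d) k).1
    (exp (((2 ^ k : ℕ) : ℝ)⁻¹ • A)) (exp (((2 ^ k : ℕ) : ℝ)⁻¹ • B))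
    (Matrix.IsHermitian.exp (by rw [Matrix.IsHermitian, Matrix.conjTranspose_smul, hA.eq]; simp))
    (Matrix.IsHermitian.exp (by rw [Matrix.IsHermitian, Matrix.conjTranspose_smul, hB.eq]; simp))
  have e : ∀ Z : Matrix d d ℝ, exp (((2 ^ k : ℕ) : ℝ)⁻¹ • Z) ^ 2 ^ k = exp Z := by
    intro Z
    rw [← NormedSpace.exp_nsmul, ← Nat.cast_smul_eq_nsmul ℝ, smul_smul, mul_inv_cancel₀, one_smul]
    positivity
  rw [e, e] at h
  exact h

end GoldenThompson

end

section

open scoped Matrix.Norms.L2Operator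
open NormedSpace (exp)
open Filter Topology

/-! ### Spectral estimates for matrix exponentials -/

section SpectralBounds

variable {d : Type*} [Fintype d] [DecidableEq d]

theorem Matrix.IsHermitian.exists_eq_mul_diagonal_mul {H : Matrix d d ℝ} (hH : H.IsHermitian) :
    ∃ (U : Matrix d d ℝ) (v : d → ℝ), U * Uᴴ = 1 ∧ Uᴴ * U = 1 ∧
      H = U * Matrix.diagonal v * Uᴴ := by
  refine ⟨hH.eigenvectorUnitary, hH.eigenvalues, ?_, ?_, ?_⟩
  · exact Unitary.mul_star_self_of_mem hH.eigenvectorUnitary.2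
  · exact Unitary.star_mul_self_of_mem hH.eigenvectorUnitary.2
  · have h := hH.spectral_theorem
    rw [Unitary.conjStarAlgAut_apply] at h
    exact h

theorem Matrix.exp_conj_diagonal {U : Matrix d d ℝ} (v : d → ℝ) (h : U * Uᴴ = 1) :
    exp (U * Matrix.diagonal v * Uᴴ) = U * Matrix.diagonal (fun i => Real.exp (v i)) * Uᴴ := by
  have hinv : U⁻¹ = Uᴴ := Matrix.inv_eq_right_inv h
  have hu : IsUnit U := ⟨⟨U, Uᴴ, h, mul_eq_one_comm.1 h⟩, rfl⟩
  rw [← hinv, Matrix.exp_conj _ _ hu, Matrix.exp_diagonal]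
  congr 3
  ext i
  rw [Pi.coe_exp, Real.exp_eq_exp_ℝ]

theorem Matrix.norm_conj_diagonal {U : Matrix d d ℝ} (v : d → ℝ) (h : U * Uᴴ = 1)
    (h' : Uᴴ * U = 1) : ‖U * Matrix.diagonal v * Uᴴ‖ = ‖v‖ := by
  have hU : U ∈ unitary (Matrix d d ℝ) := ⟨h', h⟩
  have hU' : Uᴴ ∈ unitary (Matrix d d ℝ) := Unitary.star_mem hU
  rw [CStarRing.norm_mul_mem_unitary _ hU', CStarRing.norm_mem_unitary_mul _ hU,
    Matrix.l2_opNorm_diagonal]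

theorem Matrix.trace_conj_diagonal {U : Matrix d d ℝ} (v : d → ℝ) (h' : Uᴴ * U = 1) :
    (U * Matrix.diagonal v * Uᴴ).trace = ∑ i, v i := by
  rw [Matrix.trace_mul_comm, ← mul_assoc, h', one_mul, Matrix.trace_diagonal]

/-- The eigenvalue of largest modulus contributes `exp ‖H‖` to one of the two traces, and all other
contributions are positive. -/
theorem Matrix.exp_norm_le_trace_exp [Nonempty d] {H : Matrix d d ℝ} (hH : H.IsHermitian) :
    Real.exp ‖H‖ ≤ (exp H).trace + (exp (-H)).trace := by
  obtain ⟨U, v, h, h', rfl⟩ := hH.exists_eq_mul_diagonal_mul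
  have hneg : -(U * Matrix.diagonal v * Uᴴ) = U * Matrix.diagonal (fun i => -v i) * Uᴴ := by
    rw [← Matrix.diagonal_neg, mul_neg, neg_mul]
  rw [hneg, Matrix.exp_conj_diagonal _ h, Matrix.exp_conj_diagonal _ h,
    Matrix.trace_conj_diagonal _ h', Matrix.trace_conj_diagonal _ h',
    Matrix.norm_conj_diagonal _ h h', ← Finset.sum_add_distrib]
  obtain ⟨i, hi⟩ : ∃ i, ‖v‖ = ‖v i‖ := by
    obtain ⟨i, -, hi⟩ := Finset.exists_mem_eq_sup Finset.univ Finset.univ_nonempty fun i => ‖v i‖₊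
    exact ⟨i, by rw [Pi.norm_def, hi]; rfl⟩
  rw [hi]
  refine le_trans ?_ (Finset.single_le_sum (f := fun i => Real.exp (v i) + Real.exp (-v i))
    (fun j _ => by positivity) (Finset.mem_univ i))
  simp only [Real.norm_eq_abs]
  rcases abs_choice (v i) with h | h <;> rw [h]
  · linarith [Real.exp_pos (-v i)]
  · linarith [Real.exp_pos (v i)]

/-- Diagonalising reduces this to `exp x ≤ 1 + x + x²` for `|x| ≤ 1`. -/
theorem Matrix.posSemidef_quadratic_sub_exp {H : Matrix d d ℝ} (hH : H.IsHermitian)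
    (h1 : ‖H‖ ≤ 1) : (1 + H + H * H - exp H).PosSemidef := by
  obtain ⟨U, v, h, h', rfl⟩ := hH.exists_eq_mul_diagonal_mul
  rw [Matrix.norm_conj_diagonal _ h h'] at h1
  have e : 1 + U * Matrix.diagonal v * Uᴴ + U * Matrix.diagonal v * Uᴴ * (U * Matrix.diagonal v * Uᴴ)
      - exp (U * Matrix.diagonal v * Uᴴ)
      = U * Matrix.diagonal (fun i => 1 + v i + v i * v i - Real.exp (v i)) * Uᴴ := by
    rw [Matrix.exp_conj_diagonal _ h]
    have e1 : (1 : Matrix d d ℝ) = U * Matrix.diagonal (fun _ => (1 : ℝ)) * Uᴴ := by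
      rw [Matrix.diagonal_one, mul_one, h]
    have e2 : U * Matrix.diagonal v * Uᴴ * (U * Matrix.diagonal v * Uᴴ)
        = U * Matrix.diagonal (fun i => v i * v i) * Uᴴ := by
      rw [← Matrix.diagonal_mul_diagonal]
      calc _ = U * Matrix.diagonal v * (Uᴴ * U) * Matrix.diagonal v * Uᴴ := by
            simp only [mul_assoc]
        _ = _ := by rw [h', mul_one]; simp only [mul_assoc]
    rw [e2]
    nth_rewrite 1 [e1]
    rw [← add_mul, ← add_mul, ← sub_mul, ← mul_add, ← mul_add, ← mul_sub]
    simp only [Matrix.diagonal_add, Matrix.diagonal_sub]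
  rw [e]
  refine Matrix.PosSemidef.mul_mul_conjTranspose_same (Matrix.PosSemidef.diagonal fun i => ?_) U
  have hv : |v i| ≤ 1 := (norm_le_pi_norm v i).trans h1
  have := Real.abs_exp_sub_one_sub_id_le hv
  simp only [Pi.zero_apply]
  nlinarith [abs_le.1 this]

theorem Matrix.posSemidef_exp {H : Matrix d d ℝ} (hH : H.IsHermitian) :
    (exp H).PosSemidef := by
  obtain ⟨U, v, h, h', rfl⟩ := hH.exists_eq_mul_diagonal_mul
  rw [Matrix.exp_conj_diagonal _ h]
  exact Matrix.PosSemidef.mul_mul_conjTranspose_same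
    (Matrix.PosSemidef.diagonal fun i => (Real.exp_pos _).le) U

theorem Matrix.PosSemidef.trace_mul_nonneg {A B : Matrix d d ℝ} (hA : A.PosSemidef)
    (hB : B.PosSemidef) : 0 ≤ (A * B).trace := by
  obtain ⟨U, v, h, h', e⟩ := hB.isHermitian.exists_eq_mul_diagonal_mul
  have hv : ∀ i, 0 ≤ v i := by
    have h2 := hB.conjTranspose_mul_mul_same U
    have e2 : Uᴴ * B * U = Matrix.diagonal v := by
      rw [e]
      calc _ = (Uᴴ * U) * Matrix.diagonal v * (Uᴴ * U) := by simp only [mul_assoc]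
        _ = _ := by rw [h', one_mul, mul_one]
    rw [e2] at h2
    exact fun i => by simpa using h2.diag_nonneg (i := i)
  rw [e, ← mul_assoc, Matrix.trace_mul_comm, ← mul_assoc, ← mul_assoc]
  have h3 := hA.conjTranspose_mul_mul_same U
  simp only [Matrix.trace, Matrix.diag, Matrix.mul_diagonal]
  exact Finset.sum_nonneg fun i _ => mul_nonneg h3.diag_nonneg (hv i)

end SpectralBounds

/-! ### Expectations over lazy draws -/

section LazySampling

variable {ι : Type*} [Fintype ι]

/-- Expectation over the list of points seen in `m` independent lazy draws: each draw returns each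
point of `ι` with probability `w` and nothing otherwise. -/
noncomputable def lazyExp (w : ℝ) : ℕ → (List ι → ℝ) → ℝ
  | 0, F => F []
  | m + 1, F => (1 - Fintype.card ι * w) * lazyExp w m F + w * ∑ x, lazyExp w m fun l => F (x :: l)

theorem lazyExp_add (w : ℝ) (m : ℕ) (F G : List ι → ℝ) :
    lazyExp w m (fun l => F l + G l) = lazyExp w m F + lazyExp w m G := by
  induction m generalizing F G with
  | zero => rfl
  | succ m ih => simp only [lazyExp, ih, Finset.sum_add_distrib]; ring

theorem lazyExp_const_mul (w : ℝ) (m : ℕ) (c : ℝ) (F : List ι → ℝ) :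
    lazyExp w m (fun l => c * F l) = c * lazyExp w m F := by
  induction m generalizing F with
  | zero => rfl
  | succ m ih => simp only [lazyExp, ih, ← Finset.mul_sum]; ring

theorem lazyExp_const (w : ℝ) (m : ℕ) (c : ℝ) :
    lazyExp w m (fun _ : List ι => c) = c := by
  induction m with
  | zero => rfl
  | succ m ih => simp only [lazyExp, ih, Finset.sum_const, Finset.card_univ, nsmul_eq_mul]; ring

theorem lazyExp_mono {w : ℝ} (hw : 0 ≤ w) (hw1 : Fintype.card ι * w ≤ 1) (m : ℕ)
    {F G : List ι → ℝ} (h : ∀ l, F l ≤ G l) : lazyExp w m F ≤ lazyExp w m G := by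
  induction m generalizing F G with
  | zero => exact h _
  | succ m ih =>
    simp only [lazyExp]
    have : 0 ≤ 1 - Fintype.card ι * w := by linarith
    gcongr
    · exact ih h
    · exact ih fun l => h _

end LazySampling

/-! ### The matrix Laplace transform of a sum of lazy draws -/

section MatrixBernstein

variable {ι d : Type*} [Fintype ι] [Fintype d] [DecidableEq d]

/-- Golden–Thompson detaches `exp G`, so it suffices that the mean exponential of the centred
increment is at most `1 + v` in the Loewner order. The increment is `H x - D`, or `-D` for an empty
draw, with `D` the mean. In `exp Z ≤ 1 + Z + Z²` the linear terms average to zero and the quadratic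
ones to the variance `w ∑ H² - D²`. -/
theorem Matrix.trace_exp_lazy_step {w v : ℝ} (hw : 0 ≤ w) (hw1 : Fintype.card ι * w ≤ 1)
    (H : ι → Matrix d d ℝ) (hH : ∀ x, (H x).IsHermitian) (hn : ∀ x, ‖H x‖ ≤ 1 / 2)
    (hv : ∀ z : d → ℝ, w * ∑ x, (H x *ᵥ z) ⬝ᵥ (H x *ᵥ z) ≤ v * (z ⬝ᵥ z))
    {G : Matrix d d ℝ} (hG : G.IsHermitian) :
    (1 - Fintype.card ι * w) * (exp (G - w • ∑ x, H x)).trace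
      + w * ∑ x, (exp (G + H x - w • ∑ x, H x)).trace ≤ (1 + v) * (exp G).trace := by
  set D := w • ∑ x, H x with hD
  have hDh : D.IsHermitian := by
    rw [hD, Matrix.IsHermitian, Matrix.conjTranspose_smul, Matrix.conjTranspose_sum]
    simp only [star_trivial, (hH _).eq]
  have hDn : ‖D‖ ≤ 1 / 2 := by
    rw [hD, norm_smul, Real.norm_of_nonneg hw]
    calc w * ‖∑ x, H x‖ ≤ w * ∑ x : ι, (1 / 2 : ℝ) := by
          gcongr
          exact norm_sum_le_of_le _ fun x _ => hn x
      _ = (Fintype.card ι * w) * (1 / 2) := by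
          rw [Finset.sum_const, Finset.card_univ, nsmul_eq_mul]; ring
      _ ≤ 1 * (1 / 2) := by gcongr
      _ = _ := one_mul _
  have h0 : 0 ≤ 1 - Fintype.card ι * w := by linarith
  have hdiff : ∀ x, ‖H x - D‖ ≤ 1 := fun x => (norm_sub_le _ _).trans (by linarith [hn x])
  have hnegD : ‖-D‖ ≤ 1 := by rw [norm_neg]; linarith
  have g1 : (exp (G - D)).trace ≤ (exp G * exp (-D)).trace := by
    rw [sub_eq_add_neg]; exact Matrix.trace_exp_add_le hG hDh.neg
  have g2 : ∀ x, (exp (G + H x - D)).trace ≤ (exp G * exp (H x - D)).trace := fun x => by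
    rw [add_sub_assoc]; exact Matrix.trace_exp_add_le hG ((hH x).sub hDh)
  set E := (1 - Fintype.card ι * w) • exp (-D) + w • ∑ x, exp (H x - D) with hE
  have hpsd : ((1 + v) • (1 : Matrix d d ℝ) - E).PosSemidef := by
    have p1 := (Matrix.posSemidef_quadratic_sub_exp hDh.neg hnegD).smul h0
    have p2 : (w • ∑ x, (1 + (H x - D) + (H x - D) * (H x - D) - exp (H x - D))).PosSemidef :=
      (Matrix.posSemidef_sum _ fun x _ =>
        Matrix.posSemidef_quadratic_sub_exp ((hH x).sub hDh) (hdiff x)).smul hw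
    have p3 : (v • (1 : Matrix d d ℝ) - w • ∑ x, H x * H x + D * D).PosSemidef := by
      refine Matrix.PosSemidef.of_dotProduct_mulVec_nonneg ?_ fun z => ?_
      · refine Matrix.IsHermitian.add (Matrix.IsHermitian.sub ?_ ?_) ?_
        · rw [Matrix.IsHermitian, Matrix.conjTranspose_smul, Matrix.conjTranspose_one, star_trivial]
        · rw [Matrix.IsHermitian, Matrix.conjTranspose_smul, Matrix.conjTranspose_sum]
          simp only [star_trivial, Matrix.conjTranspose_mul, (hH _).eq]
        · rw [Matrix.IsHermitian, Matrix.conjTranspose_mul, hDh.eq]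
      · have key : ∀ A : Matrix d d ℝ, A.IsHermitian →
            z ⬝ᵥ (A * A) *ᵥ z = (A *ᵥ z) ⬝ᵥ (A *ᵥ z) := by
          intro A hA
          rw [← Matrix.mulVec_mulVec, Matrix.dotProduct_mulVec, ← Matrix.mulVec_transpose]
          rw [← Matrix.conjTranspose_eq_transpose_of_trivial, hA.eq]
        rw [star_trivial, Matrix.add_mulVec, Matrix.sub_mulVec, dotProduct_add, dotProduct_sub,
          Matrix.smul_mulVec, Matrix.smul_mulVec, Matrix.one_mulVec, key D hDh,
          dotProduct_smul, dotProduct_smul, Matrix.sum_mulVec, dotProduct_sum]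
        simp only [key _ (hH _), smul_eq_mul]
        have := hv z
        have h2 : 0 ≤ (D *ᵥ z) ⬝ᵥ (D *ᵥ z) := by
          simpa using dotProduct_star_self_nonneg (D *ᵥ z)
        linarith
    have e : (1 + v) • (1 : Matrix d d ℝ) - E
        = (1 - Fintype.card ι * w) • (1 + -D + -D * -D - exp (-D))
          + w • ∑ x, (1 + (H x - D) + (H x - D) * (H x - D) - exp (H x - D))
          + (v • (1 : Matrix d d ℝ) - w • ∑ x, H x * H x + D * D) := by
      have s1 : ∑ x, (1 + (H x - D) + (H x - D) * (H x - D) - exp (H x - D))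
          = (Fintype.card ι : ℝ) • (1 - D + D * D) + ∑ x, H x + ∑ x, H x * H x
            - (∑ x, H x) * D - D * (∑ x, H x) - ∑ x, exp (H x - D) := by
        rw [Finset.sum_mul, Finset.mul_sum]
        have : ∀ x, 1 + (H x - D) + (H x - D) * (H x - D) - exp (H x - D)
            = (1 - D + D * D) + H x + H x * H x - H x * D - D * H x - exp (H x - D) := by
          intro x; noncomm_ring
        simp only [this, Finset.sum_sub_distrib, Finset.sum_add_distrib, Finset.sum_const,
          Finset.card_univ, Nat.cast_smul_eq_nsmul, smul_add, smul_sub]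
      have s2 : w • ((∑ x, H x) * D) = D * D := by rw [← smul_mul_assoc]
      have s3 : w • (D * (∑ x, H x)) = D * D := by rw [← mul_smul_comm]
      rw [s1, hE]
      simp only [smul_sub, smul_add, s2, s3, ← hD, neg_mul_neg, smul_smul, sub_smul, add_smul,
        one_smul, smul_neg, mul_comm (Fintype.card ι : ℝ) w]
      abel
    rw [e]
    exact (p1.add p2).add p3
  have ht := (Matrix.posSemidef_exp hG).trace_mul_nonneg hpsd
  rw [mul_sub, Matrix.trace_sub, mul_smul_comm, mul_one, Matrix.trace_smul, smul_eq_mul] at ht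
  have hEt : (exp G * E).trace = (1 - Fintype.card ι * w) * (exp G * exp (-D)).trace
      + w * ∑ x, (exp G * exp (H x - D)).trace := by
    rw [hE, mul_add, Matrix.trace_add, mul_smul_comm, mul_smul_comm, Matrix.trace_smul,
      Matrix.trace_smul, Finset.mul_sum, Matrix.trace_sum, smul_eq_mul, smul_eq_mul]
  calc _ ≤ (1 - Fintype.card ι * w) * (exp G * exp (-D)).trace
      + w * ∑ x, (exp G * exp (H x - D)).trace := by
        gcongr with x
        exact g2 x
    _ ≤ _ := by linarith

/-- The draws are revealed one at a time; a general `G` absorbs those already made, and each costs a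
factor `1 + v`. -/
theorem Matrix.lazyExp_trace_exp_le {w v : ℝ} (hw : 0 ≤ w) (hw1 : Fintype.card ι * w ≤ 1)
    (H : ι → Matrix d d ℝ) (hH : ∀ x, (H x).IsHermitian) (hn : ∀ x, ‖H x‖ ≤ 1 / 2)
    (hv0 : 0 ≤ v)
    (hv : ∀ z : d → ℝ, w * ∑ x, (H x *ᵥ z) ⬝ᵥ (H x *ᵥ z) ≤ v * (z ⬝ᵥ z))
    (m : ℕ) {G : Matrix d d ℝ} (hG : G.IsHermitian) :
    lazyExp w m (fun l => (exp (G + (l.map H).sum - (m * w) • ∑ x, H x)).trace)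
      ≤ (1 + v) ^ m * (exp G).trace := by
  have hDh : (w • ∑ x, H x).IsHermitian := by
    rw [Matrix.IsHermitian, Matrix.conjTranspose_smul, Matrix.conjTranspose_sum]
    simp only [star_trivial, (hH _).eq]
  induction m generalizing G with
  | zero => simp [lazyExp]
  | succ m ih =>
    have e1 : ∀ l : List ι, G + (l.map H).sum - ((m + 1 : ℕ) * w) • ∑ x, H x
        = (G - w • ∑ x, H x) + (l.map H).sum - (m * w) • ∑ x, H x := by
      intro l; push_cast; module
    have e2 : ∀ x, ∀ l : List ι, G + ((x :: l).map H).sum - ((m + 1 : ℕ) * w) • ∑ x, H x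
        = (G + H x - w • ∑ x, H x) + (l.map H).sum - (m * w) • ∑ x, H x := by
      intro x l; rw [List.map_cons, List.sum_cons]; push_cast; module
    rw [lazyExp]
    simp only [e2]
    simp only [e1]
    have h0 : 0 ≤ 1 - Fintype.card ι * w := by linarith
    calc _ ≤ (1 - Fintype.card ι * w) * ((1 + v) ^ m * (exp (G - w • ∑ x, H x)).trace)
        + w * ∑ x, (1 + v) ^ m * (exp (G + H x - w • ∑ x, H x)).trace := by
          gcongr with x
          · exact ih (hG.sub hDh)
          · exact ih ((hG.add (hH x)).sub hDh)
      _ = (1 + v) ^ m * ((1 - Fintype.card ι * w) * (exp (G - w • ∑ x, H x)).trace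
        + w * ∑ x, (exp (G + H x - w • ∑ x, H x)).trace) := by
          rw [← Finset.mul_sum]; ring
      _ ≤ (1 + v) ^ m * ((1 + v) * (exp G).trace) := by
          gcongr
          exact Matrix.trace_exp_lazy_step hw hw1 H hH hn hv hG
      _ = _ := by ring

end MatrixBernstein

end

section

open scoped Matrix.Norms.L2Operator
open NormedSpace (exp)
open Filter Topology

/-! ### Tail bounds: the matrix Bernstein inequality -/

section OperatorNorm

theorem Matrix.l2_opNorm_le_iff {m n : Type*} [Fintype m] [Fintype n] [DecidableEq n]
    {A : Matrix m n ℝ} {K : ℝ} (hK : 0 ≤ K) :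
    ‖A‖ ≤ K ↔ ∀ z : n → ℝ, (A *ᵥ z) ⬝ᵥ (A *ᵥ z) ≤ K ^ 2 * (z ⬝ᵥ z) := by
  have hn : ∀ {k : Type _} [Fintype k] (z : k → ℝ), z ⬝ᵥ z = ‖WithLp.toLp 2 z‖ ^ 2 := by
    intro k _ z
    rw [EuclideanSpace.real_norm_sq_eq]
    simp [dotProduct, sq]
  have hn' : ∀ z : m → ℝ, z ⬝ᵥ z = ‖WithLp.toLp 2 z‖ ^ 2 := by
    intro z
    rw [EuclideanSpace.real_norm_sq_eq]
    simp [dotProduct, sq]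
  constructor
  · intro h z
    have h1 := Matrix.l2_opNorm_mulVec A (WithLp.toLp 2 z)
    rw [hn', hn, ← mul_pow]
    refine pow_le_pow_left₀ (norm_nonneg _) (le_trans h1 ?_) 2
    gcongr
  · intro h
    rw [Matrix.l2_opNorm_def]
    refine ContinuousLinearMap.opNorm_le_bound _ hK fun x => ?_
    refine le_of_sq_le_sq ?_ (by positivity)
    have := h x.ofLp
    rw [hn', hn, ← mul_pow] at this
    exact this

end OperatorNorm

section Bernstein

variable {ι : Type*} [Fintype ι]

open Classical in
/-- The probability of an event under `m` lazy draws. -/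
noncomputable def lazyProb (w : ℝ) (m : ℕ) (P : List ι → Prop) : ℝ :=
  lazyExp w m fun l => if P l then 1 else 0

theorem lazyProb_mono {w : ℝ} (hw : 0 ≤ w) (hw1 : Fintype.card ι * w ≤ 1) (m : ℕ)
    {P Q : List ι → Prop} (h : ∀ l, P l → Q l) : lazyProb w m P ≤ lazyProb w m Q := by
  refine lazyExp_mono hw hw1 m fun l => ?_
  by_cases hP : P l
  · rw [if_pos hP, if_pos (h l hP)]
  · rw [if_neg hP]; split_ifs <;> norm_num

theorem lazyProb_or_le {w : ℝ} (hw : 0 ≤ w) (hw1 : Fintype.card ι * w ≤ 1) (m : ℕ)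
    (P Q : List ι → Prop) :
    lazyProb w m (fun l => P l ∨ Q l) ≤ lazyProb w m P + lazyProb w m Q := by
  rw [lazyProb, lazyProb, lazyProb, ← lazyExp_add]
  refine lazyExp_mono hw hw1 m fun l => ?_
  by_cases hP : P l <;> by_cases hQ : Q l <;> simp [hP, hQ]

theorem lazyProb_exists_le {κ : Type*} [Fintype κ] {w : ℝ} (hw : 0 ≤ w)
    (hw1 : Fintype.card ι * w ≤ 1) (m : ℕ) (P : κ → List ι → Prop) :
    lazyProb w m (fun l => ∃ k, P k l) ≤ ∑ k, lazyProb w m (P k) := by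
  classical
  have h : ∀ s : Finset κ,
      lazyProb w m (fun l => ∃ k ∈ s, P k l) ≤ ∑ k ∈ s, lazyProb w m (P k) := by
    intro s
    induction s using Finset.induction_on with
    | empty => simp [lazyProb, lazyExp_const]
    | insert a s ha ih =>
      rw [Finset.sum_insert ha]
      refine le_trans ?_ ((lazyProb_or_le hw hw1 m _ _).trans (add_le_add_right ih _))
      exact lazyProb_mono hw hw1 m fun l => by simp
  simpa using h Finset.univ

/-- Chernoff's method at a fixed `θ`, used with both signs so that the traces control the whole
norm. The condition `2 * θ * K ≤ 1` keeps the increments where the quadratic bound on `exp` is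
valid. -/
theorem Matrix.lazyProb_isHermitian_norm_gt {d : Type*} [Fintype d] [DecidableEq d]
    {w θ K V t : ℝ} (hw : 0 ≤ w) (hw1 : Fintype.card ι * w ≤ 1)
    (H : ι → Matrix d d ℝ) (hH : ∀ x, (H x).IsHermitian) (hn : ∀ x, ‖H x‖ ≤ K)
    (hV0 : 0 ≤ V) (hV : ∀ z : d → ℝ, ∑ x, (H x *ᵥ z) ⬝ᵥ (H x *ᵥ z) ≤ V * (z ⬝ᵥ z))
    (hθ : 0 ≤ θ) (hθK : 2 * θ * K ≤ 1) (ht : 0 ≤ t) (m : ℕ) :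
    lazyProb w m (fun l => t < ‖(l.map H).sum - (m * w) • ∑ x, H x‖)
      ≤ 2 * Fintype.card d * Real.exp (-θ * t + θ ^ 2 * (m * w * V)) := by
  classical
  cases isEmpty_or_nonempty d
  · have : ∀ Z : Matrix d d ℝ, ¬ t < ‖Z‖ := fun Z => by
      rw [Subsingleton.elim Z 0, norm_zero]; exact not_lt.2 ht
    simp [lazyProb, this, lazyExp_const]
  set Z : List ι → Matrix d d ℝ := fun l => (l.map H).sum - (m * w) • ∑ x, H x with hZ
  have hsum : ∀ l : List ι, (l.map H).sum.IsHermitian := by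
    intro l
    induction l with
    | nil => simp
    | cons x l ih => simpa using (hH x).add ih
  have hsmul : ∀ (c : ℝ) {A : Matrix d d ℝ}, A.IsHermitian → (c • A).IsHermitian := by
    intro c A hA
    rw [Matrix.IsHermitian, Matrix.conjTranspose_smul, hA.eq, star_trivial]
  have hD : (∑ x, H x).IsHermitian := by
    rw [Matrix.IsHermitian, Matrix.conjTranspose_sum]; simp only [(hH _).eq]
  have hZh : ∀ l, (Z l).IsHermitian := fun l => (hsum l).sub (hsmul _ hD)
  have bound : ∀ c : ℝ, |c| = θ → lazyExp w m (fun l => (exp (c • Z l)).trace)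
      ≤ (1 + θ ^ 2 * (w * V)) ^ m * Fintype.card d := by
    intro c hc
    have hc2 : c ^ 2 = θ ^ 2 := by rw [← hc, sq_abs]
    have h := Matrix.lazyExp_trace_exp_le (v := θ ^ 2 * (w * V)) hw hw1 (fun x => c • H x)
      (fun x => hsmul c (hH x)) (fun x => by
        rw [norm_smul, Real.norm_eq_abs, hc]
        nlinarith [hn x]) (by positivity) (fun z => by
        simp only [Matrix.smul_mulVec, dotProduct_smul, smul_dotProduct, smul_eq_mul]
        rw [← Finset.mul_sum, ← Finset.mul_sum]
        have := hV z
        have h3 : w * (c * (c * ∑ x, (H x *ᵥ z) ⬝ᵥ (H x *ᵥ z)))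
          = θ ^ 2 * w * ∑ x, (H x *ᵥ z) ⬝ᵥ (H x *ᵥ z) := by rw [← hc2]; ring
        rw [h3]
        calc _ ≤ θ ^ 2 * w * (V * (z ⬝ᵥ z)) := by gcongr
          _ = _ := by ring) m (G := 0) (Matrix.isHermitian_zero)
    rw [NormedSpace.exp_zero, Matrix.trace_one] at h
    have e : ∀ l : List ι, 0 + (l.map fun x => c • H x).sum - (m * w) • ∑ x, c • H x = c • Z l := by
      intro l
      rw [hZ, zero_add, smul_sub, List.smul_sum, List.map_map, ← Finset.smul_sum, smul_comm]
      rfl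
    simpa only [e] using h
  have b1 := bound θ (abs_of_nonneg hθ)
  have b2 := bound (-θ) (by rw [abs_neg, abs_of_nonneg hθ])
  calc _ ≤ lazyExp w m (fun l => Real.exp (-θ * t) *
        ((exp (θ • Z l)).trace + (exp ((-θ) • Z l)).trace)) := by
        refine lazyExp_mono hw hw1 m fun l => ?_
        split_ifs with h
        · have h1 := Matrix.exp_norm_le_trace_exp (hsmul θ (hZh l))
          rw [norm_smul, Real.norm_of_nonneg hθ, ← neg_smul] at h1
          calc (1 : ℝ) = Real.exp (-θ * t) * Real.exp (θ * t) := by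
                rw [← Real.exp_add]; simp
            _ ≤ Real.exp (-θ * t) * Real.exp (θ * ‖Z l‖) := by gcongr
            _ ≤ _ := by gcongr
        · have h1 := (Matrix.posSemidef_exp (hsmul θ (hZh l))).trace_nonneg
          have h2 := (Matrix.posSemidef_exp (hsmul (-θ) (hZh l))).trace_nonneg
          positivity
    _ ≤ Real.exp (-θ * t) * ((1 + θ ^ 2 * (w * V)) ^ m * Fintype.card d
        + (1 + θ ^ 2 * (w * V)) ^ m * Fintype.card d) := by
        rw [lazyExp_const_mul, lazyExp_add]
        gcongr
    _ ≤ Real.exp (-θ * t) * (Real.exp (θ ^ 2 * (w * V)) ^ m * Fintype.card d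
        + Real.exp (θ ^ 2 * (w * V)) ^ m * Fintype.card d) := by
        have : 1 + θ ^ 2 * (w * V) ≤ Real.exp (θ ^ 2 * (w * V)) := by
          rw [add_comm]; exact Real.add_one_le_exp _
        gcongr
    _ = _ := by
        rw [← Real.exp_nat_mul, Real.exp_add]
        ring_nf

/-- **Matrix Bernstein inequality** for lazy draws of rectangular matrices. -/
theorem Matrix.lazyProb_norm_gt {d₁ d₂ : Type*} [Fintype d₁] [DecidableEq d₁] [Fintype d₂]
    [DecidableEq d₂] {w θ K V t : ℝ} (hw : 0 ≤ w) (hw1 : Fintype.card ι * w ≤ 1)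
    (B : ι → Matrix d₁ d₂ ℝ) (hn : ∀ x, ‖B x‖ ≤ K) (hK : 0 ≤ K)
    (hV0 : 0 ≤ V) (hV : ∀ z, ∑ x, (B x *ᵥ z) ⬝ᵥ (B x *ᵥ z) ≤ V * (z ⬝ᵥ z))
    (hV' : ∀ z, ∑ x, ((B x)ᵀ *ᵥ z) ⬝ᵥ ((B x)ᵀ *ᵥ z) ≤ V * (z ⬝ᵥ z))
    (hθ : 0 ≤ θ) (hθK : 2 * θ * K ≤ 1) (ht : 0 ≤ t) (m : ℕ) :
    lazyProb w m (fun l => t < ‖(l.map B).sum - (m * w) • ∑ x, B x‖)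
      ≤ 2 * (Fintype.card d₁ + Fintype.card d₂) *
        Real.exp (-θ * t + θ ^ 2 * (m * w * V)) := by
  -- Hermitian dilation. Its square is block diagonal with blocks `A Aᵀ` and `Aᵀ A`, whence the two
  -- variance hypotheses.
  set D : Matrix d₁ d₂ ℝ → Matrix (d₁ ⊕ d₂) (d₁ ⊕ d₂) ℝ := fun A => Matrix.fromBlocks 0 A Aᵀ 0
    with hD
  have hdot : ∀ (A : Matrix d₁ d₂ ℝ) (z : d₁ ⊕ d₂ → ℝ), (D A *ᵥ z) ⬝ᵥ (D A *ᵥ z)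
      = (A *ᵥ (z ∘ Sum.inr)) ⬝ᵥ (A *ᵥ (z ∘ Sum.inr))
        + (Aᵀ *ᵥ (z ∘ Sum.inl)) ⬝ᵥ (Aᵀ *ᵥ (z ∘ Sum.inl)) := by
    intro A z
    rw [hD, Matrix.fromBlocks_mulVec]
    simp [dotProduct]
  have hz : ∀ z : d₁ ⊕ d₂ → ℝ, z ⬝ᵥ z
      = (z ∘ Sum.inr) ⬝ᵥ (z ∘ Sum.inr) + (z ∘ Sum.inl) ⬝ᵥ (z ∘ Sum.inl) := by
    intro z; simp [dotProduct, add_comm]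
  have hle : ∀ A, ‖A‖ ≤ ‖D A‖ := by
    intro A
    rw [Matrix.l2_opNorm_le_iff (norm_nonneg _)]
    intro z
    have h := (Matrix.l2_opNorm_le_iff (norm_nonneg (D A))).1 le_rfl (Sum.elim 0 z)
    rw [hdot, hz] at h
    simpa using h
  have hDn : ∀ x, ‖D (B x)‖ ≤ K := by
    intro x
    rw [Matrix.l2_opNorm_le_iff hK]
    intro z
    have h1 := (Matrix.l2_opNorm_le_iff hK).1 (hn x) (z ∘ Sum.inr)
    have h2 := (Matrix.l2_opNorm_le_iff (A := (B x)ᵀ) hK).1 (by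
      rw [← Matrix.conjTranspose_eq_transpose_of_trivial, Matrix.l2_opNorm_conjTranspose]
      exact hn x) (z ∘ Sum.inl)
    rw [hdot, hz]
    linarith
  have h := Matrix.lazyProb_isHermitian_norm_gt (V := V) hw hw1 (fun x => D (B x)) (fun x => by
      rw [Matrix.IsHermitian, Matrix.conjTranspose_eq_transpose_of_trivial]
      simp [hD, Matrix.fromBlocks_transpose]) hDn hV0 (fun z => by
      simp only [hdot, hz, Finset.sum_add_distrib]
      linarith [hV (z ∘ Sum.inr), hV' (z ∘ Sum.inl)]) hθ hθK ht m
  have hadd : ∀ A A', D (A + A') = D A + D A' := by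
    intro A A'; simp [hD, Matrix.fromBlocks_add]
  have hsmul : ∀ (c : ℝ) A, D (c • A) = c • D A := by
    intro c A; simp [hD, Matrix.fromBlocks_smul]
  let L : Matrix d₁ d₂ ℝ →ₗ[ℝ] Matrix (d₁ ⊕ d₂) (d₁ ⊕ d₂) ℝ := ⟨⟨D, hadd⟩, hsmul⟩
  have e : ∀ l : List ι, (l.map fun x => D (B x)).sum - (m * w) • ∑ x, D (B x)
      = D ((l.map B).sum - (m * w) • ∑ x, B x) := by
    intro l
    change (l.map fun x => L (B x)).sum - (m * w) • ∑ x, L (B x) = L _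
    rw [map_sub, map_smul, map_sum, map_list_sum, List.map_map]
    rfl
  rw [Fintype.card_sum] at h
  push_cast at h
  refine le_trans (lazyProb_mono hw hw1 m fun l hl => ?_) h
  rw [e]
  exact hl.trans_le (hle _)

end Bernstein

end

section

open Filter Topology

/-! ### Comparing Bernoulli subsets with lazy draws -/

section BernoulliSubset

variable {ι : Type*} [DecidableEq ι]

/-- Expectation of `f` over a random subset of `s` that contains each element independently with
probability `p`. -/
noncomputable def bernExp (s : Finset ι) (p : ℝ) (f : Finset ι → ℝ) : ℝ :=
  ∑ S ∈ s.powerset, p ^ S.card * (1 - p) ^ (s \ S).card * f S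

theorem bernExp_add (s : Finset ι) (p : ℝ) (f g : Finset ι → ℝ) :
    bernExp s p (fun S => f S + g S) = bernExp s p f + bernExp s p g := by
  simp only [bernExp, mul_add, Finset.sum_add_distrib]

theorem bernExp_const_mul (s : Finset ι) (p c : ℝ) (f : Finset ι → ℝ) :
    bernExp s p (fun S => c * f S) = c * bernExp s p f := by
  simp only [bernExp, Finset.mul_sum]
  exact Finset.sum_congr rfl fun _ _ => by ring

theorem bernExp_mono {s : Finset ι} {p : ℝ} (hp : 0 ≤ p) (hp1 : p ≤ 1) {f g : Finset ι → ℝ}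
    (h : ∀ S, f S ≤ g S) : bernExp s p f ≤ bernExp s p g := by
  have : 0 ≤ 1 - p := by linarith
  exact Finset.sum_le_sum fun S _ => mul_le_mul_of_nonneg_left (h S) (by positivity)

theorem bernExp_insert {s : Finset ι} {a : ι} (ha : a ∉ s) (p : ℝ) (f : Finset ι → ℝ) :
    bernExp (insert a s) p f
      = (1 - p) * bernExp s p f + p * bernExp s p fun S => f (insert a S) := by
  simp only [bernExp]
  rw [Finset.sum_powerset_insert ha, Finset.mul_sum, Finset.mul_sum]
  congr 1 <;> refine Finset.sum_congr rfl fun S hS => ?_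
  · have haS : a ∉ S := fun h => ha (Finset.mem_powerset.1 hS h)
    rw [Finset.insert_sdiff_of_notMem _ haS, Finset.card_insert_of_notMem (by simp [ha]), pow_succ]
    ring
  · have haS : a ∉ S := fun h => ha (Finset.mem_powerset.1 hS h)
    rw [Finset.insert_sdiff_insert, Finset.card_insert_of_notMem haS,
      Finset.sdiff_insert_of_notMem ha, pow_succ]
    ring

theorem bernExp_const (s : Finset ι) (p c : ℝ) : bernExp s p (fun _ => c) = c := by
  induction s using Finset.induction_on with
  | empty => simp [bernExp]
  | insert a s ha ih => rw [bernExp_insert ha, ih]; ring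

/-- The union of independent Bernoulli subsets of rates `p` and `q` is dominated by a Bernoulli
subset of rate `p + q`. -/
theorem bernExp_union_le {s : Finset ι} {p q : ℝ} (hp : 0 ≤ p) (hq : 0 ≤ q) (hpq : p + q ≤ 1)
    {f : Finset ι → ℝ} (hf : Monotone f) :
    bernExp s q (fun S => bernExp s p fun T => f (S ∪ T)) ≤ bernExp s (p + q) f := by
  induction s using Finset.induction_on generalizing f with
  | empty => simp [bernExp]
  | insert a s ha ih =>
    have hfa : Monotone fun S => f (insert a S) := fun S T h => hf (Finset.insert_subset_insert a h)
    have h1 := ih hf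
    have h2 := ih hfa
    have h3 : bernExp s (p + q) f ≤ bernExp s (p + q) fun S => f (insert a S) :=
      bernExp_mono (by linarith) hpq fun S => hf (Finset.subset_insert a S)
    simp only [bernExp_insert ha, bernExp_add, bernExp_const_mul, Finset.insert_union,
      Finset.union_insert, Finset.insert_idem]
    set L := bernExp s q fun S => bernExp s p fun T => f (S ∪ T)
    set L' := bernExp s q fun S => bernExp s p fun T => f (insert a (S ∪ T))
    set E := bernExp s (p + q) f
    set E' := bernExp s (p + q) fun S => f (insert a S)
    have hpq0 : 0 ≤ p * q := mul_nonneg hp hq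
    have hc : 0 ≤ (1 - q) * (1 - p) := mul_nonneg (by linarith) (by linarith)
    have hc' : 0 ≤ 1 - (1 - q) * (1 - p) := by nlinarith
    -- The union contains `a` with probability `p + q - p q` only; the missing `p q (E' - E)` is
    -- nonnegative by monotonicity.
    calc _ = (1 - q) * (1 - p) * L + (1 - (1 - q) * (1 - p)) * L' := by ring
      _ ≤ (1 - q) * (1 - p) * E + (1 - (1 - q) * (1 - p)) * E' := by gcongr
      _ = (1 - (p + q)) * E + (p + q) * E' - p * q * (E' - E) := by ring
      _ ≤ _ := by linarith [mul_nonneg hpq0 (sub_nonneg.2 h3)]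

variable [Fintype ι]

/-- A single lazy draw is dominated by a Bernoulli subset. -/
theorem lazy_draw_le_bernExp {q : ℝ} (hq : 0 ≤ q) (hq1 : q ≤ 1) {h : Finset ι → ℝ}
    (hh : Monotone h) :
    (1 - Fintype.card ι * (q * (1 - q) ^ (Fintype.card ι - 1))) * h ∅
      + (q * (1 - q) ^ (Fintype.card ι - 1)) * ∑ x, h {x} ≤ bernExp Finset.univ q h := by
  set w := q * (1 - q) ^ (Fintype.card ι - 1) with hw
  have hq' : 0 ≤ 1 - q := by linarith
  have h1 : bernExp Finset.univ q (fun S => h ∅ + (h S + -h ∅)) = bernExp Finset.univ q h := by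
    congr 1; ext S; ring
  rw [← h1, bernExp_add, bernExp_const]
  -- The weight `w` is exactly the probability that the Bernoulli set is `{x}`. Keeping only
  -- singletons loses nonnegative terms once `h ∅` is subtracted.
  have h2 : ∑ x : ι, w * (h {x} + -h ∅) ≤ bernExp Finset.univ q fun S => h S + -h ∅ := by
    rw [bernExp]
    have e : ∑ x : ι, w * (h {x} + -h ∅)
        = ∑ S ∈ Finset.univ.map ⟨fun x : ι => ({x} : Finset ι), Finset.singleton_injective⟩,
          q ^ S.card * (1 - q) ^ (Finset.univ \ S).card * (h S + -h ∅) := by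
      rw [Finset.sum_map]
      refine Finset.sum_congr rfl fun x _ => ?_
      simp [hw, Finset.card_sdiff]
    rw [e]
    refine Finset.sum_le_sum_of_subset_of_nonneg (fun S _ => by simp) fun S _ _ => ?_
    have := hh (Finset.empty_subset S)
    have : 0 ≤ h S + -h ∅ := by linarith
    positivity
  have e : ∑ x : ι, w * (h {x} + -h ∅) = w * ∑ x, h {x} - Fintype.card ι * w * h ∅ := by
    rw [← Finset.mul_sum, Finset.sum_add_distrib, Finset.sum_const, Finset.card_univ, nsmul_eq_mul]
    ring
  linarith

/-- Each draw in turn is dominated by an independent Bernoulli subset of rate `q`, and the union of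
Bernoulli subsets by one of the summed rate; both comparisons need `f` monotone. -/
theorem lazyExp_bernExp_le {p q : ℝ} (hp : 0 ≤ p) (hq : 0 ≤ q) (m : ℕ) (hpq : p + m * q ≤ 1)
    (hw1 : Fintype.card ι * (q * (1 - q) ^ (Fintype.card ι - 1)) ≤ 1)
    {f : Finset ι → ℝ} (hf : Monotone f) :
    lazyExp (q * (1 - q) ^ (Fintype.card ι - 1)) m
      (fun l => bernExp Finset.univ p fun T => f (l.toFinset ∪ T))
      ≤ bernExp Finset.univ (p + m * q) f := by
  induction m generalizing f with
  | zero => simp [lazyExp]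
  | succ m ih =>
    push_cast at hpq ⊢
    have hmq : 0 ≤ m * q := by positivity
    have hq1 : q ≤ 1 := by linarith
    have hw : 0 ≤ q * (1 - q) ^ (Fintype.card ι - 1) :=
      mul_nonneg hq (pow_nonneg (by linarith) _)
    have hpq' : p + m * q ≤ 1 := by linarith
    have hfx : ∀ x, Monotone fun S => f (insert x S) :=
      fun x S T h => hf (Finset.insert_subset_insert x h)
    rw [lazyExp]
    simp only [List.toFinset_cons, Finset.insert_union]
    have hmono : Monotone fun S => bernExp Finset.univ (p + m * q) fun T => f (S ∪ T) :=
      fun S S' h => bernExp_mono (by linarith) hpq' fun T => hf (Finset.union_subset_union_left h)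
    have h1 := lazy_draw_le_bernExp hq hq1 hmono
    have h2 := bernExp_union_le (s := Finset.univ) (p := p + m * q) (q := q) (by linarith) hq
      (by linarith) hf
    simp only [Finset.empty_union, Finset.singleton_union] at h1
    have h3 : p + (m + 1) * q = p + m * q + q := by ring
    rw [h3]
    refine le_trans ?_ (h1.trans h2)
    have h0 : 0 ≤ 1 - Fintype.card ι * (q * (1 - q) ^ (Fintype.card ι - 1)) := by linarith
    gcongr with x
    · exact ih hpq' hf
    · exact ih hpq' (hfx x)

open Classical in
/-- The probability that a Bernoulli subset has the property `P`. -/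
noncomputable def bernProb (p : ℝ) (P : Finset ι → Prop) : ℝ :=
  bernExp Finset.univ p fun S => if P S then 1 else 0

theorem bernProb_mono {p : ℝ} (hp : 0 ≤ p) (hp1 : p ≤ 1) {P Q : Finset ι → Prop}
    (h : ∀ S, P S → Q S) : bernProb p P ≤ bernProb p Q := by
  refine bernExp_mono hp hp1 fun S => ?_
  by_cases hP : P S
  · rw [if_pos hP, if_pos (h S hP)]
  · rw [if_neg hP]; split_ifs <;> norm_num

/-- One batch of lazy draws followed by a Bernoulli subset: if outside an event of probability `η`
for the batch the increasing property `P` of the union has conditional probability at least `c`,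
then it has probability at least `c - η` at the summed rate. -/
theorem bernProb_ge_of_lazyProb_le {p q c η : ℝ} (hp : 0 ≤ p) (hq : 0 ≤ q) (m : ℕ)
    (hpq : p + m * q ≤ 1) (hc : c ≤ 1) (hw : 0 ≤ q * (1 - q) ^ (Fintype.card ι - 1))
    (hw1 : Fintype.card ι * (q * (1 - q) ^ (Fintype.card ι - 1)) ≤ 1)
    {P : Finset ι → Prop} (hP : ∀ S T, S ⊆ T → P S → P T) (bad : List ι → Prop)
    (hbad : lazyProb (q * (1 - q) ^ (Fintype.card ι - 1)) m bad ≤ η)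
    (hgood : ∀ l, ¬ bad l → c ≤ bernProb p fun T => P (l.toFinset ∪ T)) :
    c - η ≤ bernProb (p + m * q) P := by
  classical
  have hf : Monotone fun S : Finset ι => if P S then (1 : ℝ) else 0 := by
    intro S T h
    by_cases hS : P S
    · simp [hS, hP S T h hS]
    · simp only [hS, if_false]; split_ifs <;> norm_num
  have h1 := lazyExp_bernExp_le hp hq m hpq hw1 hf
  have hp1 : p ≤ 1 := by
    have : 0 ≤ m * q := by positivity
    linarith
  have h2 : lazyExp (q * (1 - q) ^ (Fintype.card ι - 1)) m
      (fun l : List ι => c + (-1) * (if bad l then 1 else 0))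
      ≤ lazyExp (q * (1 - q) ^ (Fintype.card ι - 1)) m
      (fun l => bernExp Finset.univ p fun T => if P (l.toFinset ∪ T) then 1 else 0) := by
    refine lazyExp_mono hw hw1 m fun l => ?_
    by_cases hb : bad l
    · have : bernExp Finset.univ p (fun _ : Finset ι => (0 : ℝ))
          ≤ bernExp Finset.univ p fun T => if P (l.toFinset ∪ T) then 1 else 0 :=
        bernExp_mono hp hp1 fun T => by split_ifs <;> norm_num
      rw [bernExp_const] at this
      simp only [hb, if_true]
      linarith
    · have h := hgood l hb
      simp only [hb, if_false, mul_zero, add_zero]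
      unfold bernProb at h
      convert h
  rw [lazyExp_add, lazyExp_const, lazyExp_const_mul] at h2
  have h3 : lazyProb (q * (1 - q) ^ (Fintype.card ι - 1)) m bad
      = lazyExp (q * (1 - q) ^ (Fintype.card ι - 1)) m fun l => if bad l then 1 else 0 := by
    unfold lazyProb; congr
  have h4 : bernProb (p + m * q) P
      = bernExp Finset.univ (p + m * q) fun S => if P S then (1 : ℝ) else 0 := by
    unfold bernProb; congr
  rw [h4]
  rw [h3] at hbad
  linarith


/-- The link between the finite sums used for all estimates and the law in the theorem; the sample
space is finite, so measurability is no restriction. -/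
theorem setBernoulli_real_eq_bernProb (p : unitInterval)
    (Q : Set ι → Prop) :
    (ProbabilityTheory.setBernoulli Set.univ p).real {Ω : Set ι | Q Ω}
      = bernProb (p : ℝ) fun S : Finset ι => Q S := by
  classical
  have h := MeasureTheory.measureReal_biUnion_finset
    (μ := ProbabilityTheory.setBernoulli (Set.univ : Set ι) p)
    (s := Finset.univ.filter fun S : Finset ι => Q S) (f := fun S : Finset ι => {(S : Set ι)})
    (by intro S _ T _ hST; simpa [Function.onFun] using hST) (fun S _ => by measurability)
  have e : (⋃ S ∈ Finset.univ.filter fun S : Finset ι => Q S, {(S : Set ι)}) = {Ω | Q Ω} := by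
    ext Ω
    simp only [Set.mem_iUnion, Finset.mem_filter, Finset.mem_univ, true_and,
      Set.mem_singleton_iff, exists_prop, Set.mem_ofPred_eq]
    constructor
    · rintro ⟨S, hS, rfl⟩; exact hS
    · intro hΩ
      exact ⟨Ω.toFinset, by simpa using hΩ, by simp⟩
  rw [e] at h
  rw [h, bernProb, bernExp, Finset.sum_filter, Finset.powerset_univ]
  refine Finset.sum_congr rfl fun S _ => ?_
  split_ifs with hS
  · rw [ProbabilityTheory.setBernoulli_real_singleton p (Set.subset_univ _) Set.finite_univ]
    rw [Set.ncard_coe_finset, ← Finset.coe_univ, ← Finset.coe_sdiff, Set.ncard_coe_finset, mul_one]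
  · simp

end BernoulliSubset

end

section

open scoped Matrix.Norms.L2Operator

/-! ### Nuclear norm duality -/

section NuclearNorm

open StructuredCompletion

variable {m n : ℕ}

theorem StructuredCompletion.nuclearNorm_eq_sum (Z : Matrix (Fin m) (Fin n) ℝ) :
    nuclearNorm Z = ∑ i : Fin n, (Matrix.toEuclideanLin Z).singularValues i := by
  rw [nuclearNorm, Finsupp.sum_of_support_subset (s := Finset.range n), Finset.sum_range]
  · intro i hi
    by_contra h
    rw [Finsupp.mem_support_iff] at hi
    exact hi (LinearMap.singularValues_of_finrank_le _ (by simpa using h))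
  · simp

/-- An orthonormal basis of right singular vectors. -/
theorem Matrix.exists_orthonormalBasis_inner_toEuclideanLin (Z : Matrix (Fin m) (Fin n) ℝ) :
    ∃ e : OrthonormalBasis (Fin n) ℝ (EuclideanSpace ℝ (Fin n)), ∀ i j,
      inner ℝ (Matrix.toEuclideanLin Z (e i)) (Matrix.toEuclideanLin Z (e j))
        = if i = j then (Matrix.toEuclideanLin Z).singularValues i ^ 2 else 0 := by
  set T := Matrix.toEuclideanLin Z
  have hn : Module.finrank ℝ (EuclideanSpace ℝ (Fin n)) = n := by simp
  refine ⟨T.isSymmetric_adjoint_comp_self.eigenvectorBasis hn, fun i j => ?_⟩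
  rw [← LinearMap.adjoint_inner_right]
  have h := T.isSymmetric_adjoint_comp_self.apply_eigenvectorBasis hn j
  rw [LinearMap.comp_apply] at h
  rw [h, inner_smul_right, OrthonormalBasis.inner_eq_ite, T.sq_singularValues_fin hn]
  split_ifs with hij
  · subst hij; simp
  · simp

theorem Matrix.trace_transpose_mul_eq_sum_inner (G Z : Matrix (Fin m) (Fin n) ℝ)
    (e : OrthonormalBasis (Fin n) ℝ (EuclideanSpace ℝ (Fin n))) :
    (Gᵀ * Z).trace
      = ∑ i, inner ℝ (Matrix.toEuclideanLin G (e i)) (Matrix.toEuclideanLin Z (e i)) := by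
  have h := LinearMap.trace_eq_sum_inner
    (LinearMap.adjoint (Matrix.toEuclideanLin G) ∘ₗ Matrix.toEuclideanLin Z) e
  simp only [LinearMap.comp_apply, LinearMap.adjoint_inner_right] at h
  rw [← h, ← Matrix.toEuclideanLin_conjTranspose_eq_adjoint,
    Matrix.conjTranspose_eq_transpose_of_trivial, Matrix.toEuclideanLin_eq_toLin_orthonormal,
    Matrix.toEuclideanLin_eq_toLin_orthonormal, ← Matrix.toLin_mul, Matrix.trace_toLin_eq]

/-- In a basis of right singular vectors of `Z` the trace is `∑ ⟨G eᵢ, Z eᵢ⟩`, and Cauchy–Schwarz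
bounds each term by the singular value `‖Z eᵢ‖`. -/
theorem StructuredCompletion.trace_transpose_mul_le_nuclearNorm
    {G : Matrix (Fin m) (Fin n) ℝ} (hG : ‖G‖ ≤ 1) (Z : Matrix (Fin m) (Fin n) ℝ) :
    (Gᵀ * Z).trace ≤ nuclearNorm Z := by
  obtain ⟨e, he⟩ := Matrix.exists_orthonormalBasis_inner_toEuclideanLin Z
  rw [nuclearNorm_eq_sum, Matrix.trace_transpose_mul_eq_sum_inner G Z e]
  refine Finset.sum_le_sum fun i _ => (real_inner_le_norm _ _).trans ?_
  have h1 : ‖Matrix.toEuclideanLin Z (e i)‖ = (Matrix.toEuclideanLin Z).singularValues i := by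
    have h := he i i
    rw [if_pos rfl, real_inner_self_eq_norm_sq] at h
    exact (sq_eq_sq₀ (norm_nonneg _) (LinearMap.singularValues_nonneg _ _)).1 h
  have h2 : ‖Matrix.toEuclideanLin G (e i)‖ ≤ 1 := by
    have h := Matrix.l2_opNorm_mulVec G (e i)
    rw [e.norm_eq_one, mul_one] at h
    exact h.trans hG
  rw [h1]
  exact mul_le_of_le_one_left (LinearMap.singularValues_nonneg _ _) h2

/-- Expanding `Z = ∑ σₖ uₖ vₖᵀ` in `sᵢ = ⟨Z eᵢ, fᵢ⟩` gives `∑ sᵢ = ∑ σₖ ∑ᵢ ⟨vₖ, eᵢ⟩ ⟨uₖ, fᵢ⟩`. The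
inner sums are at most `1` by two Bessel inequalities. -/
theorem StructuredCompletion.nuclearNorm_le_sum {r : ℕ} {U : Matrix (Fin m) (Fin r) ℝ}
    {V : Matrix (Fin n) (Fin r) ℝ} {σ : Fin r → ℝ} (hU : Uᵀ * U = 1) (hV : Vᵀ * V = 1)
    (hσ : ∀ k, 0 ≤ σ k) : nuclearNorm (U * Matrix.diagonal σ * Vᵀ) ≤ ∑ k, σ k := by
  set Z := U * Matrix.diagonal σ * Vᵀ with hZ
  obtain ⟨e, he⟩ := Matrix.exists_orthonormalBasis_inner_toEuclideanLin Z
  set T := Matrix.toEuclideanLin Z with hT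
  set s : Fin n → ℝ := fun i => T.singularValues i with hs
  let u : Fin r → EuclideanSpace ℝ (Fin m) := fun k => WithLp.toLp 2 (Uᵀ k)
  let v : Fin r → EuclideanSpace ℝ (Fin n) := fun k => WithLp.toLp 2 (Vᵀ k)
  have hu : ∀ k, ‖u k‖ ^ 2 = 1 := by
    intro k
    have h := congrFun (congrFun hU k) k
    rw [Matrix.mul_apply, Matrix.one_apply_eq] at h
    rw [EuclideanSpace.real_norm_sq_eq, ← h]
    exact Finset.sum_congr rfl fun i _ => sq _
  have hv : ∀ k, ‖v k‖ ^ 2 = 1 := by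
    intro k
    have h := congrFun (congrFun hV k) k
    rw [Matrix.mul_apply, Matrix.one_apply_eq] at h
    rw [EuclideanSpace.real_norm_sq_eq, ← h]
    exact Finset.sum_congr rfl fun i _ => sq _
  have hTx : ∀ x, T x = ∑ k, (σ k * inner ℝ (v k) x) • u k := by
    intro x
    ext i
    rw [hT, Matrix.ofLp_toLpLin, Matrix.toLin'_apply, hZ, ← Matrix.mulVec_mulVec, ← Matrix.mulVec_mulVec]
    rw [Matrix.mulVec, dotProduct]
    simp only [Matrix.mulVec_diagonal]
    simp only [Matrix.mulVec, dotProduct, WithLp.ofLp_sum,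
      Finset.sum_apply, WithLp.ofLp_smul, Pi.smul_apply, smul_eq_mul, PiLp.inner_apply, u, v,
      RCLike.inner_apply, conj_trivial]
    refine Finset.sum_congr rfl fun k _ => ?_
    simp only [Matrix.transpose_apply, mul_comm (x.ofLp _)]
    ring
  -- Left singular vectors, defined only for nonzero singular values; the others do not contribute
  -- to the sum.
  let f : {i // s i ≠ 0} → EuclideanSpace ℝ (Fin m) := fun i => (s i)⁻¹ • T (e i)
  have hf : Orthonormal ℝ f := by
    rw [orthonormal_iff_ite]
    intro i j
    simp only [f, inner_smul_left, inner_smul_right, he, conj_trivial]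
    by_cases hij : i = j
    · subst hij
      have := i.2
      simp only [if_true]
      change (s i)⁻¹ * ((s i)⁻¹ * s i ^ 2) = 1
      field_simp
    · rw [if_neg hij, if_neg (fun h => hij (Subtype.ext h))]; simp
  have hsum : ∑ i, s i = ∑ i : {i // s i ≠ 0}, ∑ k, σ k * (inner ℝ (v k) (e i) * inner ℝ (u k) (f i)) := by
    have h1 : ∑ i, s i = ∑ i : {i // s i ≠ 0}, s i := by
      rw [← Finset.sum_filter_ne_zero]
      exact Finset.sum_subtype _ (by simp) _
    rw [h1]
    refine Finset.sum_congr rfl fun i _ => ?_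
    have h2 : s i = inner ℝ (T (e i)) (f i) := by
      have := i.2
      simp only [f, inner_smul_right, he, if_true]
      change s i = (s i)⁻¹ * s i ^ 2
      field_simp
    rw [h2, hTx, sum_inner]
    refine Finset.sum_congr rfl fun k _ => ?_
    rw [inner_smul_left, conj_trivial, mul_assoc]
  rw [nuclearNorm_eq_sum]
  change ∑ i, s i ≤ _
  rw [hsum, Finset.sum_comm]
  refine Finset.sum_le_sum fun k _ => ?_
  rw [← Finset.mul_sum]
  refine mul_le_of_le_one_right (hσ k) ?_
  have b1 : ∑ i : {i // s i ≠ 0}, (inner ℝ (u k) (f i)) ^ 2 ≤ 1 := by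
    have h := hf.sum_inner_products_le (x := u k) (s := Finset.univ)
    rw [hu] at h
    refine le_trans (Finset.sum_le_sum fun i _ => ?_) h
    rw [Real.norm_eq_abs, sq_abs, real_inner_comm]
  have b2 : ∑ i : {i // s i ≠ 0}, (inner ℝ (v k) (e i)) ^ 2 ≤ 1 := by
    have hf' : Orthonormal ℝ (fun i : {i // s i ≠ 0} => e i) :=
      e.orthonormal.comp _ Subtype.val_injective
    have h := hf'.sum_inner_products_le (x := v k) (s := Finset.univ)
    rw [hv] at h
    refine le_trans (Finset.sum_le_sum fun i _ => ?_) h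
    rw [Real.norm_eq_abs, sq_abs, real_inner_comm]
  calc _ ≤ ∑ i : {i // s i ≠ 0}, ((inner ℝ (v k) (e i)) ^ 2 / 2 + (inner ℝ (u k) (f i)) ^ 2 / 2) := by
        refine Finset.sum_le_sum fun i _ => ?_
        linarith [two_mul_le_add_sq (inner ℝ (v k) (e i)) (inner ℝ (u k) (f i))]
    _ ≤ 1 := by
        rw [Finset.sum_add_distrib, ← Finset.sum_div, ← Finset.sum_div]
        linarith

end NuclearNorm

end

section

open scoped Matrix.Norms.L2Operator

/-! ### The tangent space projection -/

section TangentProjection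

variable {d : Type*} [Fintype d]

/-- A symmetric idempotent matrix. -/
structure Matrix.IsOrthProj (P : Matrix d d ℝ) : Prop where
  symm : Pᵀ = P
  idem : P * P = P

/-- The map `Z ↦ P Z + Z Q - P Z Q`. -/
def Matrix.tangentProj (P Q : Matrix d d ℝ) : Matrix d d ℝ →ₗ[ℝ] Matrix d d ℝ where
  toFun Z := P * Z + Z * Q - P * Z * Q
  map_add' A B := by noncomm_ring
  map_smul' c A := by
    simp only [mul_smul_comm, smul_mul_assoc, RingHom.id_apply, smul_add, smul_sub]

theorem Matrix.tangentProj_apply (P Q Z : Matrix d d ℝ) :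
    Matrix.tangentProj P Q Z = P * Z + Z * Q - P * Z * Q := rfl

theorem Matrix.trace_transpose_mul_eq_sum (A B : Matrix d d ℝ) :
    (Aᵀ * B).trace = ∑ x : d × d, A x.1 x.2 * B x.1 x.2 := by
  rw [Fintype.sum_prod_type_right]
  simp [Matrix.trace, Matrix.mul_apply]

theorem Matrix.trace_transpose_mul_self_nonneg (A : Matrix d d ℝ) : 0 ≤ (Aᵀ * A).trace := by
  rw [Matrix.trace_transpose_mul_eq_sum]
  exact Finset.sum_nonneg fun x _ => mul_self_nonneg _

theorem Matrix.trace_transpose_mul_self_eq_zero {A : Matrix d d ℝ} (h : (Aᵀ * A).trace = 0) :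
    A = 0 := by
  rw [Matrix.trace_transpose_mul_eq_sum,
    Finset.sum_eq_zero_iff_of_nonneg fun x _ => mul_self_nonneg _] at h
  ext i j
  simpa using h (i, j) (Finset.mem_univ _)

theorem Matrix.sq_trace_transpose_mul_le (A B : Matrix d d ℝ) :
    (Aᵀ * B).trace ^ 2 ≤ (Aᵀ * A).trace * (Bᵀ * B).trace := by
  simp only [Matrix.trace_transpose_mul_eq_sum, ← sq]
  exact Finset.sum_mul_sq_le_sq_mul_sq _ _ _

theorem Matrix.dotProduct_self_nonneg' {n : Type*} [Fintype n] (z : n → ℝ) : 0 ≤ z ⬝ᵥ z := by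
  simpa using dotProduct_star_self_nonneg z

theorem Matrix.dotProduct_sq_le {n : Type*} [Fintype n] (y z : n → ℝ) :
    (y ⬝ᵥ z) ^ 2 ≤ (y ⬝ᵥ y) * (z ⬝ᵥ z) := by
  simp only [dotProduct, ← sq]
  exact Finset.sum_mul_sq_le_sq_mul_sq _ _ _

theorem Matrix.IsOrthProj.dotProduct_mulVec_self {P : Matrix d d ℝ} (hP : P.IsOrthProj) (z : d → ℝ) :
    (P *ᵥ z) ⬝ᵥ (P *ᵥ z) = z ⬝ᵥ P *ᵥ z := by
  rw [Matrix.dotProduct_mulVec, ← Matrix.mulVec_transpose, hP.symm, Matrix.mulVec_mulVec, hP.idem,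
    dotProduct_comm]

variable [DecidableEq d]

theorem Matrix.sub_tangentProj (P Q Z : Matrix d d ℝ) :
    Z - Matrix.tangentProj P Q Z = (1 - P) * Z * (1 - Q) := by
  rw [Matrix.tangentProj_apply]; noncomm_ring

namespace Matrix.IsOrthProj

variable {P Q : Matrix d d ℝ}

theorem one_sub (hP : P.IsOrthProj) : (1 - P).IsOrthProj :=
  ⟨by rw [Matrix.transpose_sub, Matrix.transpose_one, hP.symm],
    by rw [mul_sub, sub_mul, sub_mul, hP.idem]; simp⟩

theorem dotProduct_add_compl (hP : P.IsOrthProj) (z : d → ℝ) :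
    (P *ᵥ z) ⬝ᵥ (P *ᵥ z) + ((1 - P) *ᵥ z) ⬝ᵥ ((1 - P) *ᵥ z) = z ⬝ᵥ z := by
  rw [hP.dotProduct_mulVec_self, hP.one_sub.dotProduct_mulVec_self, Matrix.sub_mulVec,
    Matrix.one_mulVec, dotProduct_sub]
  ring

theorem norm_le_one (hP : P.IsOrthProj) : ‖P‖ ≤ 1 := by
  rw [Matrix.l2_opNorm_le_iff zero_le_one]
  intro z
  have h := hP.dotProduct_add_compl z
  have : 0 ≤ ((1 - P) *ᵥ z) ⬝ᵥ ((1 - P) *ᵥ z) := by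
    simpa using dotProduct_star_self_nonneg ((1 - P) *ᵥ z)
  linarith

theorem tangentProj_idem (hP : P.IsOrthProj) (hQ : Q.IsOrthProj) (Z : Matrix d d ℝ) :
    Matrix.tangentProj P Q (Matrix.tangentProj P Q Z) = Matrix.tangentProj P Q Z := by
  have h1 : ∀ A : Matrix d d ℝ, P * (P * A) = P * A := fun A => by rw [← mul_assoc, hP.idem]
  simp only [Matrix.tangentProj_apply, mul_add, mul_sub, add_mul, sub_mul, mul_assoc, hQ.idem, h1]
  abel

theorem trace_transpose_tangentProj (hP : P.IsOrthProj) (hQ : Q.IsOrthProj)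
    (A B : Matrix d d ℝ) :
    (Aᵀ * Matrix.tangentProj P Q B).trace = ((Matrix.tangentProj P Q A)ᵀ * B).trace := by
  have e : (Matrix.tangentProj P Q A)ᵀ = Aᵀ * P + Q * Aᵀ - Q * Aᵀ * P := by
    simp only [Matrix.tangentProj_apply, Matrix.transpose_add, Matrix.transpose_sub,
      Matrix.transpose_mul, hP.symm, hQ.symm, mul_assoc]
  rw [e, Matrix.tangentProj_apply]
  simp only [mul_add, add_mul, mul_sub, sub_mul, Matrix.trace_add, Matrix.trace_sub]
  rw [← mul_assoc Aᵀ B Q, Matrix.trace_mul_comm (Aᵀ * B) Q,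
    ← mul_assoc Aᵀ (P * B) Q, Matrix.trace_mul_comm (Aᵀ * (P * B)) Q]
  simp only [mul_assoc]

theorem norm_sub_tangentProj_le (hP : P.IsOrthProj) (hQ : Q.IsOrthProj) (Z : Matrix d d ℝ) :
    ‖Z - Matrix.tangentProj P Q Z‖ ≤ ‖Z‖ := by
  rw [Matrix.sub_tangentProj]
  calc _ ≤ ‖1 - P‖ * ‖Z‖ * ‖1 - Q‖ := (norm_mul_le _ _).trans (by gcongr; exact norm_mul_le _ _)
    _ ≤ 1 * ‖Z‖ * 1 := by
        gcongr
        · exact hP.one_sub.norm_le_one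
        · exact hQ.one_sub.norm_le_one
    _ = _ := by ring

end Matrix.IsOrthProj

theorem Matrix.norm_le_sqrt_trace (A : Matrix d d ℝ) : ‖A‖ ≤ √(Aᵀ * A).trace := by
  rw [Matrix.l2_opNorm_le_iff (Real.sqrt_nonneg _)]
  intro z
  rw [Real.sq_sqrt (Matrix.trace_transpose_mul_self_nonneg A), Matrix.trace_transpose_mul_eq_sum,
    Fintype.sum_prod_type, Finset.sum_mul]
  refine Finset.sum_le_sum fun i _ => ?_
  have := Matrix.dotProduct_sq_le (A i) z
  rw [← sq]
  exact this

end TangentProjection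

/-! ### Approximate dual certificates -/

section Certificate

open StructuredCompletion

theorem Matrix.isOrthProj_mul_transpose {s r : ℕ} {U : Matrix (Fin s) (Fin r) ℝ}
    (hU : Uᵀ * U = 1) : (U * Uᵀ).IsOrthProj :=
  ⟨by rw [Matrix.transpose_mul, Matrix.transpose_transpose], by
    rw [Matrix.mul_assoc, ← Matrix.mul_assoc Uᵀ, hU, Matrix.one_mul]⟩

theorem Matrix.transpose_mul_one_sub {s r : ℕ} {U : Matrix (Fin s) (Fin r) ℝ}
    (hU : Uᵀ * U = 1) : Uᵀ * (1 - U * Uᵀ) = 0 := by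
  rw [Matrix.mul_sub, ← Matrix.mul_assoc, hU]
  simp

/-- `D` kills the column space of `V` and has range orthogonal to that of `U`. So `U Vᵀ` and `D` act
on orthogonal subspaces with orthogonal images, and their norms do not add up. -/
theorem Matrix.norm_add_le_one_of_complement {s r : ℕ} {U V : Matrix (Fin s) (Fin r) ℝ}
    (hU : Uᵀ * U = 1) (hV : Vᵀ * V = 1) {D : Matrix (Fin s) (Fin s) ℝ} (hD : ‖D‖ ≤ 1)
    (hDT : (1 - U * Uᵀ) * D * (1 - V * Vᵀ) = D) : ‖U * Vᵀ + D‖ ≤ 1 := by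
  have hQ := Matrix.isOrthProj_mul_transpose hV
  have hUD : Uᵀ * D = 0 := by
    rw [← hDT, ← Matrix.mul_assoc, ← Matrix.mul_assoc, Matrix.transpose_mul_one_sub hU]
    simp
  have hDV : D * (1 - V * Vᵀ) = D := by
    rw [← hDT, Matrix.mul_assoc, hQ.one_sub.idem]
  rw [Matrix.l2_opNorm_le_iff zero_le_one]
  intro z
  have h1 : ((U * Vᵀ) *ᵥ z) ⬝ᵥ ((U * Vᵀ) *ᵥ z) = ((V * Vᵀ) *ᵥ z) ⬝ᵥ ((V * Vᵀ) *ᵥ z) := by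
    have : ∀ A : Matrix (Fin s) (Fin r) ℝ, Aᵀ * A = 1 →
        ((A * Vᵀ) *ᵥ z) ⬝ᵥ ((A * Vᵀ) *ᵥ z) = (Vᵀ *ᵥ z) ⬝ᵥ (Vᵀ *ᵥ z) := by
      intro A hA
      rw [← Matrix.mulVec_mulVec, Matrix.dotProduct_mulVec, ← Matrix.mulVec_transpose,
        Matrix.mulVec_mulVec, hA, Matrix.one_mulVec]
    rw [this U hU, this V hV]
  have h2 : ((U * Vᵀ) *ᵥ z) ⬝ᵥ (D *ᵥ z) = 0 := by
    have h : (U * Vᵀ)ᵀ * D = 0 := by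
      rw [Matrix.transpose_mul, Matrix.mul_assoc, hUD, Matrix.mul_zero]
    rw [dotProduct_comm, Matrix.dotProduct_mulVec, ← Matrix.mulVec_transpose, Matrix.mulVec_mulVec,
      h]
    simp
  have h3 : (D *ᵥ z) ⬝ᵥ (D *ᵥ z) ≤ ((1 - V * Vᵀ) *ᵥ z) ⬝ᵥ ((1 - V * Vᵀ) *ᵥ z) := by
    have h := (Matrix.l2_opNorm_le_iff zero_le_one).1 hD ((1 - V * Vᵀ) *ᵥ z)
    rw [Matrix.mulVec_mulVec, hDV] at h
    linarith
  have h4 := hQ.dotProduct_add_compl z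
  rw [Matrix.add_mulVec, add_dotProduct, dotProduct_add, dotProduct_add, h2,
    dotProduct_comm (D *ᵥ z), h2, h1]
  linarith

/-- Approximate dual certificates force strict growth of the nuclear norm. -/
theorem StructuredCompletion.nuclearNorm_lt_of_certificate {s r : ℕ}
    {U V : Matrix (Fin s) (Fin r) ℝ} {σ : Fin r → ℝ} (hU : Uᵀ * U = 1) (hV : Vᵀ * V = 1)
    (hσ : ∀ k, 0 ≤ σ k) {H Y : Matrix (Fin s) (Fin s) ℝ} {ε κ : ℝ}
    (hYH : (Yᵀ * H).trace = 0)
    (hY : ‖Y - Matrix.tangentProj (U * Uᵀ) (V * Vᵀ) Y‖ ≤ 1 / 2)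
    (hYT : ((U * Vᵀ - Matrix.tangentProj (U * Uᵀ) (V * Vᵀ) Y)ᵀ *
      (U * Vᵀ - Matrix.tangentProj (U * Uᵀ) (V * Vᵀ) Y)).trace ≤ ε)
    (hH : ((Matrix.tangentProj (U * Uᵀ) (V * Vᵀ) H)ᵀ *
        Matrix.tangentProj (U * Uᵀ) (V * Vᵀ) H).trace
      ≤ κ * ((H - Matrix.tangentProj (U * Uᵀ) (V * Vᵀ) H)ᵀ *
        (H - Matrix.tangentProj (U * Uᵀ) (V * Vᵀ) H)).trace)
    (hε : 0 ≤ ε) (hεκ : ε * κ < 1 / 4) (hne : H ≠ 0) :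
    nuclearNorm (U * Matrix.diagonal σ * Vᵀ) <
      nuclearNorm (U * Matrix.diagonal σ * Vᵀ + H) := by
  have hP := Matrix.isOrthProj_mul_transpose hU
  have hQ := Matrix.isOrthProj_mul_transpose hV
  set P := U * Uᵀ with hPdef
  set Q := V * Vᵀ with hQdef
  set T := Matrix.tangentProj P Q with hT
  set N := H - T H with hN
  set a := (Nᵀ * N).trace with ha
  have ha0 : 0 ≤ a := Matrix.trace_transpose_mul_self_nonneg N
  -- Without a component off the tangent space, `hH` would force the tangent component to vanish as
  -- well.
  have ha_pos : 0 < a := by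
    refine lt_of_le_of_ne ha0 fun h => hne ?_
    have hN0 : N = 0 := Matrix.trace_transpose_mul_self_eq_zero h.symm
    rw [← h, mul_zero] at hH
    have hT0 := Matrix.trace_transpose_mul_self_eq_zero
      (le_antisymm hH (Matrix.trace_transpose_mul_self_nonneg _))
    rw [hN, hT0, sub_zero] at hN0
    exact hN0
  set h := √a with hh
  have hh_pos : 0 < h := Real.sqrt_pos.2 ha_pos
  have hh2 : h ^ 2 = a := Real.sq_sqrt ha0
  -- `U Vᵀ + D` is the test matrix for duality. Half of the norm budget of `D` goes to the
  -- certificate, half to the direction of `N`; Frobenius normalisation is enough because it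
  -- dominates the operator norm.
  set D := (Y - T Y) + (1 / 2 : ℝ) • (h⁻¹ • N) with hD
  have hDn : ‖D‖ ≤ 1 := by
    have h1 : ‖h⁻¹ • N‖ ≤ 1 := by
      rw [norm_smul, norm_inv, Real.norm_of_nonneg hh_pos.le, inv_mul_le_iff₀ hh_pos, mul_one]
      exact Matrix.norm_le_sqrt_trace N
    calc _ ≤ ‖Y - T Y‖ + ‖(1 / 2 : ℝ) • (h⁻¹ • N)‖ := norm_add_le _ _
      _ ≤ 1 / 2 + 1 / 2 * 1 := by
          gcongr
          rw [norm_smul]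
          gcongr
          simp
      _ = 1 := by norm_num
  have hcomp : ∀ Z : Matrix (Fin s) (Fin s) ℝ, (1 - P) * (Z - T Z) * (1 - Q) = Z - T Z := by
    intro Z
    rw [Matrix.sub_tangentProj]
    calc _ = ((1 - P) * (1 - P)) * Z * ((1 - Q) * (1 - Q)) := by simp only [Matrix.mul_assoc]
      _ = _ := by rw [hP.one_sub.idem, hQ.one_sub.idem]
  have hDT : (1 - P) * D * (1 - Q) = D := by
    rw [hD, mul_add, add_mul, hcomp, mul_smul_comm, mul_smul_comm, smul_mul_assoc, smul_mul_assoc,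
      hN, hcomp]
  have hTD : T D = 0 := by
    have h1 := Matrix.sub_tangentProj P Q D
    rw [hDT] at h1
    have : D - T D = D := h1
    simpa using this
  have hG := Matrix.norm_add_le_one_of_complement hU hV hDn hDT
  have hdual := trace_transpose_mul_le_nuclearNorm hG (U * Matrix.diagonal σ * Vᵀ + H)
  have hUD : Uᵀ * D = 0 := by
    rw [← hDT, ← Matrix.mul_assoc, ← Matrix.mul_assoc, hPdef, Matrix.transpose_mul_one_sub hU]
    simp
  have hDU : Dᵀ * U = 0 := by
    rw [← Matrix.transpose_transpose (Dᵀ * U), Matrix.transpose_mul, Matrix.transpose_transpose,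
      hUD, Matrix.transpose_zero]
  have t1 : ((U * Vᵀ + D)ᵀ * (U * Matrix.diagonal σ * Vᵀ)).trace = ∑ k, σ k := by
    rw [Matrix.transpose_add, Matrix.add_mul, ← Matrix.mul_assoc Dᵀ, ← Matrix.mul_assoc Dᵀ, hDU]
    rw [Matrix.zero_mul, Matrix.zero_mul, add_zero, Matrix.transpose_mul,
      Matrix.transpose_transpose]
    have : V * Uᵀ * (U * Matrix.diagonal σ * Vᵀ) = V * (Matrix.diagonal σ * Vᵀ) := by
      calc _ = V * ((Uᵀ * U) * (Matrix.diagonal σ * Vᵀ)) := by simp only [Matrix.mul_assoc]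
        _ = _ := by rw [hU, Matrix.one_mul]
    rw [this, Matrix.trace_mul_comm, Matrix.mul_assoc, hV, Matrix.mul_one, Matrix.trace_diagonal]
  have hTN : T N = 0 := by
    rw [hN, map_sub, hT, hP.tangentProj_idem hQ, sub_self]
  have orth : ∀ A : Matrix (Fin s) (Fin s) ℝ, T A = 0 → (Aᵀ * H).trace = (Aᵀ * N).trace := by
    intro A hA
    rw [hN, Matrix.mul_sub, Matrix.trace_sub, hT, hP.trace_transpose_tangentProj hQ]
    rw [hT] at hA
    rw [hA]
    simp
  have hTE : T (U * Vᵀ) = U * Vᵀ := by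
    rw [hT, Matrix.tangentProj_apply, hPdef, hQdef]
    have e1 : U * Uᵀ * (U * Vᵀ) = U * Vᵀ := by
      rw [Matrix.mul_assoc, ← Matrix.mul_assoc Uᵀ, hU, Matrix.one_mul]
    have e2 : U * Vᵀ * (V * Vᵀ) = U * Vᵀ := by
      rw [Matrix.mul_assoc, ← Matrix.mul_assoc Vᵀ, hV, Matrix.one_mul]
    rw [e1, e2]; abel
  set F := U * Vᵀ - T Y with hF
  have hTF : T F = F := by
    rw [hF, map_sub, hTE, hT, hP.tangentProj_idem hQ]
  -- `Y` pairs to zero with `H`, so the gain is `h / 2` and the only error is the pairing of `F`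
  -- with `T H`, whose square is at most `ε κ h² < h² / 4`.
  have t2 : ((U * Vᵀ + D)ᵀ * H).trace = (Fᵀ * T H).trace + 1 / 2 * h := by
    have e : U * Vᵀ + D = F + Y + (1 / 2 : ℝ) • (h⁻¹ • N) := by
      rw [hF, hD]; abel
    rw [e, Matrix.transpose_add, Matrix.transpose_add, Matrix.add_mul, Matrix.add_mul,
      Matrix.trace_add, Matrix.trace_add, hYH, add_zero, Matrix.transpose_smul,
      Matrix.transpose_smul, Matrix.smul_mul, Matrix.smul_mul, Matrix.trace_smul,
      Matrix.trace_smul, orth N hTN, ← ha, ← hh2, hT, hP.trace_transpose_tangentProj hQ, ← hT,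
      hTF]
    simp only [smul_eq_mul]
    field_simp
  have t3 : -(1 / 2 * h) < (Fᵀ * T H).trace := by
    have hcs := Matrix.sq_trace_transpose_mul_le F (T H)
    have : (Fᵀ * F).trace * ((T H)ᵀ * T H).trace ≤ ε * (κ * a) := by
      gcongr
      exact Matrix.trace_transpose_mul_self_nonneg _
    have h2 : (Fᵀ * T H).trace ^ 2 < (1 / 2 * h) ^ 2 := by
      rw [mul_pow, hh2]
      nlinarith
    exact (abs_lt.1 (abs_lt_of_sq_lt_sq h2 (by positivity))).1
  have hle := nuclearNorm_le_sum hU hV hσ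
  rw [Matrix.mul_add, Matrix.trace_add, t1, t2] at hdual
  linarith

end Certificate

end

section

open scoped Matrix.Norms.L2Operator

/-! ### Bernstein bounds in normalised form -/

section NormalizedBernstein

variable {ι : Type*} [Fintype ι]

/-- The common shape of all deviation bounds in a golfing step. With `K = δ q τ`, `V = δ q τ²`, `θ =
1 / (8 δ q τ)` and `t = q τ / 4` the exponent is `-1/(32 δ) + 1/(64 δ)`. For `τ = 0` this `θ` is
meaningless, but then every `B x` vanishes. -/
theorem Matrix.lazyProb_normalized_norm_gt {d₁ d₂ : Type*} [Fintype d₁] [DecidableEq d₁]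
    [Fintype d₂] [DecidableEq d₂] {w q δ τ : ℝ} (hw : 0 ≤ w) (hw1 : Fintype.card ι * w ≤ 1)
    {m : ℕ} (hq : q = m * w) (hq0 : 0 < q) (hδ : 0 < δ) (hτ : 0 ≤ τ)
    (B : ι → Matrix d₁ d₂ ℝ) (hn : ∀ x, ‖B x‖ ≤ δ * q * τ)
    (hV : ∀ z, ∑ x, (B x *ᵥ z) ⬝ᵥ (B x *ᵥ z) ≤ δ * q * τ ^ 2 * (z ⬝ᵥ z))
    (hV' : ∀ z, ∑ x, ((B x)ᵀ *ᵥ z) ⬝ᵥ ((B x)ᵀ *ᵥ z) ≤ δ * q * τ ^ 2 * (z ⬝ᵥ z)) :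
    lazyProb w m (fun l => τ / 4 < ‖q⁻¹ • (l.map B).sum - ∑ x, B x‖)
      ≤ 2 * (Fintype.card d₁ + Fintype.card d₂) * Real.exp (-(1 / (64 * δ))) := by
  rcases hτ.eq_or_lt with rfl | hτ
  · have hB : B = fun _ => 0 := by
      funext x
      exact norm_le_zero_iff.1 ((hn x).trans (by simp))
    have : ∀ l : List ι, (l.map fun _ => (0 : Matrix d₁ d₂ ℝ)).sum = 0 := by
      intro l; induction l with
      | nil => simp
      | cons x l ih => rw [List.map_cons, List.sum_cons, ih, add_zero]
    subst hB
    simp only [this, smul_zero, Finset.sum_const_zero, sub_zero, norm_zero, zero_div, lt_irrefl,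
      lazyProb, if_false, lazyExp_const]
    positivity
  · have h := Matrix.lazyProb_norm_gt (θ := 1 / (8 * δ * q * τ)) (t := q * τ / 4) hw hw1 B hn
      (by positivity) (by positivity) hV hV' (by positivity)
      (by field_simp; norm_num) (by positivity) m
    rw [← hq] at h
    have e : -(1 / (8 * δ * q * τ)) * (q * τ / 4)
        + (1 / (8 * δ * q * τ)) ^ 2 * (q * (δ * q * τ ^ 2)) = -(1 / (64 * δ)) := by
      field_simp; norm_num
    rw [e] at h
    refine le_trans (lazyProb_mono hw hw1 m fun l hl => ?_) h
    have e2 : (l.map B).sum - q • ∑ x, B x = q • (q⁻¹ • (l.map B).sum - ∑ x, B x) := by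
      rw [smul_sub, smul_smul, mul_inv_cancel₀ hq0.ne', one_smul]
    rw [e2, norm_smul, Real.norm_of_nonneg hq0.le]
    have := mul_lt_mul_of_pos_left hl hq0
    linarith

/-- A vector is a one-column matrix, with operator norm its Euclidean length. Scalars are covered by
the index type `Unit`. -/
theorem Matrix.lazyProb_normalized_vec_gt {d : Type*} [Fintype d] [DecidableEq d]
    {w q δ τ : ℝ} (hw : 0 ≤ w) (hw1 : Fintype.card ι * w ≤ 1)
    {m : ℕ} (hq : q = m * w) (hq0 : 0 < q) (hδ : 0 < δ) (hτ : 0 ≤ τ)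
    (b : ι → d → ℝ) (hn : ∀ x, b x ⬝ᵥ b x ≤ (δ * q * τ) ^ 2)
    (hV : ∑ x, b x ⬝ᵥ b x ≤ δ * q * τ ^ 2) :
    lazyProb w m (fun l => (τ / 4) ^ 2 < (q⁻¹ • (l.map b).sum - ∑ x, b x) ⬝ᵥ
        (q⁻¹ • (l.map b).sum - ∑ x, b x))
      ≤ 2 * (Fintype.card d + 1) * Real.exp (-(1 / (64 * δ))) := by
  let C : (d → ℝ) →ₗ[ℝ] Matrix d Unit ℝ :=
    { toFun := fun y => Matrix.replicateCol Unit y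
      map_add' := fun _ _ => rfl
      map_smul' := fun _ _ => rfl }
  have hCa : ∀ y i j, C y i j = y i := fun _ _ _ => rfl
  have hC : ∀ (y : d → ℝ) (z : Unit → ℝ), C y *ᵥ z = z () • y := by
    intro y z; ext i; simp [hCa, Matrix.mulVec, dotProduct, mul_comm]
  have hC' : ∀ (y : d → ℝ) (z : d → ℝ), (C y)ᵀ *ᵥ z = fun _ => y ⬝ᵥ z := by
    intro y z; ext i; simp [hCa, Matrix.mulVec, dotProduct]
  have hdot : ∀ (y : d → ℝ) (z : Unit → ℝ), (C y *ᵥ z) ⬝ᵥ (C y *ᵥ z) = (y ⬝ᵥ y) * (z ⬝ᵥ z) := by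
    intro y z
    rw [hC, smul_dotProduct, dotProduct_smul]
    simp [dotProduct]; ring
  have h := Matrix.lazyProb_normalized_norm_gt hw hw1 hq hq0 hδ hτ (fun x => C (b x))
    (fun x => by
      rw [Matrix.l2_opNorm_le_iff (by positivity)]
      intro z
      rw [hdot]
      exact mul_le_mul_of_nonneg_right (hn x) (Matrix.dotProduct_self_nonneg' z))
    (fun z => by
      simp only [hdot]
      rw [← Finset.sum_mul]
      exact mul_le_mul_of_nonneg_right hV (Matrix.dotProduct_self_nonneg' z))
    (fun z => by
      simp only [hC']
      calc _ ≤ ∑ x, (b x ⬝ᵥ b x) * (z ⬝ᵥ z) := by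
            refine Finset.sum_le_sum fun x _ => ?_
            have := Matrix.dotProduct_sq_le (b x) z
            simpa [dotProduct, sq] using this
        _ ≤ _ := by
            rw [← Finset.sum_mul]
            exact mul_le_mul_of_nonneg_right hV (Matrix.dotProduct_self_nonneg' z))
  simp only [Fintype.card_unit, Nat.cast_one] at h
  refine le_trans (lazyProb_mono hw hw1 m fun l hl => ?_) h
  have e : q⁻¹ • (l.map fun x => C (b x)).sum - ∑ x, C (b x)
      = C (q⁻¹ • (l.map b).sum - ∑ x, b x) := by
    rw [map_sub, map_smul, map_sum, map_list_sum, List.map_map]; rfl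
  rw [e]
  by_contra hcon
  have h2 := (Matrix.l2_opNorm_le_iff (by positivity)).1 (not_lt.1 hcon) (fun _ => 1)
  rw [hdot] at h2
  simp only [dotProduct, Finset.univ_unique, Finset.sum_const, Finset.card_singleton, mul_one,
    one_smul] at h2 hl
  linarith

end NormalizedBernstein

/-! ### Incoherent frames and sizes of projected atoms -/

section Frame

variable {I d : Type*} [Fintype I] [Fintype d]

theorem Matrix.vecMulVec_mulVec_eq_smul (a b z : d → ℝ) :
    Matrix.vecMulVec a b *ᵥ z = (b ⬝ᵥ z) • a := by
  ext i
  simp only [Matrix.mulVec, dotProduct, Matrix.vecMulVec_apply, Pi.smul_apply, smul_eq_mul,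
    Finset.sum_mul]
  exact Finset.sum_congr rfl fun _ _ => by ring

theorem Matrix.IsOrthProj.dotProduct_mulVec_comm {P : Matrix d d ℝ} (hP : P.IsOrthProj)
    (y z : d → ℝ) : y ⬝ᵥ P *ᵥ z = z ⬝ᵥ P *ᵥ y := by
  rw [Matrix.dotProduct_mulVec, ← Matrix.mulVec_transpose, hP.symm, dotProduct_comm]

theorem Matrix.IsOrthProj.sq_dotProduct_mulVec_le {P : Matrix d d ℝ} (hP : P.IsOrthProj)
    {y z : d → ℝ} {c : ℝ} (hy : (P *ᵥ y) ⬝ᵥ (P *ᵥ y) ≤ c) (hz : (P *ᵥ z) ⬝ᵥ (P *ᵥ z) ≤ c) :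
    (y ⬝ᵥ P *ᵥ z) ^ 2 ≤ c ^ 2 := by
  have e : y ⬝ᵥ P *ᵥ z = (P *ᵥ y) ⬝ᵥ (P *ᵥ z) := by
    rw [Matrix.dotProduct_mulVec (P *ᵥ y), ← Matrix.mulVec_transpose, hP.symm,
      Matrix.mulVec_mulVec, hP.idem, hP.dotProduct_mulVec_comm, dotProduct_comm]
  rw [e, sq c]
  refine (Matrix.dotProduct_sq_le _ _).trans ?_
  have := Matrix.dotProduct_self_nonneg' (P *ᵥ y)
  have := Matrix.dotProduct_self_nonneg' (P *ᵥ z)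
  gcongr
  linarith

variable [DecidableEq d]

theorem Matrix.IsOrthProj.dotProduct_compl_le {P : Matrix d d ℝ} (hP : P.IsOrthProj) {y : d → ℝ}
    {c : ℝ} (hy : y ⬝ᵥ y ≤ c) : ((1 - P) *ᵥ y) ⬝ᵥ ((1 - P) *ᵥ y) ≤ c := by
  have h := hP.dotProduct_add_compl y
  have := Matrix.dotProduct_self_nonneg' (P *ᵥ y)
  linarith

theorem Matrix.norm_smul_vecMulVec_le {c K : ℝ} (hK : 0 ≤ K) {a b : d → ℝ}
    (h : c ^ 2 * ((a ⬝ᵥ a) * (b ⬝ᵥ b)) ≤ K ^ 2) : ‖c • Matrix.vecMulVec a b‖ ≤ K := by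
  rw [Matrix.l2_opNorm_le_iff hK]
  intro z
  rw [Matrix.smul_mulVec, Matrix.vecMulVec_mulVec_eq_smul]
  simp only [smul_dotProduct, dotProduct_smul, smul_eq_mul]
  have h1 := Matrix.dotProduct_sq_le b z
  have h2 := Matrix.dotProduct_self_nonneg' a
  have h3 := Matrix.dotProduct_self_nonneg' z
  calc _ = c ^ 2 * (a ⬝ᵥ a) * (b ⬝ᵥ z) ^ 2 := by ring
    _ ≤ c ^ 2 * (a ⬝ᵥ a) * ((b ⬝ᵥ b) * (z ⬝ᵥ z)) := by gcongr
    _ = (c ^ 2 * ((a ⬝ᵥ a) * (b ⬝ᵥ b))) * (z ⬝ᵥ z) := by ring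
    _ ≤ _ := by gcongr

/-- The rows of two matrices with orthonormal columns, together with a pair of projections, with
row norms (squared) at most `B` and projected row norms (squared) at most `A ≤ B`. -/
structure IncoherentFrame (u v : I → d → ℝ) (P Q : Matrix d d ℝ) (A B : ℝ) : Prop where
  left_proj : P.IsOrthProj
  right_proj : Q.IsOrthProj
  left_tight : ∑ i, Matrix.vecMulVec (u i) (u i) = 1
  right_tight : ∑ i, Matrix.vecMulVec (v i) (v i) = 1
  nonneg : 0 ≤ A
  le : A ≤ B
  left_norm : ∀ i, u i ⬝ᵥ u i ≤ B
  right_norm : ∀ i, v i ⬝ᵥ v i ≤ B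
  left_proj_norm : ∀ i, (P *ᵥ u i) ⬝ᵥ (P *ᵥ u i) ≤ A
  right_proj_norm : ∀ i, (Q *ᵥ v i) ⬝ᵥ (Q *ᵥ v i) ≤ A

namespace IncoherentFrame

variable {u v : I → d → ℝ} {P Q : Matrix d d ℝ} {A B : ℝ}

theorem swap (F : IncoherentFrame u v P Q A B) : IncoherentFrame v u Q P A B :=
  ⟨F.right_proj, F.left_proj, F.right_tight, F.left_tight, F.nonneg, F.le, F.right_norm,
    F.left_norm, F.right_proj_norm, F.left_proj_norm⟩

theorem nonneg' (F : IncoherentFrame u v P Q A B) : 0 ≤ B := F.nonneg.trans F.le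

theorem sum_smul_left (F : IncoherentFrame u v P Q A B) (z : d → ℝ) :
    ∑ i, (u i ⬝ᵥ z) • u i = z := by
  have h := congrArg (· *ᵥ z) F.left_tight
  simpa only [Matrix.sum_mulVec, Matrix.vecMulVec_mulVec_eq_smul, Matrix.one_mulVec] using h

theorem sum_sq_left (F : IncoherentFrame u v P Q A B) (z : d → ℝ) :
    ∑ i, (u i ⬝ᵥ z) ^ 2 = z ⬝ᵥ z := by
  have h := congrArg (fun y => y ⬝ᵥ z) (F.sum_smul_left z)
  simpa only [sum_dotProduct, smul_dotProduct, smul_eq_mul, ← sq] using h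

theorem sum_proj_sq_left (F : IncoherentFrame u v P Q A B) {R : Matrix d d ℝ} (hR : R.IsOrthProj)
    (y : d → ℝ) : ∑ i, (y ⬝ᵥ R *ᵥ u i) ^ 2 = (R *ᵥ y) ⬝ᵥ (R *ᵥ y) := by
  rw [← F.sum_sq_left]
  exact Finset.sum_congr rfl fun i _ => by rw [hR.dotProduct_mulVec_comm]

/-- Bounds for the rows of the tangent projection of the sampling atoms. -/
theorem row_atom_bounds (F : IncoherentFrame u v P Q A B) {c : I → I → ℝ} {ν : ℝ}
    (hc : ∀ a b, c a b ^ 2 ≤ (A * ν) ^ 2) (hrow : ∀ a, ∑ b, c a b ^ 2 ≤ A * ν ^ 2) (y : I)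
    (g : I → I → d → ℝ) (hg : ∀ a b, g a b = c a b • ((u y ⬝ᵥ P *ᵥ u a) • v b
      + (u y ⬝ᵥ (1 - P) *ᵥ u a) • Q *ᵥ v b)) :
    (∀ a b, g a b ⬝ᵥ g a b ≤ (2 * A * B) ^ 2 * (A * ν ^ 2)) ∧
      ∑ a, ∑ b, g a b ⬝ᵥ g a b ≤ 4 * A * B * (A * ν ^ 2) := by
  have hA := F.nonneg
  have hB := F.nonneg'
  -- After `(x + y)² ≤ 2 x² + 2 y²` each term has one projected factor, worth `A`, and one free
  -- factor, worth `B`. Hence `A * B` below instead of `B ^ 2`.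
  have hpt : ∀ a b, g a b ⬝ᵥ g a b ≤ c a b ^ 2 *
      (2 * ((u y ⬝ᵥ P *ᵥ u a) ^ 2 * B + (u y ⬝ᵥ (1 - P) *ᵥ u a) ^ 2 * A)) := by
    intro a b
    rw [hg]
    set x₁ := u y ⬝ᵥ P *ᵥ u a
    set x₂ := u y ⬝ᵥ (1 - P) *ᵥ u a
    have h0 := Matrix.dotProduct_self_nonneg' (x₁ • v b - x₂ • Q *ᵥ v b)
    simp only [sub_dotProduct, dotProduct_sub, smul_dotProduct, dotProduct_smul, smul_eq_mul] at h0
    simp only [add_dotProduct, dotProduct_add, smul_dotProduct, dotProduct_smul, smul_eq_mul]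
    have h1 := mul_le_mul_of_nonneg_left (F.right_norm b) (sq_nonneg x₁)
    have h2 := mul_le_mul_of_nonneg_left (F.right_proj_norm b) (sq_nonneg x₂)
    calc _ = c a b ^ 2 * (x₁ * (x₁ * (v b ⬝ᵥ v b)) + x₂ * (x₁ * (Q *ᵥ v b ⬝ᵥ v b))
          + (x₁ * (x₂ * (v b ⬝ᵥ Q *ᵥ v b)) + x₂ * (x₂ * (Q *ᵥ v b ⬝ᵥ Q *ᵥ v b)))) := by ring
      _ ≤ _ := by
          apply mul_le_mul_of_nonneg_left _ (sq_nonneg _)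
          linarith
  have hb1 : ∀ a, (u y ⬝ᵥ P *ᵥ u a) ^ 2 ≤ A ^ 2 := fun a =>
    F.left_proj.sq_dotProduct_mulVec_le (F.left_proj_norm y) (F.left_proj_norm a)
  have hb2 : ∀ a, (u y ⬝ᵥ (1 - P) *ᵥ u a) ^ 2 ≤ B ^ 2 := fun a =>
    F.left_proj.one_sub.sq_dotProduct_mulVec_le (F.left_proj.dotProduct_compl_le (F.left_norm y))
      (F.left_proj.dotProduct_compl_le (F.left_norm a))
  have hAB : A ^ 2 * B ≤ A * B ^ 2 := by
    have := mul_le_mul_of_nonneg_left F.le (mul_nonneg hA hB)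
    linarith
  constructor
  · intro a b
    refine (hpt a b).trans ?_
    calc _ ≤ (A * ν) ^ 2 * (2 * (A ^ 2 * B + B ^ 2 * A)) := by
          gcongr ?_ * (2 * (?_ * B + ?_ * A))
          · exact hc a b
          · exact hb1 a
          · exact hb2 a
      _ ≤ (A * ν) ^ 2 * (2 * (A * B ^ 2 + B ^ 2 * A)) := by gcongr
      _ = _ := by ring
  · calc _ ≤ ∑ a, ∑ b, c a b ^ 2 *
          (2 * ((u y ⬝ᵥ P *ᵥ u a) ^ 2 * B + (u y ⬝ᵥ (1 - P) *ᵥ u a) ^ 2 * A)) :=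
          Finset.sum_le_sum fun a _ => Finset.sum_le_sum fun b _ => hpt a b
      -- The bracket is free of `b`, so the row bound sums `c²` over `b` first; Parseval then sums
      -- the bracket over `a`.
      _ ≤ ∑ a, A * ν ^ 2 *
          (2 * ((u y ⬝ᵥ P *ᵥ u a) ^ 2 * B + (u y ⬝ᵥ (1 - P) *ᵥ u a) ^ 2 * A)) := by
          refine Finset.sum_le_sum fun a _ => ?_
          rw [← Finset.sum_mul]
          gcongr
          exact hrow a
      _ = A * ν ^ 2 * (2 * ((P *ᵥ u y ⬝ᵥ P *ᵥ u y) * B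
          + ((1 - P) *ᵥ u y ⬝ᵥ (1 - P) *ᵥ u y) * A)) := by
          rw [← Finset.mul_sum, ← Finset.mul_sum, Finset.sum_add_distrib, ← Finset.sum_mul,
            ← Finset.sum_mul, F.sum_proj_sq_left F.left_proj, F.sum_proj_sq_left F.left_proj.one_sub]
      _ ≤ A * ν ^ 2 * (2 * (A * B + B * A)) := by
          gcongr
          · exact F.left_proj_norm y
          · exact F.left_proj.dotProduct_compl_le (F.left_norm y)
      _ = _ := by ring

/-- Bounds for the entries of the tangent projection of the sampling atoms. -/
theorem entry_atom_bounds (F : IncoherentFrame u v P Q A B) {c : I → I → ℝ} {ν : ℝ}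
    (hc : ∀ a b, c a b ^ 2 ≤ (A * ν) ^ 2) (y y' : I)
    (g : I → I → ℝ) (hg : ∀ a b, g a b = c a b * ((u y ⬝ᵥ P *ᵥ u a) * (v y' ⬝ᵥ v b)
      + (u y ⬝ᵥ (1 - P) *ᵥ u a) * (v y' ⬝ᵥ Q *ᵥ v b))) :
    (∀ a b, g a b ^ 2 ≤ (2 * A * B) ^ 2 * (A * ν) ^ 2) ∧
      ∑ a, ∑ b, g a b ^ 2 ≤ 4 * A * B * (A * ν) ^ 2 := by
  have hA := F.nonneg
  have hB := F.nonneg'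
  have hpt : ∀ a b, g a b ^ 2 ≤ (A * ν) ^ 2 * (2 * ((u y ⬝ᵥ P *ᵥ u a) ^ 2 * (v b ⬝ᵥ v y') ^ 2
      + (u y ⬝ᵥ (1 - P) *ᵥ u a) ^ 2 * (v y' ⬝ᵥ Q *ᵥ v b) ^ 2)) := by
    intro a b
    rw [hg, mul_pow, dotProduct_comm (v y') (v b)]
    gcongr ?_ * ?_
    · exact hc a b
    · have := two_mul_le_add_sq ((u y ⬝ᵥ P *ᵥ u a) * (v b ⬝ᵥ v y'))
        ((u y ⬝ᵥ (1 - P) *ᵥ u a) * (v y' ⬝ᵥ Q *ᵥ v b))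
      nlinarith
  have hb1 : ∀ a, (u y ⬝ᵥ P *ᵥ u a) ^ 2 ≤ A ^ 2 := fun a =>
    F.left_proj.sq_dotProduct_mulVec_le (F.left_proj_norm y) (F.left_proj_norm a)
  have hb2 : ∀ a, (u y ⬝ᵥ (1 - P) *ᵥ u a) ^ 2 ≤ B ^ 2 := fun a =>
    F.left_proj.one_sub.sq_dotProduct_mulVec_le (F.left_proj.dotProduct_compl_le (F.left_norm y))
      (F.left_proj.dotProduct_compl_le (F.left_norm a))
  have hb3 : ∀ b, (v y' ⬝ᵥ Q *ᵥ v b) ^ 2 ≤ A ^ 2 := fun a =>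
    F.right_proj.sq_dotProduct_mulVec_le (F.right_proj_norm y') (F.right_proj_norm a)
  have hb4 : ∀ b, (v b ⬝ᵥ v y') ^ 2 ≤ B ^ 2 := fun b => by
    refine (Matrix.dotProduct_sq_le _ _).trans ?_
    rw [sq B]
    exact mul_le_mul (F.right_norm b) (F.right_norm y') (Matrix.dotProduct_self_nonneg' _) hB
  constructor
  · intro a b
    refine (hpt a b).trans ?_
    calc _ ≤ (A * ν) ^ 2 * (2 * (A ^ 2 * B ^ 2 + B ^ 2 * A ^ 2)) := by
          gcongr (A * ν) ^ 2 * (2 * (?_ * ?_ + ?_ * ?_))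
          · exact hb1 a
          · exact hb4 b
          · exact hb2 a
          · exact hb3 b
      _ = _ := by ring
  · calc _ ≤ ∑ a, ∑ b, (A * ν) ^ 2 * (2 * ((u y ⬝ᵥ P *ᵥ u a) ^ 2 * (v b ⬝ᵥ v y') ^ 2
          + (u y ⬝ᵥ (1 - P) *ᵥ u a) ^ 2 * (v y' ⬝ᵥ Q *ᵥ v b) ^ 2)) :=
          Finset.sum_le_sum fun a _ => Finset.sum_le_sum fun b _ => hpt a b
      _ = (A * ν) ^ 2 * (2 * ((P *ᵥ u y ⬝ᵥ P *ᵥ u y) * (v y' ⬝ᵥ v y')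
          + ((1 - P) *ᵥ u y ⬝ᵥ (1 - P) *ᵥ u y) * (Q *ᵥ v y' ⬝ᵥ Q *ᵥ v y'))) := by
          simp only [← Finset.mul_sum, Finset.sum_add_distrib, ← Finset.sum_mul]
          rw [F.sum_proj_sq_left F.left_proj, F.sum_proj_sq_left F.left_proj.one_sub,
            F.swap.sum_proj_sq_left F.right_proj, F.swap.sum_sq_left]
      _ ≤ (A * ν) ^ 2 * (2 * (A * B + B * A)) := by
          have := Matrix.dotProduct_self_nonneg' (v y')
          have := Matrix.dotProduct_self_nonneg' (Q *ᵥ v y')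
          gcongr
          · exact F.left_proj_norm y
          · exact F.right_norm y'
          · exact F.left_proj.dotProduct_compl_le (F.left_norm y)
          · exact F.right_proj_norm y'
      _ = _ := by ring

end IncoherentFrame

end Frame

end

section

open scoped Matrix.Norms.L2Operator

/-! ### One golfing step -/

section Golfing

variable {I d : Type*} [Fintype d]

/-- The rank-one matrix `u_a v_bᵀ` measured by the index pair `(a, b)`. -/
def sampleAtom (u v : I → d → ℝ) (x : I × I) : Matrix d d ℝ := Matrix.vecMulVec (u x.1) (v x.2)

/-- The measurement `Z ↦ u_aᵀ Z v_b`. -/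
def sampleCoef (u v : I → d → ℝ) (x : I × I) : Matrix d d ℝ →ₗ[ℝ] ℝ where
  toFun Z := u x.1 ⬝ᵥ Z *ᵥ v x.2
  map_add' A B := by rw [Matrix.add_mulVec, dotProduct_add]
  map_smul' c A := by rw [Matrix.smul_mulVec, dotProduct_smul]; rfl

/-- The empirical sampling operator. -/
noncomputable def sampleOp (u v : I → d → ℝ) (q : ℝ) (l : List (I × I)) (Z : Matrix d d ℝ) :
    Matrix d d ℝ :=
  q⁻¹ • (l.map fun x => sampleCoef u v x Z • sampleAtom u v x).sum

/-- Incoherence of a matrix in the range of the tangent projection, at scale `ν`. -/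
structure IsGolfable (u v : I → d → ℝ) (P Q : Matrix d d ℝ) (A ν : ℝ) (W : Matrix d d ℝ) :
    Prop where
  tangent : Matrix.tangentProj P Q W = W
  entry : ∀ x, sampleCoef u v x W ^ 2 ≤ (A * ν) ^ 2
  row : ∀ i, (Wᵀ *ᵥ u i) ⬝ᵥ (Wᵀ *ᵥ u i) ≤ A * ν ^ 2
  column : ∀ j, (W *ᵥ v j) ⬝ᵥ (W *ᵥ v j) ≤ A * ν ^ 2

theorem sampleCoef_apply (u v : I → d → ℝ) (x : I × I) (Z : Matrix d d ℝ) :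
    sampleCoef u v x Z = u x.1 ⬝ᵥ Z *ᵥ v x.2 := rfl

theorem trace_sampleAtom_transpose_mul (u v : I → d → ℝ) (x : I × I) (Z : Matrix d d ℝ) :
    ((sampleAtom u v x)ᵀ * Z).trace = sampleCoef u v x Z := by
  rw [sampleAtom, Matrix.transpose_vecMulVec, Matrix.vecMulVec_mul, Matrix.trace_vecMulVec,
    sampleCoef_apply, Matrix.dotProduct_mulVec, dotProduct_comm]

variable [DecidableEq d]

/-- Each rank-one term carries one projected factor. This form suits rows and entries; its mirror
image below suits columns. -/
theorem tangentProj_sampleAtom {P Q : Matrix d d ℝ} (hQ : Q.IsOrthProj) (u v : I → d → ℝ)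
    (x : I × I) : Matrix.tangentProj P Q (sampleAtom u v x)
      = Matrix.vecMulVec (P *ᵥ u x.1) (v x.2) + Matrix.vecMulVec ((1 - P) *ᵥ u x.1) (Q *ᵥ v x.2) := by
  have hv : ∀ a : d → ℝ, Matrix.vecMulVec a (v x.2) * Q = Matrix.vecMulVec a (Q *ᵥ v x.2) := by
    intro a
    rw [Matrix.vecMulVec_mul, ← Matrix.mulVec_transpose, hQ.symm]
  rw [Matrix.tangentProj_apply, sampleAtom, Matrix.mul_vecMulVec, hv, hv, Matrix.sub_mulVec,
    Matrix.one_mulVec]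
  ext i j
  simp [Matrix.vecMulVec_apply]
  ring

theorem tangentProj_sampleAtom' {P Q : Matrix d d ℝ} (hQ : Q.IsOrthProj) (u v : I → d → ℝ)
    (x : I × I) : Matrix.tangentProj P Q (sampleAtom u v x)
      = Matrix.vecMulVec (u x.1) (Q *ᵥ v x.2) + Matrix.vecMulVec (P *ᵥ u x.1) ((1 - Q) *ᵥ v x.2) := by
  rw [tangentProj_sampleAtom hQ]
  ext i j
  simp [Matrix.vecMulVec_apply, Matrix.sub_mulVec]
  ring

variable [Fintype I]

namespace IncoherentFrame

variable {u v : I → d → ℝ} {P Q : Matrix d d ℝ} {A B : ℝ}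

/-- The tensor product of two tight frames is tight. Consequently `sampleOp` is unbiased when `q = m
* w`. -/
theorem sum_sampleCoef_smul (F : IncoherentFrame u v P Q A B) (Z : Matrix d d ℝ) :
    ∑ x : I × I, sampleCoef u v x Z • sampleAtom u v x = Z := by
  have h1 : ∀ x : I × I, sampleCoef u v x Z • sampleAtom u v x
      = Matrix.vecMulVec (u x.1) (u x.1) * Z * Matrix.vecMulVec (v x.2) (v x.2) := by
    intro x
    rw [Matrix.vecMulVec_mul, Matrix.vecMulVec_mul_vecMulVec, sampleCoef_apply,
      Matrix.dotProduct_mulVec, Matrix.vecMulVec_smul]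
    rfl
  simp only [h1]
  rw [Fintype.sum_prod_type]
  simp only [← Finset.mul_sum, ← Finset.sum_mul, F.left_tight, F.right_tight, one_mul, mul_one]

/-- Deviation bounds pass through linear images of the sampling operator. -/
theorem map_sampleOp_sub (F : IncoherentFrame u v P Q A B) {E : Type*} [AddCommGroup E]
    [Module ℝ E] (L : Matrix d d ℝ →ₗ[ℝ] E) (q : ℝ) (l : List (I × I)) (Z : Matrix d d ℝ) :
    q⁻¹ • (l.map fun x => sampleCoef u v x Z • L (sampleAtom u v x)).sum
      - ∑ x, sampleCoef u v x Z • L (sampleAtom u v x) = L (sampleOp u v q l Z - Z) := by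
  rw [sampleOp, map_sub, map_smul, map_list_sum, List.map_map]
  conv_rhs => rw [← F.sum_sampleCoef_smul Z]
  rw [map_sum]
  congr 1
  · congr 3
    ext x
    simp [F.sum_sampleCoef_smul]
  · simp

variable {w q δ ν : ℝ} {m : ℕ} {W : Matrix d d ℝ}

theorem row_sq_sum (F : IncoherentFrame u v P Q A B) (i : I) (Z : Matrix d d ℝ) :
    ∑ j, sampleCoef u v (i, j) Z ^ 2 = (Zᵀ *ᵥ u i) ⬝ᵥ (Zᵀ *ᵥ u i) := by
  rw [← F.swap.sum_sq_left]
  refine Finset.sum_congr rfl fun j _ => ?_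
  rw [sampleCoef_apply, Matrix.dotProduct_mulVec, ← Matrix.mulVec_transpose, dotProduct_comm]

theorem column_sq_sum (F : IncoherentFrame u v P Q A B) (j : I) (Z : Matrix d d ℝ) :
    ∑ i, sampleCoef u v (i, j) Z ^ 2 = (Z *ᵥ v j) ⬝ᵥ (Z *ᵥ v j) := by
  rw [← F.sum_sq_left]
  rfl

/-- Each part of `IsGolfable` has its role here: entries give the uniform bound, columns and rows
the two variances. -/
theorem lazyProb_norm_dev (F : IncoherentFrame u v P Q A B) (hw : 0 ≤ w)
    (hw1 : Fintype.card (I × I) * w ≤ 1) (hq : q = m * w) (hq0 : 0 < q) (hδ : 0 < δ)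
    (hAB : 4 * A * B ≤ δ * q) (hν : 0 ≤ ν) (hW : IsGolfable u v P Q A ν W) :
    lazyProb w m (fun l => ν / 4 < ‖sampleOp u v q l W - W‖)
      ≤ 2 * (Fintype.card d + Fintype.card d) * Real.exp (-(1 / (64 * δ))) := by
  have hA := F.nonneg
  have hB := F.nonneg'
  have hABn : 0 ≤ A * B := mul_nonneg hA hB
  have hAB' : A * B ≤ δ * q := by linarith
  have e : ∀ x : I × I, ∀ z, (sampleCoef u v x W • sampleAtom u v x) *ᵥ z
      = (sampleCoef u v x W * (v x.2 ⬝ᵥ z)) • u x.1 := by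
    intro x z
    rw [Matrix.smul_mulVec, sampleAtom, Matrix.vecMulVec_mulVec_eq_smul, smul_smul]
  have e' : ∀ x : I × I, ∀ z, (sampleCoef u v x W • sampleAtom u v x)ᵀ *ᵥ z
      = (sampleCoef u v x W * (u x.1 ⬝ᵥ z)) • v x.2 := by
    intro x z
    rw [Matrix.transpose_smul, Matrix.smul_mulVec, sampleAtom, Matrix.transpose_vecMulVec,
      Matrix.vecMulVec_mulVec_eq_smul, smul_smul]
  have h := Matrix.lazyProb_normalized_norm_gt hw hw1 hq hq0 hδ hν
    (fun x => sampleCoef u v x W • sampleAtom u v x)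
    (fun x => by
      refine Matrix.norm_smul_vecMulVec_le (by positivity) ?_
      have h1 := F.left_norm x.1
      have h2 := F.right_norm x.2
      have h3 := Matrix.dotProduct_self_nonneg' (u x.1)
      have h4 := Matrix.dotProduct_self_nonneg' (v x.2)
      calc _ ≤ (A * ν) ^ 2 * (B * B) := by
            gcongr ?_ * (?_ * ?_)
            exact hW.entry x
        _ = (A * B * ν) ^ 2 := by ring
        _ ≤ _ := by gcongr)
    (fun z => by
      simp only [e, smul_dotProduct, dotProduct_smul, smul_eq_mul]
      calc _ ≤ ∑ x : I × I, (v x.2 ⬝ᵥ z) ^ 2 * (B * sampleCoef u v x W ^ 2) := by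
            refine Finset.sum_le_sum fun x _ => ?_
            have h1 := mul_le_mul_of_nonneg_left (F.left_norm x.1)
              (sq_nonneg (sampleCoef u v x W * (v x.2 ⬝ᵥ z)))
            linarith
        _ = ∑ j, (v j ⬝ᵥ z) ^ 2 * (B * ((W *ᵥ v j) ⬝ᵥ (W *ᵥ v j))) := by
            rw [Fintype.sum_prod_type_right]
            simp only [← Finset.mul_sum, F.column_sq_sum]
        _ ≤ ∑ j, (v j ⬝ᵥ z) ^ 2 * (B * (A * ν ^ 2)) := by
            gcongr with j
            exact hW.column j
        _ = (A * B) * ν ^ 2 * (z ⬝ᵥ z) := by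
            rw [← Finset.sum_mul, F.swap.sum_sq_left]; ring
        _ ≤ _ := by
            have := Matrix.dotProduct_self_nonneg' z
            gcongr)
    (fun z => by
      simp only [e', smul_dotProduct, dotProduct_smul, smul_eq_mul]
      calc _ ≤ ∑ x : I × I, (u x.1 ⬝ᵥ z) ^ 2 * (B * sampleCoef u v x W ^ 2) := by
            refine Finset.sum_le_sum fun x _ => ?_
            have h1 := mul_le_mul_of_nonneg_left (F.right_norm x.2)
              (sq_nonneg (sampleCoef u v x W * (u x.1 ⬝ᵥ z)))
            linarith
        _ = ∑ i, (u i ⬝ᵥ z) ^ 2 * (B * ((Wᵀ *ᵥ u i) ⬝ᵥ (Wᵀ *ᵥ u i))) := by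
            rw [Fintype.sum_prod_type]
            simp only [← Finset.mul_sum, F.row_sq_sum]
        _ ≤ ∑ i, (u i ⬝ᵥ z) ^ 2 * (B * (A * ν ^ 2)) := by
            gcongr with i
            exact hW.row i
        _ = (A * B) * ν ^ 2 * (z ⬝ᵥ z) := by
            rw [← Finset.sum_mul, F.sum_sq_left]; ring
        _ ≤ _ := by
            have := Matrix.dotProduct_self_nonneg' z
            gcongr)
  simpa only [F.sum_sampleCoef_smul, ← sampleOp.eq_1] using h

theorem lazyProb_entry_dev (F : IncoherentFrame u v P Q A B) (hw : 0 ≤ w)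
    (hw1 : Fintype.card (I × I) * w ≤ 1) (hq : q = m * w) (hq0 : 0 < q) (hδ : 0 < δ)
    (hAB : 4 * A * B ≤ δ * q) (hν : 0 ≤ ν) (hW : IsGolfable u v P Q A ν W) (y : I × I) :
    lazyProb w m (fun l => (A * ν / 4) ^ 2
        < sampleCoef u v y (Matrix.tangentProj P Q (sampleOp u v q l W - W)) ^ 2)
      ≤ 4 * Real.exp (-(1 / (64 * δ))) := by
  have hA := F.nonneg
  have hB := F.nonneg'
  have hABn : 0 ≤ A * B := mul_nonneg hA hB
  let L : Matrix d d ℝ →ₗ[ℝ] Unit → ℝ :=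
    LinearMap.pi fun _ => sampleCoef u v y ∘ₗ Matrix.tangentProj P Q
  have hL : ∀ Z k, L Z k = sampleCoef u v y (Matrix.tangentProj P Q Z) := fun _ _ => rfl
  have hb := F.entry_atom_bounds (c := fun a b => sampleCoef u v (a, b) W)
    (fun a b => hW.entry (a, b)) y.1 y.2
    (fun a b => sampleCoef u v (a, b) W * L (sampleAtom u v (a, b)) ()) (fun a b => by
      rw [hL, tangentProj_sampleAtom F.right_proj, sampleCoef_apply u v y, Matrix.add_mulVec,
        Matrix.vecMulVec_mulVec_eq_smul, Matrix.vecMulVec_mulVec_eq_smul, dotProduct_add,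
        dotProduct_smul, dotProduct_smul, dotProduct_comm (v b) (v y.2),
        dotProduct_comm (Q *ᵥ v b)]
      simp only [smul_eq_mul]
      ring)
  have h := Matrix.lazyProb_normalized_vec_gt hw hw1 hq hq0 hδ (mul_nonneg hA hν)
    (fun x => sampleCoef u v x W • L (sampleAtom u v x))
    (fun x => by
      have h1 := hb.1 x.1 x.2
      simp only [dotProduct, Finset.univ_unique, Finset.sum_singleton, Pi.smul_apply, smul_eq_mul]
      calc _ ≤ (2 * A * B) ^ 2 * (A * ν) ^ 2 := by rw [← sq]; exact h1
        _ = (2 * A * B * (A * ν)) ^ 2 := by ring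
        _ ≤ _ := by
            gcongr (?_ * (A * ν)) ^ 2
            linarith)
    (by
      simp only [dotProduct, Finset.univ_unique, Finset.sum_singleton, Pi.smul_apply, smul_eq_mul]
      rw [Fintype.sum_prod_type]
      simp only [← sq]
      refine hb.2.trans ?_
      gcongr)
  simp only [F.map_sampleOp_sub L, Fintype.card_unit, Nat.cast_one] at h
  refine le_trans (lazyProb_mono hw hw1 m fun l hl => ?_) (h.trans (by norm_num))
  simp only [dotProduct, Finset.univ_unique, Finset.sum_singleton, ← sq, hL]
  exact hl

theorem lazyProb_row_dev (F : IncoherentFrame u v P Q A B) (hw : 0 ≤ w)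
    (hw1 : Fintype.card (I × I) * w ≤ 1) (hq : q = m * w) (hq0 : 0 < q) (hδ : 0 < δ)
    (hAB : 4 * A * B ≤ δ * q) (hν : 0 ≤ ν) (hW : IsGolfable u v P Q A ν W) (y : I) :
    lazyProb w m (fun l => A * (ν / 4) ^ 2
        < ((Matrix.tangentProj P Q (sampleOp u v q l W - W))ᵀ *ᵥ u y) ⬝ᵥ
          ((Matrix.tangentProj P Q (sampleOp u v q l W - W))ᵀ *ᵥ u y))
      ≤ 2 * (Fintype.card d + 1) * Real.exp (-(1 / (64 * δ))) := by
  have hA := F.nonneg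
  have hB := F.nonneg'
  have hABn : 0 ≤ A * B := mul_nonneg hA hB
  have hs : (√A * ν) ^ 2 = A * ν ^ 2 := by rw [mul_pow, Real.sq_sqrt hA]
  let L : Matrix d d ℝ →ₗ[ℝ] d → ℝ :=
    { toFun := fun Z => (Matrix.tangentProj P Q Z)ᵀ *ᵥ u y
      map_add' := fun Z Z' => by rw [map_add, Matrix.transpose_add, Matrix.add_mulVec]
      map_smul' := fun c Z => by
        rw [map_smul, Matrix.transpose_smul, Matrix.smul_mulVec]; rfl }
  have hL : ∀ Z, L Z = (Matrix.tangentProj P Q Z)ᵀ *ᵥ u y := fun _ => rfl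
  have hb := F.row_atom_bounds (c := fun a b => sampleCoef u v (a, b) W)
    (fun a b => hW.entry (a, b)) (fun a => by rw [F.row_sq_sum]; exact hW.row a) y
    (fun a b => sampleCoef u v (a, b) W • L (sampleAtom u v (a, b))) (fun a b => by
      rw [hL, tangentProj_sampleAtom F.right_proj, Matrix.transpose_add, Matrix.add_mulVec,
        Matrix.transpose_vecMulVec, Matrix.transpose_vecMulVec, Matrix.vecMulVec_mulVec_eq_smul,
        Matrix.vecMulVec_mulVec_eq_smul, dotProduct_comm (P *ᵥ u a), dotProduct_comm _ (u y)])
  have h := Matrix.lazyProb_normalized_vec_gt hw hw1 hq hq0 hδ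
    (mul_nonneg (Real.sqrt_nonneg A) hν) (fun x => sampleCoef u v x W • L (sampleAtom u v x))
    (fun x => by
      refine (hb.1 x.1 x.2).trans ?_
      rw [← hs, ← mul_pow]
      gcongr (?_ * (√A * ν)) ^ 2
      linarith)
    (by
      rw [Fintype.sum_prod_type, hs]
      refine hb.2.trans ?_
      gcongr)
  simp only [F.map_sampleOp_sub L] at h
  refine le_trans (lazyProb_mono hw hw1 m fun l hl => ?_) h
  rw [div_pow, hs, hL]
  linarith

theorem lazyProb_column_dev (F : IncoherentFrame u v P Q A B) (hw : 0 ≤ w)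
    (hw1 : Fintype.card (I × I) * w ≤ 1) (hq : q = m * w) (hq0 : 0 < q) (hδ : 0 < δ)
    (hAB : 4 * A * B ≤ δ * q) (hν : 0 ≤ ν) (hW : IsGolfable u v P Q A ν W) (y : I) :
    lazyProb w m (fun l => A * (ν / 4) ^ 2
        < (Matrix.tangentProj P Q (sampleOp u v q l W - W) *ᵥ v y) ⬝ᵥ
          (Matrix.tangentProj P Q (sampleOp u v q l W - W) *ᵥ v y))
      ≤ 2 * (Fintype.card d + 1) * Real.exp (-(1 / (64 * δ))) := by
  have hA := F.nonneg
  have hB := F.nonneg'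
  have hABn : 0 ≤ A * B := mul_nonneg hA hB
  have hs : (√A * ν) ^ 2 = A * ν ^ 2 := by rw [mul_pow, Real.sq_sqrt hA]
  let L : Matrix d d ℝ →ₗ[ℝ] d → ℝ :=
    { toFun := fun Z => Matrix.tangentProj P Q Z *ᵥ v y
      map_add' := fun Z Z' => by rw [map_add, Matrix.add_mulVec]
      map_smul' := fun c Z => by rw [map_smul, Matrix.smul_mulVec]; rfl }
  have hL : ∀ Z, L Z = Matrix.tangentProj P Q Z *ᵥ v y := fun _ => rfl
  -- Columns are the rows of the swapped frame, with the indices of `c` exchanged.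
  have hb := F.swap.row_atom_bounds (c := fun b a => sampleCoef u v (a, b) W)
    (fun b a => hW.entry (a, b)) (fun b => by rw [F.column_sq_sum]; exact hW.column b) y
    (fun b a => sampleCoef u v (a, b) W • L (sampleAtom u v (a, b))) (fun b a => by
      rw [hL, tangentProj_sampleAtom' F.right_proj, Matrix.add_mulVec,
        Matrix.vecMulVec_mulVec_eq_smul,
        Matrix.vecMulVec_mulVec_eq_smul, dotProduct_comm (Q *ᵥ v b), dotProduct_comm _ (v y)])
  have h := Matrix.lazyProb_normalized_vec_gt hw hw1 hq hq0 hδ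
    (mul_nonneg (Real.sqrt_nonneg A) hν) (fun x => sampleCoef u v x W • L (sampleAtom u v x))
    (fun x => by
      refine (hb.1 x.2 x.1).trans ?_
      rw [← hs, ← mul_pow]
      gcongr (?_ * (√A * ν)) ^ 2
      linarith)
    (by
      rw [Fintype.sum_prod_type_right, hs]
      refine hb.2.trans ?_
      gcongr)
  simp only [F.map_sampleOp_sub L] at h
  refine le_trans (lazyProb_mono hw hw1 m fun l hl => ?_) h
  rw [div_pow, hs, hL]
  linarith

/-- One golfing step succeeds with high probability. -/
theorem lazyProb_golfing_step (F : IncoherentFrame u v P Q A B) (hw : 0 ≤ w)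
    (hw1 : Fintype.card (I × I) * w ≤ 1) (hq : q = m * w) (hq0 : 0 < q) (hδ : 0 < δ)
    (hAB : 4 * A * B ≤ δ * q) (hν : 0 ≤ ν) (hW : IsGolfable u v P Q A ν W) :
    lazyProb w m (fun l => ¬ (‖sampleOp u v q l W - W‖ ≤ ν / 4 ∧
        IsGolfable u v P Q A (ν / 2) (Matrix.tangentProj P Q (W - sampleOp u v q l W))))
      ≤ (4 * Fintype.card d + 4 * Fintype.card I ^ 2 + 4 * Fintype.card I * (Fintype.card d + 1))
        * Real.exp (-(1 / (64 * δ))) := by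
  have hA := F.nonneg
  have hν2 : (ν / 4) ^ 2 ≤ (ν / 2) ^ 2 := by nlinarith [sq_nonneg ν]
  have hAν2 : (A * ν / 4) ^ 2 ≤ (A * (ν / 2)) ^ 2 := by nlinarith [sq_nonneg (A * ν)]
  set X := fun l => Matrix.tangentProj P Q (sampleOp u v q l W - W) with hX
  have hneg : ∀ l, Matrix.tangentProj P Q (W - sampleOp u v q l W) = -X l := fun l => by
    rw [hX, ← map_neg, neg_sub]
  have h1 := F.lazyProb_norm_dev hw hw1 hq hq0 hδ hAB hν hW
  have h2 := (lazyProb_exists_le hw hw1 m fun (y : I × I) l =>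
    (A * ν / 4) ^ 2 < sampleCoef u v y (X l) ^ 2).trans
    (Finset.sum_le_sum fun y _ => F.lazyProb_entry_dev hw hw1 hq hq0 hδ hAB hν hW y)
  have h3 := (lazyProb_exists_le hw hw1 m fun (y : I) l =>
    A * (ν / 4) ^ 2 < ((X l)ᵀ *ᵥ u y) ⬝ᵥ ((X l)ᵀ *ᵥ u y)).trans
    (Finset.sum_le_sum fun y _ => F.lazyProb_row_dev hw hw1 hq hq0 hδ hAB hν hW y)
  have h4 := (lazyProb_exists_le hw hw1 m fun (y : I) l =>
    A * (ν / 4) ^ 2 < (X l *ᵥ v y) ⬝ᵥ (X l *ᵥ v y)).trans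
    (Finset.sum_le_sum fun y _ => F.lazyProb_column_dev hw hw1 hq hq0 hδ hAB hν hW y)
  simp only [Finset.sum_const, Finset.card_univ, nsmul_eq_mul, Fintype.card_prod,
    Nat.cast_mul] at h2 h3 h4
  -- Union bound over the norm event and all entries, rows and columns. The deviations are
  -- controlled at `ν / 4`, more than the scale `ν / 2` requires.
  refine le_trans (lazyProb_mono hw hw1 m fun l hl => ?_)
    (((lazyProb_or_le hw hw1 m _ _).trans (add_le_add h1 ((lazyProb_or_le hw hw1 m _ _).trans
      (add_le_add h2 ((lazyProb_or_le hw hw1 m _ _).trans (add_le_add h3 h4)))))).trans_eq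
      (by ring))
  by_contra hcon
  push Not at hcon
  obtain ⟨c1, c2, c3, c4⟩ := hcon
  refine hl ⟨c1, ?_, fun x => ?_, fun i => ?_, fun j => ?_⟩
  · exact F.left_proj.tangentProj_idem F.right_proj _
  · rw [hneg, map_neg, neg_sq]
    exact (c2 x).trans hAν2
  · rw [hneg, Matrix.transpose_neg, Matrix.neg_mulVec, neg_dotProduct_neg]
    exact (c3 i).trans (by gcongr)
  · rw [hneg, Matrix.neg_mulVec, neg_dotProduct_neg]
    exact (c4 j).trans (by gcongr)

end IncoherentFrame

end Golfing

end

/-! ### Iterated golfing and injectivity on the tangent space -/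

section

open scoped Matrix.Norms.L2Operator

/-- Matrix Bernstein for `b bᵀ`: as `(b bᵀ)² = |b|² b bᵀ`, the frame bound makes `K` a variance
bound too. The norm of the deviation controls its quadratic form at all `z` at once. -/
theorem lazyProb_gram_dev {ι κ : Type*} [Fintype ι] [Fintype κ] [DecidableEq κ]
    {w q θ K t : ℝ} {m : ℕ} (hw : 0 ≤ w) (hw1 : Fintype.card ι * w ≤ 1) (hq : q = m * w)
    (hq0 : 0 < q) (hK : 0 ≤ K) (b : ι → κ → ℝ) (hb : ∀ x, b x ⬝ᵥ b x ≤ K)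
    (hfr : ∀ z, ∑ x, (b x ⬝ᵥ z) ^ 2 ≤ z ⬝ᵥ z) (hθ : 0 ≤ θ) (hθK : 2 * θ * K ≤ q) (ht : 0 ≤ t) :
    lazyProb w m (fun l => ∃ z, t * (z ⬝ᵥ z)
        < |q⁻¹ * (l.map fun x => (b x ⬝ᵥ z) ^ 2).sum - ∑ x, (b x ⬝ᵥ z) ^ 2|)
      ≤ 4 * Fintype.card κ * Real.exp (-θ * t + θ ^ 2 * K / q) := by
  have hquad : ∀ z, ∑ x, (Matrix.vecMulVec (b x) (b x) *ᵥ z) ⬝ᵥ (Matrix.vecMulVec (b x) (b x) *ᵥ z)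
      ≤ K * (z ⬝ᵥ z) := by
    intro z
    calc _ ≤ ∑ x, K * (b x ⬝ᵥ z) ^ 2 := by
          refine Finset.sum_le_sum fun x _ => ?_
          rw [Matrix.vecMulVec_mulVec_eq_smul]
          simp only [smul_dotProduct, dotProduct_smul, smul_eq_mul]
          have := mul_le_mul_of_nonneg_left (hb x) (sq_nonneg (b x ⬝ᵥ z))
          linarith
      _ ≤ _ := by
          rw [← Finset.mul_sum]
          exact mul_le_mul_of_nonneg_left (hfr z) hK
  have h := Matrix.lazyProb_norm_gt (θ := θ / q) (t := q * t) hw hw1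
    (fun x => Matrix.vecMulVec (b x) (b x)) (fun x => by
      rw [← one_smul ℝ (Matrix.vecMulVec (b x) (b x))]
      refine Matrix.norm_smul_vecMulVec_le hK ?_
      have := Matrix.dotProduct_self_nonneg' (b x)
      rw [one_pow, one_mul, sq]
      exact mul_le_mul (hb x) (hb x) this hK) hK hK hquad
    (fun z => by simp only [Matrix.transpose_vecMulVec]; exact hquad z) (by positivity)
    (by rw [mul_div_assoc', div_mul_eq_mul_div, div_le_one hq0]; exact hθK) (by positivity) m
  rw [← hq] at h
  have e : -(θ / q) * (q * t) + (θ / q) ^ 2 * (q * K) = -θ * t + θ ^ 2 * K / q := by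
    field_simp
  rw [e] at h
  refine le_trans (lazyProb_mono hw hw1 m fun l hl => ?_) (h.trans_eq (by ring))
  obtain ⟨z, hz⟩ := hl
  set S := (l.map fun x => Matrix.vecMulVec (b x) (b x)).sum
    - q • ∑ x, Matrix.vecMulVec (b x) (b x) with hS
  have hlist : ∀ l : List ι, z ⬝ᵥ ((l.map fun x => Matrix.vecMulVec (b x) (b x)).sum *ᵥ z)
      = (l.map fun x => (b x ⬝ᵥ z) ^ 2).sum := by
    intro l
    induction l with
    | nil => simp
    | cons x l ih =>
      rw [List.map_cons, List.sum_cons, List.map_cons, List.sum_cons, Matrix.add_mulVec,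
        dotProduct_add, ih, Matrix.vecMulVec_mulVec_eq_smul, dotProduct_smul, dotProduct_comm z,
        smul_eq_mul, sq]
  have hSz : z ⬝ᵥ S *ᵥ z
      = q * (q⁻¹ * (l.map fun x => (b x ⬝ᵥ z) ^ 2).sum - ∑ x, (b x ⬝ᵥ z) ^ 2) := by
    rw [hS, Matrix.sub_mulVec, dotProduct_sub, hlist, Matrix.smul_mulVec, dotProduct_smul,
      Matrix.sum_mulVec, dotProduct_sum, mul_sub, ← mul_assoc, mul_inv_cancel₀ hq0.ne', one_mul,
      smul_eq_mul]
    congr 2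
    refine Finset.sum_congr rfl fun x _ => ?_
    rw [Matrix.vecMulVec_mulVec_eq_smul, dotProduct_smul, dotProduct_comm z, smul_eq_mul, sq]
  by_contra hcon
  have h1 := (Matrix.l2_opNorm_le_iff (by positivity)).1 (not_lt.1 hcon) z
  have hz0 := Matrix.dotProduct_self_nonneg' z
  have h2 : |z ⬝ᵥ S *ᵥ z| ≤ q * t * (z ⬝ᵥ z) := by
    refine abs_le_of_sq_le_sq ((Matrix.dotProduct_sq_le _ _).trans ?_) (by positivity)
    calc _ ≤ (z ⬝ᵥ z) * ((q * t) ^ 2 * (z ⬝ᵥ z)) := by gcongr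
      _ = _ := by ring
  rw [hSz, abs_mul, abs_of_pos hq0, mul_assoc] at h2
  exact absurd (le_of_mul_le_mul_left h2 hq0) (not_le.2 hz)

section Golfing

variable {I d : Type*} [Fintype d]

theorem trace_sampleOp_transpose_mul_eq_zero (u v : I → d → ℝ) (q : ℝ) (W : Matrix d d ℝ)
    {H : Matrix d d ℝ} {l : List (I × I)} (h : ∀ x ∈ l, sampleCoef u v x H = 0) :
    ((sampleOp u v q l W)ᵀ * H).trace = 0 := by
  rw [sampleOp, Matrix.transpose_smul, Matrix.smul_mul, Matrix.trace_smul]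
  refine smul_eq_zero_of_right _ ?_
  induction l with
  | nil => simp
  | cons x l ih =>
    rw [List.map_cons, List.sum_cons, Matrix.transpose_add, Matrix.add_mul, Matrix.trace_add,
      Matrix.transpose_smul, Matrix.smul_mul, Matrix.trace_smul, trace_sampleAtom_transpose_mul,
      h x List.mem_cons_self, smul_zero, zero_add]
    exact ih fun y hy => h y (List.mem_cons_of_mem _ hy)

variable [Fintype I] [DecidableEq d]

theorem Matrix.IsOrthProj.trace_tangentProj_add_compl {P Q : Matrix d d ℝ} (hP : P.IsOrthProj)
    (hQ : Q.IsOrthProj) (Z : Matrix d d ℝ) :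
    ((Matrix.tangentProj P Q Z)ᵀ * Matrix.tangentProj P Q Z).trace
      + ((Z - Matrix.tangentProj P Q Z)ᵀ * (Z - Matrix.tangentProj P Q Z)).trace
      = (Zᵀ * Z).trace := by
  have h1 := hP.trace_transpose_tangentProj hQ (Matrix.tangentProj P Q Z) Z
  rw [hP.tangentProj_idem hQ] at h1
  have h2 := hP.trace_transpose_tangentProj hQ Z Z
  simp only [Matrix.transpose_sub, Matrix.mul_sub, Matrix.sub_mul, Matrix.trace_sub]
  linarith

/-- A matrix `Y` supported on the measurements in `Ω` that golfs `W` up to scale `ν / 2 ^ k`. -/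
def HasGolfCertificate (u v : I → d → ℝ) (P Q : Matrix d d ℝ) (A : ℝ) (Ω : Finset (I × I))
    (W : Matrix d d ℝ) (ν : ℝ) (k : ℕ) : Prop :=
  ∃ Y : Matrix d d ℝ, (∀ H, (∀ x ∈ Ω, sampleCoef u v x H = 0) → (Yᵀ * H).trace = 0) ∧
    IsGolfable u v P Q A (ν / 2 ^ k) (W - Matrix.tangentProj P Q Y) ∧
    ‖Y - Matrix.tangentProj P Q Y‖ ≤ ν / 2

namespace IncoherentFrame

variable {u v : I → d → ℝ} {P Q : Matrix d d ℝ} {A B : ℝ}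

/-- The certificate of the residual is corrected by `sampleOp W`. As `W` is tangent, this correction
leaves the tangent space only through its deviation, at most `ν / 4`; the residual adds `(ν / 2) /
2`, and the total is again `ν / 2`. -/
theorem hasGolfCertificate_succ [DecidableEq I] (F : IncoherentFrame u v P Q A B) {q ν : ℝ}
    {l : List (I × I)}
    {Ω : Finset (I × I)} {W : Matrix d d ℝ} {k : ℕ} (hW : IsGolfable u v P Q A ν W)
    (hl : ‖sampleOp u v q l W - W‖ ≤ ν / 4)
    (h : HasGolfCertificate u v P Q A Ω (Matrix.tangentProj P Q (W - sampleOp u v q l W))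
      (ν / 2) k) : HasGolfCertificate u v P Q A (l.toFinset ∪ Ω) W ν (k + 1) := by
  obtain ⟨Y, h1, h2, h3⟩ := h
  refine ⟨sampleOp u v q l W + Y, fun H hH => ?_, ?_, ?_⟩
  · rw [Matrix.transpose_add, Matrix.add_mul, Matrix.trace_add,
      h1 H fun x hx => hH x (Finset.mem_union_right _ hx),
      trace_sampleOp_transpose_mul_eq_zero u v q W
        fun x hx => hH x (Finset.mem_union_left _ (List.mem_toFinset.2 hx)), add_zero]
  · have e1 : W - Matrix.tangentProj P Q (sampleOp u v q l W + Y)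
        = Matrix.tangentProj P Q (W - sampleOp u v q l W) - Matrix.tangentProj P Q Y := by
      rw [map_sub, map_add, hW.tangent]; abel
    have e2 : ν / 2 ^ (k + 1) = ν / 2 / 2 ^ k := by rw [pow_succ']; field_simp
    rw [e1, e2]
    exact h2
  · have e : sampleOp u v q l W + Y - Matrix.tangentProj P Q (sampleOp u v q l W + Y)
        = ((sampleOp u v q l W - W) - Matrix.tangentProj P Q (sampleOp u v q l W - W))
          + (Y - Matrix.tangentProj P Q Y) := by
      rw [map_sub, map_add, hW.tangent]; abel
    rw [e]
    refine (norm_add_le _ _).trans ?_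
    have := F.left_proj.norm_sub_tangentProj_le F.right_proj (sampleOp u v q l W - W)
    linarith

/-- Induction over batches with `W` and `ν` arbitrary, since the residual depends on the batch just
drawn. Each batch costs rate `m * p₀` and failure probability `η`. -/
theorem bernProb_hasGolfCertificate_ge [DecidableEq I] (F : IncoherentFrame u v P Q A B)
    {p₀ w q δ η : ℝ} {m : ℕ} (hp₀ : 0 ≤ p₀)
    (hwp : w = p₀ * (1 - p₀) ^ (Fintype.card (I × I) - 1)) (hw : 0 ≤ w)
    (hw1 : Fintype.card (I × I) * w ≤ 1) (hq : q = m * w) (hq0 : 0 < q) (hδ : 0 < δ)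
    (hAB : 4 * A * B ≤ δ * q)
    (hη : (4 * Fintype.card d + 4 * Fintype.card I ^ 2 + 4 * Fintype.card I * (Fintype.card d + 1))
        * Real.exp (-(1 / (64 * δ))) ≤ η) (k : ℕ) (hk : k * (m * p₀) ≤ 1) {ν : ℝ} (hν : 0 ≤ ν)
    {W : Matrix d d ℝ} (hW : IsGolfable u v P Q A ν W) :
    1 - k * η ≤ bernProb (k * (m * p₀)) fun Ω => HasGolfCertificate u v P Q A Ω W ν k := by
  induction k generalizing ν W with
  | zero =>
    have : ∀ Ω, HasGolfCertificate u v P Q A Ω W ν 0 := fun Ω => by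
      refine ⟨0, fun H _ => by simp, by simpa using hW, ?_⟩
      rw [map_zero, sub_zero, norm_zero]; positivity
    simp [bernProb, this, bernExp_const]
  | succ k ih =>
    have hmp : 0 ≤ m * p₀ := by positivity
    have hkmp : 0 ≤ k * (m * p₀) := by positivity
    have hη0 : 0 ≤ η := le_trans (by positivity) hη
    push_cast at hk ⊢
    have hk' : k * (m * p₀) + m * p₀ ≤ 1 := by linarith
    subst hwp
    have h := bernProb_ge_of_lazyProb_le (p := k * (m * p₀)) (q := p₀) (c := 1 - k * η) (η := η)
      hkmp hp₀ m hk' (by have : 0 ≤ k * η := by positivity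
                         linarith) hw hw1
      (P := fun Ω => HasGolfCertificate u v P Q A Ω W ν (k + 1))
      (fun S T hST ⟨Y, h1, h2⟩ => ⟨Y, fun H hH => h1 H fun x hx => hH x (hST hx), h2⟩)
      _ ((F.lazyProb_golfing_step hw hw1 hq hq0 hδ hAB hν hW).trans hη)
      (fun l hl => by
        rw [not_not] at hl
        refine (ih (by linarith) (by positivity) hl.2).trans (bernProb_mono hkmp (by linarith) ?_)
        exact fun T hT => F.hasGolfCertificate_succ hW hl.1 hT)
    have e1 : (k + 1 : ℝ) * (m * p₀) = k * (m * p₀) + m * p₀ := by ring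
    rw [e1]
    refine le_trans (le_of_eq ?_) h
    ring

theorem sum_sq_sampleCoef (F : IncoherentFrame u v P Q A B) (Z : Matrix d d ℝ) :
    ∑ x : I × I, sampleCoef u v x Z ^ 2 = (Zᵀ * Z).trace := by
  conv_rhs => rw [← F.sum_sampleCoef_smul Z, Matrix.transpose_sum, Finset.sum_mul,
    Matrix.trace_sum]
  refine Finset.sum_congr rfl fun x _ => ?_
  rw [F.sum_sampleCoef_smul, Matrix.transpose_smul, Matrix.smul_mul, Matrix.trace_smul,
    trace_sampleAtom_transpose_mul, sq, smul_eq_mul]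

/-- The projection is self-adjoint and idempotent, so this is one measurement, equal to `|v|² |P u|²
+ |(1 - P) u|² |Q v|²`. -/
theorem trace_tangentProj_sampleAtom_le (F : IncoherentFrame u v P Q A B) (x : I × I) :
    ((Matrix.tangentProj P Q (sampleAtom u v x))ᵀ *
      Matrix.tangentProj P Q (sampleAtom u v x)).trace ≤ 2 * A * B := by
  have hA := F.nonneg
  have hB := F.nonneg'
  rw [← F.left_proj.trace_transpose_tangentProj F.right_proj,
    F.left_proj.tangentProj_idem F.right_proj, trace_sampleAtom_transpose_mul,
    tangentProj_sampleAtom F.right_proj, sampleCoef_apply, Matrix.add_mulVec,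
    Matrix.vecMulVec_mulVec_eq_smul, Matrix.vecMulVec_mulVec_eq_smul, dotProduct_add,
    dotProduct_smul, dotProduct_smul, dotProduct_comm (Q *ᵥ _),
    ← F.left_proj.dotProduct_mulVec_self, ← F.left_proj.one_sub.dotProduct_mulVec_self,
    ← F.right_proj.dotProduct_mulVec_self, smul_eq_mul, smul_eq_mul]
  have h1 := mul_le_mul (F.right_norm x.2) (F.left_proj_norm x.1)
    (Matrix.dotProduct_self_nonneg' _) hB
  have h2 := mul_le_mul (F.right_proj_norm x.2)
    (F.left_proj.dotProduct_compl_le (F.left_norm x.1)) (Matrix.dotProduct_self_nonneg' _) hA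
  linarith

theorem trace_sampleAtom_le (F : IncoherentFrame u v P Q A B) (x : I × I) :
    ((sampleAtom u v x)ᵀ * sampleAtom u v x).trace ≤ B ^ 2 := by
  rw [trace_sampleAtom_transpose_mul, sampleCoef_apply, sampleAtom,
    Matrix.vecMulVec_mulVec_eq_smul, dotProduct_smul, smul_eq_mul, sq]
  exact mul_le_mul (F.right_norm x.2) (F.left_norm x.1) (Matrix.dotProduct_self_nonneg' _)
    F.nonneg'

/-- With high probability, one batch of draws is injective enough on the tangent space and bounded
on its complement. -/
theorem lazyProb_injectivity (F : IncoherentFrame u v P Q A B) {w q δ θ t : ℝ} {m : ℕ}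
    (hw : 0 ≤ w) (hw1 : Fintype.card (I × I) * w ≤ 1) (hq : q = m * w) (hq0 : 0 < q) (hδ : 0 < δ)
    (hAB : 4 * A * B ≤ δ * q) (hθ : 0 ≤ θ) (hθB : 2 * θ * B ^ 2 ≤ q) (ht : 0 ≤ t) :
    lazyProb w m (fun l => ¬ ∀ H, (∀ x ∈ l, sampleCoef u v x H = 0) →
        3 / 4 * ((Matrix.tangentProj P Q H)ᵀ * Matrix.tangentProj P Q H).trace
          ≤ (1 + t) * ((H - Matrix.tangentProj P Q H)ᵀ * (H - Matrix.tangentProj P Q H)).trace)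
      ≤ 4 * Fintype.card d ^ 2 * Real.exp (-(1 / (64 * δ)))
        + 4 * Fintype.card d ^ 2 * Real.exp (-θ * t + θ ^ 2 * B ^ 2 / q) := by
  have hA := F.nonneg
  have hB := F.nonneg'
  have hABn : 0 ≤ A * B := mul_nonneg hA hB
  let vec : Matrix d d ℝ → d × d → ℝ := fun Z x => Z x.1 x.2
  have hvec : ∀ Y Z, vec Y ⬝ᵥ vec Z = (Yᵀ * Z).trace := fun Y Z =>
    (Matrix.trace_transpose_mul_eq_sum Y Z).symm
  have hsurj : ∀ z, ∃ Z, vec Z = z := fun z => ⟨fun i j => z (i, j), rfl⟩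
  have hT : ∀ x Z, vec (Matrix.tangentProj P Q (sampleAtom u v x)) ⬝ᵥ vec Z
      = sampleCoef u v x (Matrix.tangentProj P Q Z) := fun x Z => by
    rw [hvec, ← F.left_proj.trace_transpose_tangentProj F.right_proj,
      trace_sampleAtom_transpose_mul]
  have hS : ∀ x Z, vec (sampleAtom u v x) ⬝ᵥ vec Z = sampleCoef u v x Z := fun x Z => by
    rw [hvec, trace_sampleAtom_transpose_mul]
  have hq4 : 2 * (1 / (8 * δ)) * (δ * q) ≤ q := by
    field_simp
    norm_num
  have h1 := lazyProb_gram_dev (θ := 1 / (8 * δ)) (K := δ * q) (t := 1 / 4) hw hw1 hq hq0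
    (by positivity) (fun x => vec (Matrix.tangentProj P Q (sampleAtom u v x)))
    (fun x => by rw [hvec]; linarith [F.trace_tangentProj_sampleAtom_le x])
    (fun z => by
      obtain ⟨Z, rfl⟩ := hsurj z
      simp only [hT]
      rw [F.sum_sq_sampleCoef, hvec]
      have := F.left_proj.trace_tangentProj_add_compl F.right_proj Z
      have := Matrix.trace_transpose_mul_self_nonneg (Z - Matrix.tangentProj P Q Z)
      linarith) (by positivity) hq4 (by norm_num)
  -- For unprojected atoms only the bound `B²` is available, so the deviation `t` must be allowed to
  -- be large.
  have h2 := lazyProb_gram_dev (θ := θ) (K := B ^ 2) (t := t) hw hw1 hq hq0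
    (by positivity) (fun x => vec (sampleAtom u v x))
    (fun x => by rw [hvec]; exact F.trace_sampleAtom_le x)
    (fun z => by
      obtain ⟨Z, rfl⟩ := hsurj z
      simp only [hS]
      rw [F.sum_sq_sampleCoef, hvec]) hθ hθB ht
  have e1 : -(1 / (8 * δ)) * (1 / 4) + (1 / (8 * δ)) ^ 2 * (δ * q) / q = -(1 / (64 * δ)) := by
    field_simp
    norm_num
  rw [e1] at h1
  rw [Fintype.card_prod] at h1 h2
  push_cast at h1 h2
  refine le_trans (lazyProb_mono hw hw1 m fun l hl => ?_)
    (((lazyProb_or_le hw hw1 m _ _).trans (add_le_add h1 h2)).trans_eq (by ring))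
  by_contra hcon
  push Not at hcon
  obtain ⟨c1, c2⟩ := hcon
  refine hl fun H hH => ?_
  have d1 := c1 (vec (Matrix.tangentProj P Q H))
  have d2 := c2 (vec (H - Matrix.tangentProj P Q H))
  simp only [hT, hS, hvec, F.sum_sq_sampleCoef, F.left_proj.tangentProj_idem F.right_proj]
    at d1 d2
  -- The tangent and complementary parts of an unobserved `H` have opposite measurements, so the
  -- lower bound for one meets the upper bound for the other.
  have e : (l.map fun x => sampleCoef u v x (Matrix.tangentProj P Q H) ^ 2)
      = l.map fun x => sampleCoef u v x (H - Matrix.tangentProj P Q H) ^ 2 := by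
    refine List.map_congr_left fun x hx => ?_
    rw [map_sub, hH x hx, zero_sub, neg_sq]
  rw [e] at d1
  have d1' := (abs_le.1 d1).1
  have d2' := (abs_le.1 d2).2
  linarith

end IncoherentFrame

end Golfing

end

/-! ### Strict recovery from certificate and injectivity -/

section

open scoped Matrix.Norms.L2Operator

open StructuredCompletion in
/-- Perturbations invisible to the measurements in `Ω` strictly increase the nuclear norm. -/
def IsStrictlyRecovered {I : Type*} {s : ℕ} (u v : I → Fin s → ℝ) (X : Matrix (Fin s) (Fin s) ℝ)
    (Ω : Finset (I × I)) : Prop :=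
  ∀ H : Matrix (Fin s) (Fin s) ℝ, H ≠ 0 → (∀ x ∈ Ω, sampleCoef u v x H = 0) →
    nuclearNorm X < nuclearNorm (X + H)

section Recovery

variable {I : Type*} [Fintype I] {s r : ℕ} {u v : I → Fin s → ℝ} {A B : ℝ}
  {U V : Matrix (Fin s) (Fin r) ℝ}

theorem Matrix.dotProduct_transpose_mulVec_self {s r : ℕ} {U : Matrix (Fin s) (Fin r) ℝ}
    (hU : Uᵀ * U = 1) (y : Fin s → ℝ) :
    (Uᵀ *ᵥ y) ⬝ᵥ (Uᵀ *ᵥ y) = ((U * Uᵀ) *ᵥ y) ⬝ᵥ ((U * Uᵀ) *ᵥ y) := by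
  rw [(Matrix.isOrthProj_mul_transpose hU).dotProduct_mulVec_self, ← Matrix.mulVec_mulVec,
    Matrix.dotProduct_mulVec y, ← Matrix.mulVec_transpose]

theorem Matrix.dotProduct_mulVec_self_of_orthonormal {s r : ℕ} {U : Matrix (Fin s) (Fin r) ℝ}
    (hU : Uᵀ * U = 1) (y : Fin r → ℝ) : (U *ᵥ y) ⬝ᵥ (U *ᵥ y) = y ⬝ᵥ y := by
  rw [Matrix.dotProduct_mulVec, ← Matrix.mulVec_transpose, Matrix.mulVec_mulVec, hU,
    Matrix.one_mulVec]

/-- Measurements of `U Vᵀ` are inner products of `Uᵀ uᵢ` and `Vᵀ vⱼ`, so Cauchy–Schwarz gives the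
entry bound; no separate hypothesis on `U Vᵀ` is needed. -/
theorem IncoherentFrame.isGolfable_one (F : IncoherentFrame u v (U * Uᵀ) (V * Vᵀ) A B)
    (hU : Uᵀ * U = 1) (hV : Vᵀ * V = 1) :
    IsGolfable u v (U * Uᵀ) (V * Vᵀ) A 1 (U * Vᵀ) := by
  have hu : ∀ i, (Uᵀ *ᵥ u i) ⬝ᵥ (Uᵀ *ᵥ u i) ≤ A := fun i => by
    rw [Matrix.dotProduct_transpose_mulVec_self hU]; exact F.left_proj_norm i
  have hv : ∀ i, (Vᵀ *ᵥ v i) ⬝ᵥ (Vᵀ *ᵥ v i) ≤ A := fun i => by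
    rw [Matrix.dotProduct_transpose_mulVec_self hV]; exact F.right_proj_norm i
  refine ⟨?_, fun x => ?_, fun i => ?_, fun j => ?_⟩
  · have e1 : U * Uᵀ * (U * Vᵀ) = U * Vᵀ := by
      rw [Matrix.mul_assoc, ← Matrix.mul_assoc Uᵀ, hU, Matrix.one_mul]
    have e2 : U * Vᵀ * (V * Vᵀ) = U * Vᵀ := by
      rw [Matrix.mul_assoc, ← Matrix.mul_assoc Vᵀ, hV, Matrix.one_mul]
    rw [Matrix.tangentProj_apply, e1, e2]; abel
  · rw [sampleCoef_apply, ← Matrix.mulVec_mulVec, Matrix.dotProduct_mulVec,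
      ← Matrix.mulVec_transpose, mul_one, sq A]
    refine (Matrix.dotProduct_sq_le _ _).trans ?_
    exact mul_le_mul (hu _) (hv _) (Matrix.dotProduct_self_nonneg' _) F.nonneg
  · rw [Matrix.transpose_mul, Matrix.transpose_transpose, ← Matrix.mulVec_mulVec,
      Matrix.dotProduct_mulVec_self_of_orthonormal hV]
    simpa using hu i
  · rw [← Matrix.mulVec_mulVec, Matrix.dotProduct_mulVec_self_of_orthonormal hU]
    simpa using hv j

/-- One batch serves injectivity and `k` the certificate. Summing the row bounds of the residual
gives `ε = |I| A / 4 ^ k`, injectivity gives `κ = 4/3 (1 + t)`, and `hkt` is `ε κ < 1/4`. -/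
theorem IncoherentFrame.bernProb_isStrictlyRecovered_ge [DecidableEq I]
    (F : IncoherentFrame u v (U * Uᵀ) (V * Vᵀ) A B) (hU : Uᵀ * U = 1) (hV : Vᵀ * V = 1)
    {σ : Fin r → ℝ} (hσ : ∀ k, 0 ≤ σ k) {p₀ w q δ η θ t : ℝ} {m : ℕ} (hp₀ : 0 ≤ p₀)
    (hwp : w = p₀ * (1 - p₀) ^ (Fintype.card (I × I) - 1)) (hw : 0 ≤ w)
    (hw1 : Fintype.card (I × I) * w ≤ 1) (hq : q = m * w) (hq0 : 0 < q) (hδ : 0 < δ)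
    (hAB : 4 * A * B ≤ δ * q) (hθ : 0 ≤ θ) (hθB : 2 * θ * B ^ 2 ≤ q) (ht : 0 ≤ t)
    (hη : (4 * (s : ℝ) + 4 * Fintype.card I ^ 2 + 4 * Fintype.card I * (s + 1))
        * Real.exp (-(1 / (64 * δ))) ≤ η)
    (k : ℕ) (hk : (k + 1) * (m * p₀) ≤ 1)
    (hkt : Fintype.card I * (A * (1 / 2 ^ k) ^ 2) * (4 / 3 * (1 + t)) < 1 / 4) :
    1 - k * η - (4 * (s : ℝ) ^ 2 * Real.exp (-(1 / (64 * δ)))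
        + 4 * (s : ℝ) ^ 2 * Real.exp (-θ * t + θ ^ 2 * B ^ 2 / q))
      ≤ bernProb ((k + 1) * (m * p₀))
        (IsStrictlyRecovered u v (U * Matrix.diagonal σ * Vᵀ)) := by
  have hA := F.nonneg
  have hmp : 0 ≤ m * p₀ := by positivity
  have hkmp : 0 ≤ k * (m * p₀) := by positivity
  have hη0 : 0 ≤ η := le_trans (by positivity) hη
  have hk' : k * (m * p₀) + m * p₀ ≤ 1 := by linarith
  have hinj := F.lazyProb_injectivity hw hw1 hq hq0 hδ hAB hθ hθB ht
  have hgolf := F.bernProb_hasGolfCertificate_ge hp₀ hwp hw hw1 hq hq0 hδ hAB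
    (η := η) (by rw [Fintype.card_fin]; exact hη) k (by linarith) zero_le_one (F.isGolfable_one hU hV)
  rw [Fintype.card_fin] at hinj
  subst hwp
  have e1 : (k + 1 : ℝ) * (m * p₀) = k * (m * p₀) + m * p₀ := by ring
  rw [e1]
  refine bernProb_ge_of_lazyProb_le hkmp hp₀ m hk' (by
    have : 0 ≤ k * η := by positivity
    linarith) hw hw1 (fun S T hST h H hH hx => h H hH fun x hxS => hx x (hST hxS)) _ hinj ?_
  intro l hl
  refine hgolf.trans (bernProb_mono hkmp (by linarith) ?_)
  intro T hT H hH hx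
  rw [not_not] at hl
  obtain ⟨Y, h1, h2, h3⟩ := hT
  have hl' := hl H fun x hxl => hx x (Finset.mem_union_left _ (List.mem_toFinset.2 hxl))
  refine StructuredCompletion.nuclearNorm_lt_of_certificate
    (ε := Fintype.card I * (A * (1 / 2 ^ k) ^ 2)) (κ := 4 / 3 * (1 + t)) hU hV hσ
    (h1 H fun x hxT => hx x (Finset.mem_union_right _ hxT)) h3 ?_ ?_ (by positivity) hkt hH
  · rw [← F.sum_sq_sampleCoef, Fintype.sum_prod_type]
    simp only [F.row_sq_sum]
    refine (Finset.sum_le_sum fun i _ => h2.row i).trans_eq ?_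
    rw [Finset.sum_const, Finset.card_univ, nsmul_eq_mul]
  · linarith

end Recovery

/-! ### Choice of parameters -/

section Numerics

/-- With `k = ⌈log₂ (4 y)⌉ + 1` one has `k + 1 < log₂ (4 y) + 3 = log₂ (32 y)`, the source of the
constant 32; then `1 / log 2 < 2`. -/
theorem exists_nat_pow_gt_and_le_log {y : ℝ} (hy : 1 ≤ y) :
    ∃ k : ℕ, 4 * y < 2 ^ k ∧ (k + 1 : ℝ) ≤ 2 * Real.log (32 * y) := by
  have hlog2 : 1 / 2 < Real.log 2 := by linarith [Real.log_two_gt_d9]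
  have hl2 : 0 < Real.log 2 := by linarith
  have hy0 : 0 < y := by linarith
  have hl4 : 0 ≤ Real.log (4 * y) := Real.log_nonneg (by linarith)
  refine ⟨⌈Real.log (4 * y) / Real.log 2⌉₊ + 1, ?_, ?_⟩
  · have h1 := Nat.le_ceil (Real.log (4 * y) / Real.log 2)
    rw [div_le_iff₀ hl2, ← Real.log_pow, Real.log_le_log_iff (by positivity) (by positivity)] at h1
    rw [pow_succ]
    linarith
  · have h1 := Nat.ceil_lt_add_one (div_nonneg hl4 hl2.le)
    have e : Real.log (32 * y) = Real.log (4 * y) + 3 * Real.log 2 := by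
      have : Real.log (32 * y) = Real.log (4 * y * 2 ^ 3) := by congr 1; ring
      rw [this, Real.log_mul (by positivity) (by positivity), Real.log_pow]
      norm_num
    push_cast
    have h2 : Real.log (4 * y) / Real.log 2 + 3 = Real.log (32 * y) / Real.log 2 := by
      rw [e]; field_simp
    have h3 : Real.log (32 * y) / Real.log 2 ≤ 2 * Real.log (32 * y) := by
      rw [div_le_iff₀ hl2]
      have : 0 ≤ Real.log (32 * y) := Real.log_nonneg (by linarith)
      nlinarith
    linarith

-- The choice `δ = 1 / (256 log n)` turns `exp (-1 / (64 δ))` into `n⁻⁴` and requires `q ≥ 1024 A B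
-- log n`. Since `q ≥ p / (2 (k + 1))` and `2 (k + 1) ≤ 4 log (32 n B)`, the constant is `4 * 1024 =
-- 4096`.
set_option maxHeartbeats 1000000 in
theorem IncoherentFrame.bernProb_isStrictlyRecovered_ge_of_rate {n s r : ℕ}
    {u v : Fin n → Fin s → ℝ} {A B p : ℝ} {U V : Matrix (Fin s) (Fin r) ℝ}
    (F : IncoherentFrame u v (U * Uᵀ) (V * Vᵀ) A B) (hU : Uᵀ * U = 1) (hV : Vᵀ * V = 1)
    {σ : Fin r → ℝ} (hσ : ∀ k, 0 ≤ σ k) (hn : 2 ≤ n) (hsn : s ≤ n) (hA : 1 ≤ n * A) (hB1 : B ≤ 1)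
    (hp1 : p ≤ 1) (hp : 4096 * (A * B * Real.log (32 * (n * B)) * Real.log n) ≤ p) :
    1 - 2000 * (n : ℝ)⁻¹ ≤ bernProb p
      (IsStrictlyRecovered u v (U * Matrix.diagonal σ * Vᵀ)) := by
  have hn2 : (2 : ℝ) ≤ n := by exact_mod_cast hn
  have hn0 : (0 : ℝ) < n := by linarith
  have hA0 : 0 < A := by
    by_contra h
    have : n * A ≤ 0 := mul_nonpos_of_nonneg_of_nonpos hn0.le (not_lt.1 h)
    linarith
  have hB0 : 0 < B := hA0.trans_le F.le
  have hy : 1 ≤ n * B := hA.trans (mul_le_mul_of_nonneg_left F.le hn0.le)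
  obtain ⟨k, hk1, hk2⟩ := exists_nat_pow_gt_and_le_log hy
  set L := Real.log n with hL
  set ll := Real.log (32 * (n * B)) with hll
  have hL0 : 0 < L := Real.log_pos (by linarith)
  have hll0 : 0 < ll := Real.log_pos (by linarith)
  have hp0 : 0 < p := lt_of_lt_of_le (by positivity) hp
  have hk0 : (0 : ℝ) < k + 1 := by positivity
  -- This many draws per batch force `n² p₀ ≤ 1/2`, so by Bernoulli's inequality `w ≥ p₀ / 2`: lazy
  -- draws lose at most a factor two.
  set m : ℕ := 2 * (n * n) with hm
  have hmr : (m : ℝ) = 2 * (n * n) := by rw [hm]; push_cast; ring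
  have hm0 : (0 : ℝ) < m := by rw [hmr]; positivity
  set p₀ := p / ((k + 1) * m) with hp₀
  have hp₀0 : 0 < p₀ := by positivity
  have hpe : (k + 1) * (m * p₀) = p := by rw [hp₀]; field_simp
  have hmp : m * p₀ ≤ 1 := by
    have h1 : m * p₀ ≤ (k + 1) * (m * p₀) := by
      have : (1 : ℝ) ≤ k + 1 := by linarith [(Nat.cast_nonneg k : (0 : ℝ) ≤ k)]
      exact le_mul_of_one_le_left (by positivity) this
    linarith
  have hNp : (n * n : ℝ) * p₀ ≤ 1 / 2 := by rw [hmr] at hmp; linarith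
  have hcard : Fintype.card (Fin n × Fin n) = n * n := by simp
  set w := p₀ * (1 - p₀) ^ (Fintype.card (Fin n × Fin n) - 1) with hw
  have hnn : (1 : ℝ) ≤ n * n := by nlinarith
  have hp₀1 : p₀ ≤ 1 / 2 := by nlinarith
  have hw_ge : p₀ / 2 ≤ w := by
    have h1 := one_add_mul_le_pow (a := -p₀) (by linarith) (n * n - 1)
    have h2 : ((n * n - 1 : ℕ) : ℝ) ≤ n * n := by
      have : n * n - 1 ≤ n * n := Nat.sub_le _ _
      exact_mod_cast this
    have h3 : ((n * n - 1 : ℕ) : ℝ) * p₀ ≤ n * n * p₀ := by gcongr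
    rw [hw, hcard]
    rw [← sub_eq_add_neg] at h1
    have h4 : 1 / 2 ≤ (1 - p₀) ^ (n * n - 1) := by linarith
    nlinarith
  have hw_le : w ≤ p₀ := by
    rw [hw]
    exact mul_le_of_le_one_right hp₀0.le (pow_le_one₀ (by linarith) (by linarith))
  have hw0 : 0 ≤ w := by linarith
  have hw1 : (Fintype.card (Fin n × Fin n) : ℝ) * w ≤ 1 := by
    rw [hcard]; push_cast
    have : (n * n : ℝ) * w ≤ n * n * p₀ := by gcongr
    linarith
  set q := m * w with hq
  have hq_ge : p / (2 * (k + 1)) ≤ q := by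
    have : p / (2 * (k + 1)) = m * (p₀ / 2) := by rw [hp₀]; field_simp
    rw [this, hq]
    gcongr
  have hq0 : 0 < q := lt_of_lt_of_le (by positivity) hq_ge
  have hABq : 1024 * L * (A * B) ≤ q := by
    refine le_trans ?_ hq_ge
    rw [le_div_iff₀ (by positivity)]
    calc _ ≤ 1024 * L * (A * B) * (2 * (2 * ll)) := by gcongr
      _ = 4096 * (A * B * ll * L) := by ring
      _ ≤ p := hp
  set δ := 1 / (256 * L) with hδ
  have hδ0 : 0 < δ := by positivity
  have hAB : 4 * A * B ≤ δ * q := by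
    rw [hδ, one_div, inv_mul_eq_div, le_div_iff₀ (by positivity)]
    linarith
  -- With `θ = q / (2 B²)`, the largest admissible value, the `1/2` cancels the quadratic term and
  -- the exponent is exactly `-4 log n`.
  set t := 1 / 2 + 8 * (B ^ 2 / q) * L with ht
  have ht0 : 0 ≤ t := by positivity
  have ht_le : 1 + t ≤ 3 * (n * B) := by
    have h1 : B ^ 2 * (1024 * L) ≤ n * B * q := by
      calc B ^ 2 * (1024 * L) ≤ (n * A) * (B ^ 2 * (1024 * L)) :=
            le_mul_of_one_le_left (by positivity) hA
        _ = n * B * (1024 * L * (A * B)) := by ring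
        _ ≤ _ := by gcongr
    have h2 : 8 * (B ^ 2 / q) * L ≤ n * B / 128 := by
      have : 8 * (B ^ 2 / q) * L = (B ^ 2 * (1024 * L)) / q / 128 := by field_simp; norm_num
      rw [this]
      gcongr
      rw [div_le_iff₀ hq0]
      exact h1
    rw [ht]
    linarith
  set θ := q / (2 * B ^ 2) with hθ
  have hexpL : Real.exp (-(4 * L)) = ((n : ℝ)⁻¹) ^ 4 := by
    rw [Real.exp_neg, mul_comm, Real.exp_mul, Real.exp_log hn0, inv_pow]
    norm_cast
  have e1 : Real.exp (-(1 / (64 * δ))) = ((n : ℝ)⁻¹) ^ 4 := by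
    rw [← hexpL, hδ]; congr 2; field_simp; norm_num
  have e2 : Real.exp (-θ * t + θ ^ 2 * B ^ 2 / q) = ((n : ℝ)⁻¹) ^ 4 := by
    rw [← hexpL, hθ, ht]; congr 1; field_simp; ring
  -- The left side is at most `4 (n B)² / 4 ^ k`, and `4 ^ k > 16 (n B)²` by the choice of `k`.
  have hkt : Fintype.card (Fin n) * (A * (1 / 2 ^ k) ^ 2) * (4 / 3 * (1 + t)) < 1 / 4 := by
    rw [Fintype.card_fin]
    have hk1' : (4 * (n * B)) ^ 2 < (2 ^ k) ^ 2 := by gcongr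
    have hA' : (n : ℝ) * A ≤ n * B := by gcongr; exact F.le
    have hpos : (0 : ℝ) < (2 ^ k) ^ 2 := by positivity
    calc _ = (n * A) * (4 / 3 * (1 + t)) / (2 ^ k) ^ 2 := by field_simp
      _ ≤ (n * B) * (4 / 3 * (3 * (n * B))) / (2 ^ k) ^ 2 := by gcongr
      _ < 1 / 4 := by
          rw [div_lt_iff₀ hpos]
          linarith
  have hs : (s : ℝ) ≤ n := by exact_mod_cast hsn
  set x := (n : ℝ)⁻¹ with hx
  have hx0 : 0 < x := by positivity
  have hnx : (n : ℝ) * x = 1 := mul_inv_cancel₀ hn0.ne'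
  have hη : (4 * (s : ℝ) + 4 * Fintype.card (Fin n) ^ 2 + 4 * Fintype.card (Fin n) * (s + 1))
        * Real.exp (-(1 / (64 * δ))) ≤ 16 * x ^ 2 := by
    rw [e1, Fintype.card_fin]
    calc _ ≤ (4 * (n : ℝ) + 4 * n ^ 2 + 4 * n * (n + 1)) * x ^ 4 := by gcongr
      _ ≤ (16 * n ^ 2) * x ^ 4 := by
          gcongr
          nlinarith
      _ = 16 * (n * x) ^ 2 * x ^ 2 := by ring
      _ = _ := by rw [hnx]; ring
  have hmain := F.bernProb_isStrictlyRecovered_ge hU hV hσ hp₀0.le hw hw0 hw1 hq hq0 hδ0 hAB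
    (θ := θ) (by positivity) (by rw [hθ]; apply le_of_eq; field_simp) ht0 hη k
    (by rw [hpe]; exact hp1) hkt
  rw [hpe, e1, e2] at hmain
  refine le_trans ?_ hmain
  -- A linear bound on the number of batches suffices, as each fails with probability `O(n⁻²)`.
  have hkn : (k : ℝ) ≤ 64 * n := by
    have h1 : ll ≤ 32 * (n * B) := (Real.log_le_sub_one_of_pos (by positivity)).trans (by linarith)
    have h2 : n * B ≤ n := mul_le_of_le_one_right hn0.le hB1
    linarith
  have hx1 : x ≤ 1 := by rw [hx]; exact inv_le_one_of_one_le₀ (by linarith)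
  have b1 : k * (16 * x ^ 2) ≤ 1024 * x := by
    calc k * (16 * x ^ 2) ≤ 64 * n * (16 * x ^ 2) := by gcongr
      _ = 1024 * (n * x) * x := by ring
      _ = _ := by rw [hnx]; ring
  have b2 : 4 * (s : ℝ) ^ 2 * x ^ 4 ≤ 4 * x := by
    calc 4 * (s : ℝ) ^ 2 * x ^ 4 ≤ 4 * (n : ℝ) ^ 2 * x ^ 4 := by gcongr
      _ = 4 * (n * x) ^ 2 * x * x := by ring
      _ ≤ 4 * (n * x) ^ 2 * x * 1 := by gcongr
      _ = _ := by rw [hnx]; ring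
  linarith

end Numerics

end

/-! ### Reduction of the program to incoherent frames -/

namespace StructuredCompletion

theorem transpose_mul_mul_of_col_le {n r s : ℕ} {W : Matrix (Fin n) (Fin s) ℝ}
    {U : Matrix (Fin n) (Fin r) ℝ} (hW : Wᵀ * W = 1) (h : col U ≤ col W) :
    W * (Wᵀ * U) = U := by
  have hle : col W ≤ LinearMap.ker (W * Wᵀ - 1).mulVecLin := by
    refine Submodule.span_le.2 ?_
    rintro _ ⟨k, rfl⟩
    have h1 : (W * Wᵀ - 1) * W = 0 := by
      rw [Matrix.sub_mul, Matrix.mul_assoc, hW, Matrix.mul_one, Matrix.one_mul, sub_self]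
    ext i
    exact congrFun (congrFun h1 i) k
  have h2 : (W * Wᵀ - 1) * U = 0 := by
    ext i k
    exact congrFun (hle (h (Submodule.subset_span ⟨k, rfl⟩)) : _ = _) i
  rwa [Matrix.sub_mul, Matrix.one_mul, sub_eq_zero, Matrix.mul_assoc] at h2

theorem sum_row_dotProduct {n r : ℕ} {U : Matrix (Fin n) (Fin r) ℝ} (hU : Uᵀ * U = 1) :
    ∑ i, U i ⬝ᵥ U i = r := by
  have h : (Uᵀ * U).trace = r := by rw [hU]; simp
  rw [← h, Matrix.trace]
  simp only [Matrix.diag_apply, Matrix.mul_apply, Matrix.transpose_apply]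
  rw [Finset.sum_comm]
  rfl

/-- Squared row norms sum to `r > 0`. This forces `x > 0`, which is not assumed and which `√x` alone
would not reveal, `√` being `0` on negatives. -/
theorem row_dotProduct_le {n r : ℕ} (hr : 0 < r) {U : Matrix (Fin n) (Fin r) ℝ} {x : ℝ}
    (hU : Uᵀ * U = 1) (h : ∀ i, ‖WithLp.toLp 2 (Uᵀ *ᵥ Pi.single i 1)‖ ≤ √x) :
    (∀ i, U i ⬝ᵥ U i ≤ x) ∧ (r : ℝ) ≤ n * x := by
  have h1 : ∀ i, U i ⬝ᵥ U i ≤ max x 0 := fun i => by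
    have h2 := pow_le_pow_left₀ (norm_nonneg _) (h i) 2
    rw [EuclideanSpace.norm_sq_eq] at h2
    have h3 : √x ^ 2 ≤ max x 0 := by
      rw [← Real.sq_sqrt (le_max_right x 0)]
      gcongr
      exact le_max_left _ _
    refine le_trans (le_of_eq ?_) (h2.trans h3)
    simp [dotProduct, sq]
  have h3 : (r : ℝ) ≤ n * max x 0 := by
    rw [← sum_row_dotProduct hU]
    refine (Finset.sum_le_sum fun i _ => h1 i).trans_eq ?_
    simp
  have hx : 0 < x := by
    by_contra hx
    rw [max_eq_right (not_lt.1 hx), mul_zero] at h3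
    have : (0 : ℝ) < r := by exact_mod_cast hr
    linarith
  rw [max_eq_left hx.le] at h1 h3
  exact ⟨h1, h3⟩

theorem row_dotProduct_le_one {n r : ℕ} {U : Matrix (Fin n) (Fin r) ℝ} (hU : Uᵀ * U = 1)
    (i : Fin n) : U i ⬝ᵥ U i ≤ 1 := by
  have h1 := (Matrix.isOrthProj_mul_transpose hU).dotProduct_add_compl (Pi.single i 1)
  have h2 := Matrix.dotProduct_self_nonneg' ((1 - U * Uᵀ) *ᵥ Pi.single i 1)
  rw [← Matrix.dotProduct_transpose_mulVec_self hU] at h1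
  simp only [Matrix.mulVec_single_one, single_one_dotProduct, Pi.single_eq_same] at h1
  have h4 : Uᵀ.col i = U i := rfl
  rw [h4] at h1
  simp only [Matrix.mulVec_single_one] at h2
  linarith

/-- A row of `U` is the image of the row of `W` under the contraction `(Wᵀ U)ᵀ`. Summed, this yields
`r ≤ s`; row by row, it transfers bounds from `W` to `U`. -/
theorem row_dotProduct_le_row_dotProduct {n r s : ℕ} {U : Matrix (Fin n) (Fin r) ℝ}
    {W : Matrix (Fin n) (Fin s) ℝ} (hU : Uᵀ * U = 1) (hWU : W * (Wᵀ * U) = U) (i : Fin n) :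
    U i ⬝ᵥ U i ≤ W i ⬝ᵥ W i := by
  have ho : (Wᵀ * U)ᵀ * (Wᵀ * U) = 1 := by
    rw [Matrix.transpose_mul, Matrix.transpose_transpose, Matrix.mul_assoc, hWU, hU]
  have h1 := (Matrix.isOrthProj_mul_transpose ho).dotProduct_add_compl (W i)
  have h2 := Matrix.dotProduct_self_nonneg' ((1 - Wᵀ * U * (Wᵀ * U)ᵀ) *ᵥ W i)
  have h3 : (Wᵀ * U)ᵀ *ᵥ W i = U i := by
    conv_rhs => rw [← hWU]
    rw [Matrix.mulVec_transpose]
    rfl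
  rw [← Matrix.dotProduct_transpose_mulVec_self ho, h3] at h1
  linarith

theorem sum_vecMulVec_rows {n s : ℕ} {W : Matrix (Fin n) (Fin s) ℝ} (hW : Wᵀ * W = 1) :
    ∑ i, Matrix.vecMulVec (W i) (W i) = 1 := by
  rw [← hW]
  ext a b
  rw [Matrix.sum_apply, Matrix.mul_apply]
  rfl

theorem sampleCoef_rows {n s : ℕ} (W W' : Matrix (Fin n) (Fin s) ℝ) (Z : Matrix (Fin s) (Fin s) ℝ)
    (x : Fin n × Fin n) :
    sampleCoef (fun i => W i) (fun j => W' j) x Z = (W * Z * W'ᵀ) x.1 x.2 := by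
  rw [sampleCoef_apply, Matrix.dotProduct_mulVec, Matrix.mul_apply']
  rfl

theorem proj_eq_proj_iff {m n : ℕ} {Ω : Set (Fin m × Fin n)} {Z W : Matrix (Fin m) (Fin n) ℝ} :
    proj Ω Z = proj Ω W ↔ ∀ x ∈ Ω, Z x.1 x.2 = W x.1 x.2 := by
  classical
  constructor
  · rintro h ⟨i, j⟩ hx
    have := congrFun (congrFun h i) j
    simpa [proj, hx] using this
  · intro h
    ext i j
    by_cases hx : (i, j) ∈ Ω
    · simpa [proj, hx] using h _ hx
    · simp [proj, hx]

theorem isUniqueOptimal_of_forall_lt {n s : ℕ} {Ubar Vbar : Matrix (Fin n) (Fin s) ℝ}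
    {M : Matrix (Fin n) (Fin n) ℝ} {Ω : Set (Fin n × Fin n)} {X : Matrix (Fin s) (Fin s) ℝ}
    (hX : Ubar * X * Vbarᵀ = M)
    (h : ∀ H : Matrix (Fin s) (Fin s) ℝ, H ≠ 0 →
      (∀ x ∈ Ω, sampleCoef (fun i => Ubar i) (fun j => Vbar j) x H = 0) →
      nuclearNorm X < nuclearNorm (X + H)) :
    IsUniqueOptimal Ubar Vbar M Ω X := by
  have key : ∀ Y, IsFeasible Ubar Vbar M Ω Y → Y ≠ X → nuclearNorm X < nuclearNorm Y := by
    intro Y hY hne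
    have h1 := h (Y - X) (sub_ne_zero.2 hne) fun x hx => by
      rw [sampleCoef_rows, Matrix.mul_sub, Matrix.sub_mul, hX, Matrix.sub_apply,
        proj_eq_proj_iff.1 hY x hx, sub_self]
    rwa [add_sub_cancel] at h1
  have hfeas : IsFeasible Ubar Vbar M Ω X := by rw [IsFeasible, hX]
  refine ⟨⟨hfeas, fun Y hY => ?_⟩, fun Y hY => ?_⟩
  · by_cases hne : Y = X
    · rw [hne]
    · exact (key Y hY hne).le
  · by_contra hne
    exact absurd (hY.2 X hfeas) (not_le.2 (key Y hY.1 hne))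

-- The certificate criterion at `r = 0`: the tangent space is trivial and `Y = 0` works.
open scoped Matrix.Norms.L2Operator in
theorem nuclearNorm_zero_lt {s : ℕ} {H : Matrix (Fin s) (Fin s) ℝ} (hH : H ≠ 0) :
    nuclearNorm (0 : Matrix (Fin s) (Fin s) ℝ) < nuclearNorm H := by
  have h := nuclearNorm_lt_of_certificate (r := 0) (U := 0) (V := 0)
    (σ := fun _ => 0) (Subsingleton.elim _ _) (Subsingleton.elim _ _) (fun _ => le_rfl)
    (H := H) (Y := 0) (ε := 0) (κ := 0) (by simp) (by simp) (by simp [Matrix.tangentProj_apply])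
    (by simp [Matrix.tangentProj_apply]) le_rfl (by norm_num) hH
  simpa using h

/-- The map `(Ubarᵀ U)ᵀ` sends the rows of `Ubar` to those of `U`, so the projected row norms are
the row norms of `U`. -/
theorem incoherentFrame_rows {n r s : ℕ} {U V : Matrix (Fin n) (Fin r) ℝ}
    {Ubar Vbar : Matrix (Fin n) (Fin s) ℝ} {A B : ℝ} (hU : Uᵀ * U = 1) (hV : Vᵀ * V = 1)
    (hUb : Ubarᵀ * Ubar = 1) (hVb : Vbarᵀ * Vbar = 1)
    (hUU : Ubar * (Ubarᵀ * U) = U) (hVV : Vbar * (Vbarᵀ * V) = V) (hA : 0 ≤ A) (hAB : A ≤ B)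
    (hu : ∀ i, U i ⬝ᵥ U i ≤ A) (hv : ∀ i, V i ⬝ᵥ V i ≤ A)
    (hub : ∀ i, Ubar i ⬝ᵥ Ubar i ≤ B) (hvb : ∀ i, Vbar i ⬝ᵥ Vbar i ≤ B) :
    IncoherentFrame (fun i => Ubar i) (fun j => Vbar j) (Ubarᵀ * U * (Ubarᵀ * U)ᵀ)
      (Vbarᵀ * V * (Vbarᵀ * V)ᵀ) A B := by
  have orth : ∀ {W : Matrix (Fin n) (Fin r) ℝ} {Wb : Matrix (Fin n) (Fin s) ℝ}, Wᵀ * W = 1 →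
      Wb * (Wbᵀ * W) = W → (Wbᵀ * W)ᵀ * (Wbᵀ * W) = 1 := fun {W Wb} h1 h2 => by
    rw [Matrix.transpose_mul, Matrix.transpose_transpose, Matrix.mul_assoc, h2, h1]
  have row : ∀ {W : Matrix (Fin n) (Fin r) ℝ} {Wb : Matrix (Fin n) (Fin s) ℝ},
      Wb * (Wbᵀ * W) = W → ∀ i, (Wbᵀ * W)ᵀ *ᵥ Wb i = W i := fun {W Wb} h i => by
    conv_rhs => rw [← h]
    rw [Matrix.mulVec_transpose]
    rfl
  refine ⟨Matrix.isOrthProj_mul_transpose (orth hU hUU),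
    Matrix.isOrthProj_mul_transpose (orth hV hVV), sum_vecMulVec_rows hUb,
    sum_vecMulVec_rows hVb, hA, hAB, hub, hvb, fun i => ?_, fun i => ?_⟩
  · rw [← Matrix.dotProduct_transpose_mulVec_self (orth hU hUU), row hUU]; exact hu i
  · rw [← Matrix.dotProduct_transpose_mulVec_self (orth hV hVV), row hVV]; exact hv i

theorem isUniqueOptimal_of_rank_zero {n s : ℕ} {Ubar Vbar : Matrix (Fin n) (Fin s) ℝ}
    (Ω : Set (Fin n × Fin n)) :
    IsUniqueOptimal Ubar Vbar 0 Ω (Ubarᵀ * (0 : Matrix (Fin n) (Fin n) ℝ) * Vbar) := by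
  have e : Ubarᵀ * (0 : Matrix (Fin n) (Fin n) ℝ) * Vbar = 0 := by simp
  rw [e]
  refine isUniqueOptimal_of_forall_lt (by simp) fun H hH _ => ?_
  rw [zero_add]
  exact nuclearNorm_zero_lt hH

theorem observationLaw_isUniqueOptimal_ge_of_pos {n r s : ℕ} (hn : 2 ≤ n) (hr : 0 < r)
    {M : Matrix (Fin n) (Fin n) ℝ} {U V : Matrix (Fin n) (Fin r) ℝ} {σ : Fin r → ℝ}
    {Ubar Vbar : Matrix (Fin n) (Fin s) ℝ} {μ₀ μbar₀ : ℝ} {p : unitInterval}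
    (hM : IsCompactSVD M U σ V) (hUb : Ubarᵀ * Ubar = 1) (hVb : Vbarᵀ * Vbar = 1)
    (hUcol : col U ≤ col Ubar) (hVcol : col V ≤ col Vbar) (hinc : StandardIncoherence U V μ₀)
    (hincb : StandardIncoherence Ubar Vbar μbar₀)
    (hp : 4096 * (μ₀ * μbar₀ * r * s * Real.log (32 * μbar₀ * s) * Real.log n / n ^ 2) ≤ (p : ℝ)) :
    1 - 2000 * (n : ℝ)⁻¹ ≤ (observationLaw n p).real
      {Ω | IsUniqueOptimal Ubar Vbar M Ω (Ubarᵀ * M * Vbar)} := by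
  have hn2 : (2 : ℝ) ≤ n := by exact_mod_cast hn
  have hn0 : (0 : ℝ) < n := by linarith
  have hU := hM.left_orthonormal
  have hV := hM.right_orthonormal
  have hUU := transpose_mul_mul_of_col_le hUb hUcol
  have hVV := transpose_mul_mul_of_col_le hVb hVcol
  have hUo : (Ubarᵀ * U)ᵀ * (Ubarᵀ * U) = 1 := by
    rw [Matrix.transpose_mul, Matrix.transpose_transpose, Matrix.mul_assoc, hUU, hU]
  have hVo : (Vbarᵀ * V)ᵀ * (Vbarᵀ * V) = 1 := by
    rw [Matrix.transpose_mul, Matrix.transpose_transpose, Matrix.mul_assoc, hVV, hV]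
  have hr1 : (1 : ℝ) ≤ r := by exact_mod_cast hr
  have hrs : (r : ℝ) ≤ s := by
    rw [← sum_row_dotProduct hU, ← sum_row_dotProduct hUb]
    exact Finset.sum_le_sum fun i _ => row_dotProduct_le_row_dotProduct hU hUU i
  have hs : 0 < s := by
    have : (0 : ℝ) < s := by linarith
    exact_mod_cast this
  have hsn : s ≤ n := by
    have : (s : ℝ) ≤ n := by
      rw [← sum_row_dotProduct hUb]
      refine (Finset.sum_le_sum fun i _ => row_dotProduct_le_one hUb i).trans_eq ?_
      simp
    exact_mod_cast this
  obtain ⟨hu, hrA⟩ := row_dotProduct_le hr hU hinc.1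
  obtain ⟨hv, -⟩ := row_dotProduct_le hr hV hinc.2
  obtain ⟨hub, hsB⟩ := row_dotProduct_le hs hUb hincb.1
  obtain ⟨hvb, -⟩ := row_dotProduct_le hs hVb hincb.2
  set A₀ := μ₀ * r / n with hA₀
  set B₀ := μbar₀ * s / n with hB₀
  -- Nothing orders `μ₀ r` against `μbar₀ rbar` or bounds `B₀` by `1`. The truncated values are
  -- still valid row bounds, and they only lower the required rate.
  set B := min B₀ 1 with hB
  set A := min A₀ B with hA
  have hnA : 1 ≤ n * A := by
    rw [hA, hB, mul_min_of_nonneg _ _ hn0.le, mul_min_of_nonneg _ _ hn0.le]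
    exact le_min (by linarith) (le_min (by linarith) (by linarith))
  have hA0 : 0 ≤ A := (pos_of_mul_pos_right (by linarith) hn0.le).le
  have hubB : ∀ i, Ubar i ⬝ᵥ Ubar i ≤ B := fun i => le_min (hub i) (row_dotProduct_le_one hUb i)
  have hvbB : ∀ i, Vbar i ⬝ᵥ Vbar i ≤ B := fun i => le_min (hvb i) (row_dotProduct_le_one hVb i)
  have F : IncoherentFrame (fun i => Ubar i) (fun j => Vbar j) (Ubarᵀ * U * (Ubarᵀ * U)ᵀ)
      (Vbarᵀ * V * (Vbarᵀ * V)ᵀ) A B :=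
    incoherentFrame_rows hU hV hUb hVb hUU hVV hA0 (min_le_right _ _)
      (fun i => le_min (hu i) ((row_dotProduct_le_row_dotProduct hU hUU i).trans (hubB i)))
      (fun i => le_min (hv i) ((row_dotProduct_le_row_dotProduct hV hVV i).trans (hvbB i)))
      hubB hvbB
  have hnB : 1 ≤ n * B := hnA.trans (mul_le_mul_of_nonneg_left F.le hn0.le)
  have hrate : 4096 * (A * B * Real.log (32 * (n * B)) * Real.log n) ≤ (p : ℝ) := by
    refine le_trans ?_ hp
    have e1 : 32 * μbar₀ * s = 32 * (n * B₀) := by rw [hB₀]; field_simp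
    have e2 : μ₀ * μbar₀ * r * s * Real.log (32 * μbar₀ * s) * Real.log n / n ^ 2
        = A₀ * B₀ * Real.log (32 * (n * B₀)) * Real.log n := by
      rw [e1, hA₀, hB₀]; field_simp
    rw [e2]
    have hB0 : 0 ≤ B := F.nonneg'
    have hBB : B ≤ B₀ := min_le_left _ _
    have hAA : A ≤ A₀ := min_le_left _ _
    have hl : 0 ≤ Real.log (32 * (n * B)) := Real.log_nonneg (by linarith)
    have hln : 0 ≤ Real.log n := Real.log_nonneg (by linarith)
    have hll : Real.log (32 * (n * B)) ≤ Real.log (32 * (n * B₀)) :=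
      Real.log_le_log (by linarith) (by gcongr)
    have hA₀0 : 0 ≤ A₀ := hA0.trans hAA
    have hB₀0 : 0 ≤ B₀ := hB0.trans hBB
    gcongr
  have h := F.bernProb_isStrictlyRecovered_ge_of_rate hUo hVo (fun k => (hM.singular_pos k).le)
    hn hsn hnA (min_le_right _ _) p.2.2 hrate
  rw [setBernoulli_real_eq_bernProb]
  refine h.trans (bernProb_mono p.2.1 p.2.2 fun S hS => ?_)
  have eX : Ubarᵀ * M * Vbar = Ubarᵀ * U * Matrix.diagonal σ * (Vbarᵀ * V)ᵀ := by
    rw [hM.eq_mul, Matrix.transpose_mul, Matrix.transpose_transpose]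
    simp only [Matrix.mul_assoc]
  rw [eX]
  refine isUniqueOptimal_of_forall_lt ?_ fun H hH hx => hS H hH fun x hxS => hx x hxS
  calc Ubar * (Ubarᵀ * U * Matrix.diagonal σ * (Vbarᵀ * V)ᵀ) * Vbarᵀ
      = Ubar * (Ubarᵀ * U) * Matrix.diagonal σ * (Vbar * (Vbarᵀ * V))ᵀ := by
        rw [Matrix.transpose_mul Vbar]
        simp only [Matrix.mul_assoc]
    _ = M := by rw [hUU, hVV, hM.eq_mul]

theorem observationLaw_isUniqueOptimal_ge {n r s : ℕ}
    {M : Matrix (Fin n) (Fin n) ℝ} {U V : Matrix (Fin n) (Fin r) ℝ} {σ : Fin r → ℝ}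
    {Ubar Vbar : Matrix (Fin n) (Fin s) ℝ} {μ₀ μbar₀ : ℝ} {p : unitInterval}
    (hM : IsCompactSVD M U σ V) (hUb : Ubarᵀ * Ubar = 1) (hVb : Vbarᵀ * Vbar = 1)
    (hUcol : col U ≤ col Ubar) (hVcol : col V ≤ col Vbar) (hinc : StandardIncoherence U V μ₀)
    (hincb : StandardIncoherence Ubar Vbar μbar₀)
    (hp : 4096 * (μ₀ * μbar₀ * r * s * Real.log (32 * μbar₀ * s) * Real.log n / n ^ 2) ≤ (p : ℝ)) :
    1 - 2000 * (n : ℝ) ^ (-1 : ℝ) ≤ (observationLaw n p).real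
      {Ω | IsUniqueOptimal Ubar Vbar M Ω (Ubarᵀ * M * Vbar)} := by
  rw [Real.rpow_neg_one]
  have hinv : 0 ≤ (n : ℝ)⁻¹ := by positivity
  rcases Nat.eq_zero_or_pos r with rfl | hr
  · have hM0 : M = 0 := by
      rw [hM.eq_mul]
      ext i j
      simp [Matrix.mul_apply]
    subst hM0
    have huniv : {Ω | IsUniqueOptimal Ubar Vbar 0 Ω
        (Ubarᵀ * (0 : Matrix (Fin n) (Fin n) ℝ) * Vbar)} = Set.univ :=
      Set.eq_univ_of_forall fun Ω => isUniqueOptimal_of_rank_zero Ω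
    rw [huniv, MeasureTheory.probReal_univ]
    linarith
  · rcases lt_or_ge n 2 with hn | hn
    -- At `n = 1` the bound is negative. At `n = 0` it would be `1`, because `0⁻¹ = 0`, but positive
    -- rank excludes that case.
    · refine le_trans ?_ MeasureTheory.measureReal_nonneg
      have hn1 : n = 1 := by
        rcases Nat.eq_zero_or_pos n with rfl | hn0
        · have h := sum_row_dotProduct hM.left_orthonormal
          rw [Finset.univ_eq_empty, Finset.sum_empty] at h
          exact absurd (by exact_mod_cast h : 0 = r) hr.ne
        · omega
      subst hn1
      norm_num
    · exact observationLaw_isUniqueOptimal_ge_of_pos hn hr hM hUb hVb hUcol hVcol hinc hincb hp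

end StructuredCompletion

theorem theorem2 :
    ∃ c₀ c₁ c₂ : ℝ, 0 < c₀ ∧ 0 < c₁ ∧ 0 < c₂ ∧
      ∀ (n r rbar : ℕ) (M : Matrix (Fin n) (Fin n) ℝ)
        (U V : Matrix (Fin n) (Fin r) ℝ) (σ : Fin r → ℝ)
        (Ubar Vbar : Matrix (Fin n) (Fin rbar) ℝ) (μ₀ μbar₀ : ℝ) (p : unitInterval),
        StructuredCompletion.IsCompactSVD M U σ V →
        Ubarᵀ * Ubar = 1 →
        Vbarᵀ * Vbar = 1 →
        StructuredCompletion.col U ≤ StructuredCompletion.col Ubar →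
        StructuredCompletion.col V ≤ StructuredCompletion.col Vbar →
        StructuredCompletion.StandardIncoherence U V μ₀ →
        StructuredCompletion.StandardIncoherence Ubar Vbar μbar₀ →
        c₀ * (μ₀ * μbar₀ * r * rbar * Real.log (32 * μbar₀ * rbar) * Real.log n / n ^ 2)
          ≤ (p : ℝ) →
        1 - c₁ * (n : ℝ) ^ (-c₂) ≤
          (StructuredCompletion.observationLaw n p).real
            {Ω | StructuredCompletion.IsUniqueOptimal Ubar Vbar M Ω (Ubarᵀ * M * Vbar)} := by
  refine ⟨4096, 2000, 1, by norm_num, by norm_num, by norm_num, ?_⟩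
  intro n r rbar M U V σ Ubar Vbar μ₀ μbar₀ p hM hUb hVb hUcol hVcol hinc hincb hp
  exact StructuredCompletion.observationLaw_isUniqueOptimal_ge hM hUb hVb hUcol hVcol hinc hincb hp
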